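/- **Setting.** Let $\mathbb K$ be a field of characteristic zero, $R$ a commutative $\mathbb K$-algebra, $\mathfrak h=\mathbb K\langle x,y\rangle$, $\mathfrak h^1=\mathbb K+\mathfrak hy$, $\mathfrak h^0=\mathbb K+x\mathfrak hy$, $z_k=x^{k-1}y$. Let $\mathbin{\sqcup\!\sqcup}$ be the shuffle product on $\mathfrak h$ ($w\,\mathbin{\sqcup\!\sqcup}\,1=1\,\mathbin{\sqcup\!\sqcup}\,w=w$, $au\,\mathbin{\sqcup\!\sqcup}\,bv=a(u\,\mathbin{\sqcup\!\sqcup}\,bv)+b(au\,\mathbin{\sqcup\!\sqcup}\,v)$ for letters $a,b$ and words $u,v,w$) and $\ast$ the stuffle product on $\mathfrak h^1$ ($w\ast1=1\ast w=w$, $z_ku\ast z_lv=z_k(u\ast z_lv)+z_l(z_ku\ast v)+z_{k+l}(u\ast v)$), both $\mathbb K$-bilinear. As $(\mathfrak h^1,\mathbin{\sqcup\!\sqcup})=(\mathfrak h^0,\mathbin{\sqcup\!\sqcup})[y]$ is a polynomial algebra, every $w\in\mathfrak h^1$ is uniquely $w=\sum_{i\ge0} w_i\,\mathbin{\sqcup\!\sqcup}\,y^{\sqcup\!\sqcup\,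 i}$ with $w_i\in\mathfrak h^0$; put $\mathrm{reg}_{\sqcup\!\sqcup}(w)=w_0$. A $\mathbb K$-linear map $Z_R:\mathfrak h^0\to R$ satisfies the regularized double shuffle relations if $Z_R(1)=1$, $Z_R(u\,\mathbin{\sqcup\!\sqcup}\,v)=Z_R(u)Z_R(v)=Z_R(u\ast v)$ for all $u,v\in\mathfrak h^0$, and $Z_R(\mathrm{reg}_{\sqcup\!\sqcup}(w_1\,\mathbin{\sqcup\!\sqcup}\,w_0-w_1\ast w_0))=0$ for all $w_1\in\mathfrak h^1$, $w_0\in\mathfrak h^0$. Let $S:\mathfrak h\to\mathfrak h$ be the $\mathbb K$-linear map with $S(1)=1$ and $S(wa)=\sigma(w)a$ for words $w$ and letters $a$, where $\sigma$ is the algebra automorphism of $\mathfrak h$ with $\sigma(x)=x$, $\sigma(y)=x+y$. For an index $(k_1,\dots,k_n)$ of positive integers that is empty or has $k_1\ge2$, put $\zeta_R(k_1,\dots,k_n)=Z_R(z_{k_1}\cdots z_{k_n})$ and $\zeta_R^\star(k_1,\dots,k_n)=Z_R(S(z_{k_1}\cdots z_{k_n}))$. Let $\lambda$ be an element of a commutative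 $R$-algebra with $\lambda^2=-24\,\zeta_R(2)$; the identities below that contain $\lambda$ hold in that algebra. Let $\sum_{n\ge0}\frac{B_n}{n!}t^n=\frac t{e^t-1}$ and $\beta_k=\frac{2^{1-2k}-1}{(2k)!}B_{2k}$. Here $\{a_1,\dots,a_r\}^n$ denotes the sequence $a_1,\dots,a_r$ repeated $n$ times. **Theorem.** Assume that $Z_R:\mathfrak h^0\to R$ satisfies the regularized double shuffle relations. Then: 1. For every $n\ge0$, $\zeta_R(2n)=-\dfrac{\lambda^{2n}}{2(2n)!}B_{2n}$, where $\zeta_R(0):=-\frac12$. 2. For every $n\ge1$, $\zeta_R^\star(\{2\}^n)=(2^{1-2n}-1)\dfrac{\lambda^{2n}}{(2n)!}B_{2n}=2(1-2^{1-2n})\,\zeta_R(2n)$. 3. For every $k\ge1$ and $n\ge0$, $\zeta_R(\{2k\}^n)=C_n^{(k)}\dfrac{\lambda^{2nk}}{(2nk)!}$, where $C_n^{(k)}\in\mathbb Q$ is given by $C_0^{(k)}=1$ and $C_n^{(k)}=\dfrac1{2n}\sum_{m=1}^n(-1)^m\binom{2nk}{2mk}B_{2mk}C_{n-m}^{(k)}$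 for $n\ge1$. 4. For every $k\ge1$ and $n\ge0$, $\zeta_R^\star(\{2k\}^n)=C_n^{\star,(k)}\dfrac{\lambda^{2nk}}{(2nk)!}$, where $C_n^{\star,(k)}\in\mathbb Q$ is given by $C_0^{\star,(k)}=1$ and $C_n^{\star,(k)}=-\dfrac1{2n}\sum_{m=1}^n\binom{2nk}{2mk}B_{2mk}C_{n-m}^{\star,(k)}$ for $n\ge1$. 5. For all integers $m\ge2n\ge0$, $$\sum_{\substack{m_0+\cdots+m_{2n}=m-2n\\ m_0,\dots,m_{2n}\ge0}}\zeta_R(\{2\}^{m_0},3,\{2\}^{m_1},1,\{2\}^{m_2},\dots,3,\{2\}^{m_{2n-1}},1,\{2\}^{m_{2n}})=(-1)^m\frac{2}{4^m(2m+2)!}\binom{m+1}{2n+1}\lambda^{2m}.$$ In particular, for every $n\ge0$, $\zeta_R(\{3,1\}^n)=\dfrac{\lambda^{4n}}{2^{4n-1}(4n+2)!}$, and the sum of $\zeta_R$ over the $2n+1$ indices obtained by inserting one entry $2$ into $\{3,1\}^n$, namely $\zeta_R(2,\{3,1\}^n)+\zeta_R(3,2,1,\{3,1\}^{n-1})+\cdots+\zeta_R(\{3,1\}^n,2)$,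 equals $-\dfrac{\lambda^{4n+2}}{4^{2n+1}(4n+3)!}$. 6. For all integers $m\ge2n\ge0$, $$\sum_{\substack{m_0+\cdots+m_{2n}=m-2n\\ m_0,\dots,m_{2n}\ge0}}\zeta_R^\star(\{2\}^{m_0},3,\{2\}^{m_1},1,\{2\}^{m_2},\dots,3,\{2\}^{m_{2n-1}},1,\{2\}^{m_{2n}})=\sum_{\substack{2j+k+u=2n\\ i+k+l+u+v=m\\ k,l,u,v\ge0,\ i\ge2j\ge0}}(-1)^k\binom{k+l}k\binom{u+v}u\binom{i+1}{2j+1}\frac{\beta_{k+l}\beta_{u+v}}{2^{2i-1}(2i+2)!}\lambda^{2m}.$$ In particular, for every $n\ge0$, $$\zeta_R^\star(\{3,1\}^n)=\sum_{\substack{2j+k+u=2n\\ j,k,u\ge0}}(-1)^k\frac{\beta_k\beta_u}{2^{4j-1}(4j+2)!}\lambda^{4n},$$ and the sum of $\zeta_R^\star$ over the $2n+1$ indices obtained by inserting one entry $2$ into $\{3,1\}^n$ equals $$\sum_{j=0}^n\left\{\frac1{4^{2j+1}(4j+3)!}\sum_{\substack{k+u=2(n-j)\\ k,u\ge0}}(-1)^k\beta_k\beta_u-\frac1{4^{2j-1}(4j+2)!}\sum_{\substack{k+u=2(n-j)+1\\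 k\ge1,\,u\ge0}}(-1)^kk\beta_k\beta_u\right\}\lambda^{4n+2}.$$ -/

import Mathlib

/-! Algebraic set-up of multiple zeta values: words in two letters, the shuffle and stuffle
products, and the regularized double shuffle relations. -/

namespace MZV

/-- The alphabet `{x, y}`. -/
inductive Letter : Type
  | x : Letter
  | y : Letter

noncomputable section

/-- `𝔥 = K⟨x, y⟩`, the noncommutative polynomials in `x` and `y`. -/
abbrev H (K : Type*) [Field K] : Type _ := FreeAlgebra K Letter

section

variable (K : Type*) [Field K]

/-- The letter `x` as an element of `𝔥`. -/
def X : H K := FreeAlgebra.ι K Letter.x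

/-- The letter `y` as an element of `𝔥`. -/
def Y : H K := FreeAlgebra.ι K Letter.y

/-- The word with the given letters, as an element of `𝔥`. -/
def word (w : List Letter) : H K := (w.map (FreeAlgebra.ι K)).prod

/-- `z_k = x^{k-1} y` for `k ≥ 1`. -/
def z (k : ℕ) : H K := X K ^ (k - 1) * Y K

/-- `z_{k_1} ⋯ z_{k_n}`. -/
def zProd (ks : List ℕ) : H K := (ks.map (z K)).prod

/-- The subspace `𝔥 y`. -/
def hY : Submodule K (H K) := LinearMap.range (LinearMap.mulRight K (Y K))

/-- `𝔥¹ = K + 𝔥 y`. -/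
def h1 : Submodule K (H K) := Submodule.span K {1} ⊔ hY K

/-- `𝔥⁰ = K + x 𝔥 y`. -/
def h0 : Submodule K (H K) :=
  Submodule.span K {1} ⊔ LinearMap.range (LinearMap.mulLeft K (X K) ∘ₗ LinearMap.mulRight K (Y K))

/-- The linear map on `𝔥` with prescribed values on words (words are a basis of `𝔥`). -/
def extend {M : Type*} [AddCommGroup M] [Module K M] (f : List Letter → M) : H K →ₗ[K] M :=
  (FreeAlgebra.basisFreeMonoid K Letter).constr K fun w => f w.toList

/-- The bilinear product on `𝔥` with prescribed values on pairs of words. -/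
def extend₂ (f : List Letter → List Letter → H K) : H K →ₗ[K] H K →ₗ[K] H K :=
  extend K fun u => extend K (f u)

/-- The shuffle product of two words:
`w ⧢ 1 = 1 ⧢ w = w` and `au ⧢ bv = a (u ⧢ bv) + b (au ⧢ v)`. -/
def shuffleWord : List Letter → List Letter → H K
  | [], w => word K w
  | a :: u, [] => word K (a :: u)
  | a :: u, b :: v =>
      FreeAlgebra.ι K a * shuffleWord u (b :: v) + FreeAlgebra.ι K b * shuffleWord (a :: u) v
  termination_by u v => u.length + v.length

/-- The shuffle product on `𝔥`. -/
def shuffle : H K →ₗ[K] H K →ₗ[K] H K := extend₂ K (shuffleWord K)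

/-- The stuffle product of `z_{k_1} ⋯ z_{k_n}` and `z_{l_1} ⋯ z_{l_m}`:
`w ∗ 1 = 1 ∗ w = w` and `z_k u ∗ z_l v = z_k (u ∗ z_l v) + z_l (z_k u ∗ v) + z_{k+l} (u ∗ v)`. -/
def stuffleIndex : List ℕ → List ℕ → H K
  | [], ls => zProd K ls
  | k :: ks, [] => zProd K (k :: ks)
  | k :: ks, l :: ls =>
      z K k * stuffleIndex ks (l :: ls) + z K l * stuffleIndex (k :: ks) ls
        + z K (k + l) * stuffleIndex ks ls
  termination_by ks ls => ks.length + ls.length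

end

/-- Reads `x^c w` as a product of `z_k`s and returns the list of the `k`s; this recovers the index
of every word in `𝔥¹` (a trailing block of `x`s, which such words do not have, is ignored). -/
def toIndexAux : ℕ → List Letter → List ℕ
  | _, [] => []
  | c, Letter.x :: w => toIndexAux (c + 1) w
  | c, Letter.y :: w => (c + 1) :: toIndexAux 0 w

/-- The list `(k_1, …, k_n)` such that the given word of `𝔥¹` is `z_{k_1} ⋯ z_{k_n}`. -/
def toIndex (w : List Letter) : List ℕ := toIndexAux 0 w

section

variable (K : Type*) [Field K]

/-- The stuffle product. It is only meaningful, and only used, on `𝔥¹`. -/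
def stuffle : H K →ₗ[K] H K →ₗ[K] H K :=
  extend₂ K fun u v => stuffleIndex K (toIndex u) (toIndex v)

/-- The automorphism `σ` of the noncommutative algebra `𝔥` with `σ x = x` and `σ y = x + y`. -/
def sigma : H K →ₐ[K] H K :=
  FreeAlgebra.lift K fun a => match a with
    | Letter.x => X K
    | Letter.y => X K + Y K

/-- The values on words of the map `S`: `S 1 = 1` and `S (w a) = σ(w) a`. -/
def SWord (w : List Letter) : H K :=
  match w.getLast? with
  | none => 1
  | some a => sigma K (word K w.dropLast) * FreeAlgebra.ι K a

/-- The linear map `S` on `𝔥`. -/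
def S : H K →ₗ[K] H K := extend K (SWord K)

/-- The powers of `y` for the shuffle product. -/
def shufflePowY : ℕ → H K
  | 0 => 1
  | i + 1 => shuffle K (Y K) (shufflePowY i)

/-! ### The subspaces are stable -/

theorem basis_ofList (w : List Letter) :
    FreeAlgebra.basisFreeMonoid K Letter (FreeMonoid.ofList w) = word K w := by
  simp only [FreeAlgebra.basisFreeMonoid, Module.Basis.map_apply, Finsupp.coe_basisSingleOne]
  change FreeAlgebra.equivMonoidAlgebraFreeMonoid.symm
    (MonoidAlgebra.single (FreeMonoid.ofList w) (1 : K)) = _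
  change MonoidAlgebra.lift K (FreeAlgebra K Letter) (FreeMonoid Letter)
    (FreeMonoid.lift (FreeAlgebra.ι K)) _ = _
  rw [MonoidAlgebra.lift_single, one_smul, FreeMonoid.lift_ofList]
  rfl

theorem extend_word {M : Type*} [AddCommGroup M] [Module K M] (f : List Letter → M)
    (w : List Letter) : extend K f (word K w) = f w := by
  rw [← basis_ofList, extend, Module.Basis.constr_basis]; rfl

theorem extend₂_word (f : List Letter → List Letter → H K) (u v : List Letter) :
    extend₂ K f (word K u) (word K v) = f u v := by
  rw [extend₂, extend_word, extend_word]

theorem mem_span_word (p : H K) : p ∈ Submodule.span K (Set.range (word K)) := by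
  have h : Set.range (word K) = Set.range (FreeAlgebra.basisFreeMonoid K Letter) := by
    ext q; constructor
    · rintro ⟨w, rfl⟩; exact ⟨_, basis_ofList K w⟩
    · rintro ⟨w, rfl⟩; exact ⟨w.toList, (basis_ofList K _).symm⟩
  rw [h, Module.Basis.span_eq]; trivial

theorem word_append (u v : List Letter) : word K (u ++ v) = word K u * word K v := by
  simp [word]

theorem word_cons (a : Letter) (v : List Letter) :
    word K (a :: v) = FreeAlgebra.ι K a * word K v := by
  simp [word]

theorem mul_Y_mem (p : H K) : p * Y K ∈ hY K := ⟨p, rfl⟩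

theorem mul_mem_hY (p : H K) {q : H K} (hq : q ∈ hY K) : p * q ∈ hY K := by
  obtain ⟨r, rfl⟩ := hq
  exact ⟨p * r, by simp [mul_assoc]⟩

theorem Y_mul_mem_hY {q : H K} (hq : q ∈ h1 K) : Y K * q ∈ hY K := by
  obtain ⟨a, ha, b, hb, rfl⟩ := Submodule.mem_sup.1 hq
  obtain ⟨c, rfl⟩ := Submodule.mem_span_singleton.1 ha
  rw [mul_add]
  refine add_mem ?_ (mul_mem_hY K _ hb)
  simpa using (hY K).smul_mem c (mul_Y_mem K 1)

theorem one_mem_h0 : (1 : H K) ∈ h0 K :=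
  Submodule.mem_sup_left (Submodule.mem_span_singleton_self 1)

theorem X_mul_mem_h0 {q : H K} (hq : q ∈ hY K) : X K * q ∈ h0 K := by
  obtain ⟨r, rfl⟩ := hq
  exact Submodule.mem_sup_right ⟨r, by simp⟩

theorem h0_le_span : h0 K ≤ Submodule.span K
    (word K '' {w | w = [] ∨ ∃ u, w = Letter.x :: (u ++ [Letter.y])}) := by
  refine sup_le ?_ ?_
  · rw [Submodule.span_singleton_le_iff_mem]
    exact Submodule.subset_span ⟨[], Or.inl rfl, by simp [word]⟩
  · rintro _ ⟨p, rfl⟩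
    induction mem_span_word K p using Submodule.span_induction with
    | mem q hq =>
      obtain ⟨w, rfl⟩ := hq
      refine Submodule.subset_span ⟨Letter.x :: (w ++ [Letter.y]), Or.inr ⟨w, rfl⟩, ?_⟩
      simp [X, Y, word]
    | zero => simp
    | add a b _ _ ha hb => rw [map_add]; exact add_mem ha hb
    | smul c a _ ha => rw [map_smul]; exact Submodule.smul_mem _ c ha

theorem extend₂_mem_h0 (f : List Letter → List Letter → H K)
    (hf₁ : ∀ u, u = [] ∨ (∃ u', u = Letter.x :: (u' ++ [Letter.y])) →
      f [] u ∈ h0 K ∧ f u [] ∈ h0 K)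
    (hf₂ : ∀ u v, f (Letter.x :: (u ++ [Letter.y])) (Letter.x :: (v ++ [Letter.y])) ∈ h0 K)
    {p q : H K} (hp : p ∈ h0 K) (hq : q ∈ h0 K) : extend₂ K f p q ∈ h0 K := by
  refine LinearMap.BilinMap.apply_apply_mem_of_mem_span (h0 K) _ _ (extend₂ K f) ?_ p q
    (h0_le_span K hp) (h0_le_span K hq)
  rintro _ ⟨u, hu, rfl⟩ _ ⟨v, hv, rfl⟩
  rw [extend₂_word]
  rcases hu with rfl | ⟨u, rfl⟩
  · exact (hf₁ v hv).1
  rcases hv with rfl | ⟨v, rfl⟩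
  · exact (hf₁ _ (Or.inr ⟨u, rfl⟩)).2
  exact hf₂ u v

theorem word_append_y_mem (u : List Letter) : word K (u ++ [Letter.y]) ∈ hY K := by
  rw [word_append]; exact ⟨word K u, by simp [word, Y]⟩

theorem word_x_y_mem (u : List Letter) : word K (Letter.x :: (u ++ [Letter.y])) ∈ h0 K := by
  rw [word_cons]; exact X_mul_mem_h0 K (word_append_y_mem K u)

theorem shuffleWord_nil (u : List Letter) : shuffleWord K u [] = word K u := by
  cases u <;> simp [shuffleWord]

theorem shuffleWord_mem (u v : List Letter) :
    shuffleWord K (u ++ [Letter.y]) (v ++ [Letter.y]) ∈ hY K := by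
  induction hn : u.length + v.length using Nat.strong_induction_on generalizing u v with
  | _ n ih =>
    subst hn
    have h1 : ∀ a u', u = a :: u' →
        shuffleWord K (u' ++ [Letter.y]) (v ++ [Letter.y]) ∈ hY K := by
      rintro a u' rfl; exact ih _ (by simp) u' v rfl
    have h2 : ∀ b v', v = b :: v' →
        shuffleWord K (u ++ [Letter.y]) (v' ++ [Letter.y]) ∈ hY K := by
      rintro b v' rfl; exact ih _ (by simp) u v' rfl
    cases u with
    | nil =>
      cases v with
      | nil =>
        simp only [List.nil_append, shuffleWord]
        exact add_mem (mul_mem_hY K _ (word_append_y_mem K []))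
          (mul_mem_hY K _ (word_append_y_mem K []))
      | cons b v =>
        have := h2 b v rfl
        simp only [List.nil_append, List.cons_append, shuffleWord] at this ⊢
        exact add_mem (mul_mem_hY K _ (word_append_y_mem K (b :: v))) (mul_mem_hY K _ this)
    | cons a u =>
      have h1' := h1 a u rfl
      cases v with
      | nil =>
        simp only [List.nil_append, List.cons_append, shuffleWord] at h1' ⊢
        exact add_mem (mul_mem_hY K _ h1') (mul_mem_hY K _ (word_append_y_mem K (a :: u)))
      | cons b v =>
        have h2' := h2 b v rfl
        simp only [List.cons_append, shuffleWord] at h1' h2' ⊢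
        exact add_mem (mul_mem_hY K _ h1') (mul_mem_hY K _ h2')

theorem shuffle_mem_h0 {p q : H K} (hp : p ∈ h0 K) (hq : q ∈ h0 K) :
    shuffle K p q ∈ h0 K := by
  refine extend₂_mem_h0 K _ ?_ ?_ hp hq
  · rintro u (rfl | ⟨u, rfl⟩)
    · simpa [shuffleWord, word] using one_mem_h0 K
    · rw [shuffleWord_nil, shuffleWord]
      exact ⟨word_x_y_mem K u, word_x_y_mem K u⟩
  · intro u v
    rw [shuffleWord]
    exact add_mem (X_mul_mem_h0 K (shuffleWord_mem K u (Letter.x :: v)))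
      (X_mul_mem_h0 K (shuffleWord_mem K (Letter.x :: u) v))

theorem z_mul_mem_hY (k : ℕ) {q : H K} (hq : q ∈ h1 K) : z K k * q ∈ hY K := by
  rw [z, mul_assoc]; exact mul_mem_hY K _ (Y_mul_mem_hY K hq)

theorem z_mul_mem_h0 {k : ℕ} (hk : 2 ≤ k) {q : H K} (hq : q ∈ h1 K) : z K k * q ∈ h0 K := by
  obtain ⟨j, rfl⟩ := Nat.exists_eq_add_of_le hk
  rw [z, show 2 + j - 1 = j + 1 by omega, pow_succ', mul_assoc, mul_assoc]
  exact X_mul_mem_h0 K (mul_mem_hY K _ (Y_mul_mem_hY K hq))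

theorem zProd_mem_h1 (ks : List ℕ) : zProd K ks ∈ h1 K := by
  induction ks with
  | nil => exact Submodule.mem_sup_left (Submodule.mem_span_singleton_self 1)
  | cons k ks ih =>
    rw [zProd, List.map_cons, List.prod_cons]
    exact Submodule.mem_sup_right (z_mul_mem_hY K k ih)

theorem stuffleIndex_mem_h1 (ks ls : List ℕ) : stuffleIndex K ks ls ∈ h1 K := by
  induction hn : ks.length + ls.length using Nat.strong_induction_on generalizing ks ls with
  | _ n ih =>
    subst hn
    cases ks with
    | nil => rw [stuffleIndex]; exact zProd_mem_h1 K ls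
    | cons k ks =>
      cases ls with
      | nil => rw [stuffleIndex]; exact zProd_mem_h1 K _
      | cons l ls =>
        rw [stuffleIndex]
        refine Submodule.mem_sup_right (add_mem (add_mem ?_ ?_) ?_) <;>
          refine z_mul_mem_hY K _ (ih _ ?_ _ _ rfl) <;> (simp; try omega)

theorem toIndexAux_append_y (c : ℕ) (u : List Letter) :
    ∃ k ks, toIndexAux c (u ++ [Letter.y]) = k :: ks ∧ c + 1 ≤ k := by
  induction u generalizing c with
  | nil => exact ⟨c + 1, [], rfl, le_rfl⟩
  | cons a u ih =>
    cases a with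
    | x =>
      obtain ⟨k, ks, h, hk⟩ := ih (c + 1)
      exact ⟨k, ks, h, by omega⟩
    | y => exact ⟨c + 1, _, rfl, le_rfl⟩

theorem zProd_mem_h0_of_two_le {k : ℕ} (hk : 2 ≤ k) (ks : List ℕ) : zProd K (k :: ks) ∈ h0 K := by
  rw [zProd, List.map_cons, List.prod_cons]
  exact z_mul_mem_h0 K hk (zProd_mem_h1 K ks)

theorem stuffle_mem_h0 {p q : H K} (hp : p ∈ h0 K) (hq : q ∈ h0 K) :
    stuffle K p q ∈ h0 K := by
  have key : ∀ u, ∃ k ks, toIndex (Letter.x :: (u ++ [Letter.y])) = k :: ks ∧ 2 ≤ k :=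
    fun u => toIndexAux_append_y 1 u
  refine extend₂_mem_h0 K _ ?_ ?_ hp hq
  · rintro u (rfl | ⟨u, rfl⟩)
    · simpa [toIndex, toIndexAux, stuffleIndex, zProd] using one_mem_h0 K
    · obtain ⟨k, ks, h, hk⟩ := key u
      rw [h, show toIndex [] = [] from rfl, stuffleIndex, stuffleIndex]
      exact ⟨zProd_mem_h0_of_two_le K hk ks, zProd_mem_h0_of_two_le K hk ks⟩
  · intro u v
    obtain ⟨k, ks, h, hk⟩ := key u
    obtain ⟨l, ls, h', hl⟩ := key v
    rw [h, h', stuffleIndex]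
    exact add_mem (add_mem (z_mul_mem_h0 K hk (stuffleIndex_mem_h1 K _ _))
      (z_mul_mem_h0 K hl (stuffleIndex_mem_h1 K _ _)))
      (z_mul_mem_h0 K (by omega) (stuffleIndex_mem_h1 K _ _))

theorem S_mem_h0 {p : H K} (hp : p ∈ h0 K) : S K p ∈ h0 K := by
  have h : Submodule.span K (word K '' {w | w = [] ∨ ∃ u, w = Letter.x :: (u ++ [Letter.y])}) ≤
      (h0 K).comap (S K) := by
    rw [Submodule.span_le]
    rintro _ ⟨w, hw, rfl⟩
    rw [SetLike.mem_coe, Submodule.mem_comap, S, extend_word]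
    rcases hw with rfl | ⟨u, rfl⟩
    · exact one_mem_h0 K
    · have hx : sigma K (FreeAlgebra.ι K Letter.x) = X K := by simp [sigma]
      rw [SWord, ← List.cons_append, List.getLast?_concat, List.dropLast_concat, word_cons,
        map_mul, hx]
      change X K * sigma K (word K u) * Y K ∈ h0 K
      rw [mul_assoc]
      exact X_mul_mem_h0 K (mul_Y_mem K _)
  exact h (h0_le_span K hp)

end

/-- An index `(k_1, …, k_n)` of positive integers is admissible if it is empty or `k_1 ≥ 2`. -/
def Admissible (ks : List ℕ) : Prop := (∀ k ∈ ks, 1 ≤ k) ∧ ∀ k ∈ ks.head?, 2 ≤ k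

theorem zProd_mem_h0 (K : Type*) [Field K] {ks : List ℕ} (h : Admissible ks) :
    zProd K ks ∈ h0 K := by
  cases ks with
  | nil => exact one_mem_h0 K
  | cons k ks => exact zProd_mem_h0_of_two_le K (h.2 k rfl) ks

section

variable {K : Type*} [Field K] {R : Type*} [CommRing R] [Algebra K R]

/-- `S` restricted to `𝔥⁰`. -/
def S0 (K : Type*) [Field K] : h0 K →ₗ[K] h0 K := (S K).restrict fun _ hp => S_mem_h0 K hp

/-- `Z⋆ = Z ∘ S`. -/
def star (Z : h0 K →ₗ[K] R) : h0 K →ₗ[K] R := Z ∘ₗ S0 K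

open Classical in
/-- `ζ_R(k_1, …, k_n) = Z(z_{k_1} ⋯ z_{k_n})` for an admissible index (and `0` otherwise). -/
def zeta (Z : h0 K →ₗ[K] R) (ks : List ℕ) : R :=
  if h : Admissible ks then Z ⟨zProd K ks, zProd_mem_h0 K h⟩ else 0

/-- `ζ_R⋆(k_1, …, k_n) = Z⋆(z_{k_1} ⋯ z_{k_n})` for an admissible index. -/
def zetaStar (Z : h0 K →ₗ[K] R) (ks : List ℕ) : R := zeta (star Z) ks

/-- `ζ_R(2n)`, with the convention `ζ_R(0) = -1/2`. -/
def zetaEven (Z : h0 K →ₗ[K] R) (n : ℕ) : R :=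
  if n = 0 then algebraMap K R (-1 / 2) else zeta Z [2 * n]

/-- The (finite) double shuffle relations. -/
structure DoubleShuffle (Z : h0 K →ₗ[K] R) : Prop where
  map_one : Z ⟨1, one_mem_h0 K⟩ = 1
  map_shuffle : ∀ u v : h0 K, Z ⟨shuffle K u v, shuffle_mem_h0 K u.2 v.2⟩ = Z u * Z v
  map_stuffle : ∀ u v : h0 K, Z ⟨stuffle K u v, stuffle_mem_h0 K u.2 v.2⟩ = Z u * Z v

/-- `v₀ = reg_⧢(w)`: it is the constant term of `w = ∑ᵢ vᵢ ⧢ y^{⧢ i}` with all `vᵢ ∈ 𝔥⁰`. Every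
`w ∈ 𝔥¹` has exactly one such expansion, as `𝔥¹` with `⧢` is the polynomial algebra `𝔥⁰[y]`. -/
def IsShuffleReg (w : H K) (v₀ : h0 K) : Prop :=
  ∃ (N : ℕ) (v : ℕ → h0 K), v 0 = v₀ ∧
    w = ∑ i ∈ Finset.range (N + 1), shuffle K (v i) (shufflePowY K i)

/-- The regularized double shuffle relations: the double shuffle relations together with
`Z(reg_⧢(w₁ ⧢ w₀ - w₁ ∗ w₀)) = 0` for all `w₁ ∈ 𝔥¹` and `w₀ ∈ 𝔥⁰`. -/
structure RegularizedDoubleShuffle (Z : h0 K →ₗ[K] R) : Prop extends DoubleShuffle Z where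
  map_reg : ∀ w₁ ∈ h1 K, ∀ w₀ ∈ h0 K, ∀ v : h0 K,
    IsShuffleReg (shuffle K w₁ w₀ - stuffle K w₁ w₀) v → Z v = 0

end

/-- The index `({3, 1}^n)`. -/
def threeOne (n : ℕ) : List ℕ := (List.replicate n [3, 1]).flatten

/-- The index `({2}^{c_0}, 3, {2}^{c_1}, 1, {2}^{c_2}, …, 3, {2}^{c_{2n-1}}, 1, {2}^{c_{2n}})`. -/
def insertTwos (n : ℕ) (c : Fin (2 * n + 1) → ℕ) : List ℕ :=
  List.replicate (c 0) 2 ++ (List.finRange n).flatMap fun i : Fin n =>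
    3 :: (List.replicate (c ⟨2 * i.val + 1, by have := i.isLt; omega⟩) 2 ++
      1 :: List.replicate (c ⟨2 * i.val + 2, by have := i.isLt; omega⟩) 2)

/-- `β_k = (2^{1-2k} - 1) B_{2k} / (2k)!`. -/
def beta (k : ℕ) : ℚ :=
  ((2 : ℚ) ^ (1 - 2 * (k : ℤ)) - 1) / (2 * k).factorial * bernoulli (2 * k)

end

end MZV

/-! ### Recursive rules for the products and for `S` -/

namespace MZV

noncomputable section

open Finset

variable {K : Type*} [Field K]

/-! All values are computed through generating functions in a variable t, and everything is reduced
to ζ(2). Let E, H, P be the generating functions of ζ({κ}ⁿ), ζ⋆({κ}ⁿ) and (-1)ⁿ⁻¹ζ(κn). The stuffle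
product alone gives the symmetric function identities tE' = EP and E(-t)H(t) = 1
(`DoubleShuffle.genE_newton`, `DoubleShuffle.genE_mul_genH`). They already hold for formal series of
words, since S(z_κⁿ) is the sum of the words of weight κn in the letters z_{mκ}. Such series are
handled letter by letter, with a left derivative `der` and a stuffle product `st`; `sum_stuffle_elt`
returns to 𝔥 weight by weight.

Regularization enters only through w₁ = y and w₀ = z_{N+2}, which gives the sum formula in depth
two. Combined with a telescoping alternating sum of the products z_a ⧢ z_b it yields 2 ∑ ζ(2i)ζ(2j)
= (2l+5) ζ(2l+4), the sum being over i + j = l + 2 with i, j ≥ 1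
(`RegularizedDoubleShuffle.even_depth_two`). By the Riccati equation of (t/2) coth(t/2) the numbers
-B_{2n}/(2(2n)!) satisfy the same recursion, so ζ(2n) is the stated multiple of λ^{2n}. The equation
tE' = EP and its analogue for H then determine the values for κ = 2k. For κ = 2, E(-t²) is
sinh(λt/2)/(λt/2), and the inverse series has the coefficients β.

For the sums over {2}^{m_0},3,{2}^{m_1},1,…, the product (xy)^p ⧢ (xy)^q is ∑ 4ⁿ binom(p+q-2n, p-n)
times the n-th sum of words (`shuffle_pow_pow`). The values of the left side are known and the
system is triangular. Its solution is verified by comparing coefficients in (1+X)^{2N} = (2X +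
(1+X²))^N.

For the star sums, give z_2 the weight c and z_3, z_1 the weight d. Since S merges neighbouring
letters, its image has as coefficients the entries of (c + dJ)^r, where J exchanges the states "next
is 3" and "next is 1". The eigenvalues are c - d and c + d. Stuffle multiplication by ∑ (-(c-d))ⁿ
z_2ⁿ and ∑ (-(c+d))ⁿ z_2ⁿ removes both and leaves the non-star series with c replaced by -c
(`st_altMidSer`). For c = 1, d = b, inverting the two factors gives the star sums as the non-star
sums times H((1-b)t) H((1+b)t) (`DoubleShuffle.altStar_gen`), and comparing powers of b finishes. -/

theorem word_nil : word K [] = 1 := rfl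

theorem induction_word {p : H K → Prop} (u : H K) (mem : ∀ w, p (word K w)) (zero : p 0)
    (add : ∀ a b, p a → p b → p (a + b)) (smul : ∀ (c : K) a, p a → p (c • a)) : p u := by
  induction mem_span_word K u using Submodule.span_induction with
  | mem q hq => obtain ⟨w, rfl⟩ := hq; exact mem w
  | zero => exact zero
  | add a b _ _ ha hb => exact add a b ha hb
  | smul c a _ ha => exact smul c a ha

theorem shuffle_one_left (v : H K) : shuffle K 1 v = v := by
  induction v using induction_word with
  | mem w => rw [← word_nil, shuffle, extend₂_word, shuffleWord]
  | zero => simp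
  | add a b ha hb => rw [map_add, ha, hb]
  | smul c a ha => rw [map_smul, ha]

theorem shuffle_one_right (v : H K) : shuffle K v 1 = v := by
  induction v using induction_word with
  | mem w => rw [← word_nil, shuffle, extend₂_word, shuffleWord_nil]
  | zero => simp
  | add a b ha hb => rw [map_add, LinearMap.add_apply, ha, hb]
  | smul c a ha => rw [map_smul, LinearMap.smul_apply, ha]

theorem shuffle_mul_mul (a b : Letter) (u v : H K) :
    shuffle K (FreeAlgebra.ι K a * u) (FreeAlgebra.ι K b * v) =
      FreeAlgebra.ι K a * shuffle K u (FreeAlgebra.ι K b * v) +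
        FreeAlgebra.ι K b * shuffle K (FreeAlgebra.ι K a * u) v := by
  induction u using induction_word with
  | mem u =>
    induction v using induction_word with
    | mem v =>
      simp only [← word_cons, shuffle, extend₂_word]
      rw [shuffleWord]
    | zero => simp
    | add p q hp hq => simp only [mul_add, map_add, hp, hq]; abel
    | smul c p hp => simp only [mul_smul_comm, map_smul, hp, smul_add]
  | zero => simp
  | add p q hp hq => simp only [mul_add, map_add, LinearMap.add_apply, hp, hq]; abel
  | smul c p hp =>
    simp only [mul_smul_comm, map_smul, LinearMap.smul_apply, hp, smul_add]

theorem shuffle_X_X (u v : H K) : shuffle K (X K * u) (X K * v) =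
    X K * shuffle K u (X K * v) + X K * shuffle K (X K * u) v := shuffle_mul_mul _ _ u v

theorem shuffle_X_Y (u v : H K) : shuffle K (X K * u) (Y K * v) =
    X K * shuffle K u (Y K * v) + Y K * shuffle K (X K * u) v := shuffle_mul_mul _ _ u v

theorem shuffle_Y_X (u v : H K) : shuffle K (Y K * u) (X K * v) =
    Y K * shuffle K u (X K * v) + X K * shuffle K (Y K * u) v := shuffle_mul_mul _ _ u v

theorem shuffle_Y_Y (u v : H K) : shuffle K (Y K * u) (Y K * v) =
    Y K * shuffle K u (Y K * v) + Y K * shuffle K (Y K * u) v := shuffle_mul_mul _ _ u v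

theorem z_succ (k : ℕ) : z K (k + 1) = X K ^ k * Y K := rfl

theorem X_pow_mul_z_succ (a k : ℕ) : X K ^ a * z K (k + 1) = z K (a + k + 1) := by
  rw [z_succ, z_succ, pow_add, mul_assoc]

theorem zProd_nil : zProd K [] = 1 := rfl

theorem zProd_cons (k : ℕ) (ks : List ℕ) : zProd K (k :: ks) = z K k * zProd K ks := by
  simp [zProd]

theorem zProd_append (ks ls : List ℕ) : zProd K (ks ++ ls) = zProd K ks * zProd K ls := by
  simp [zProd]

theorem zProd_replicate (n k : ℕ) : zProd K (List.replicate n k) = z K k ^ n := by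
  simp [zProd]

theorem z_mul_word (k : ℕ) (w : List Letter) :
    z K (k + 1) * word K w = word K (List.replicate k Letter.x ++ Letter.y :: w) := by
  rw [word_append, word_cons, z_succ, mul_assoc]
  congr 1
  simp [word, X]

theorem toIndexAux_replicate (c k : ℕ) (w : List Letter) :
    toIndexAux c (List.replicate k Letter.x ++ Letter.y :: w) = (c + k + 1) :: toIndex w := by
  induction k generalizing c with
  | zero => rfl
  | succ k ih =>
    rw [List.replicate_succ, List.cons_append, toIndexAux, ih]
    congr 2; omega

theorem toIndex_replicate (k : ℕ) (w : List Letter) :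
    toIndex (List.replicate k Letter.x ++ Letter.y :: w) = (k + 1) :: toIndex w := by
  rw [toIndex, toIndexAux_replicate, zero_add]

theorem stuffleIndex_nil (ks : List ℕ) : stuffleIndex K ks [] = zProd K ks := by
  cases ks <;> simp [stuffleIndex]

theorem stuffle_one_one : stuffle K 1 1 = 1 := by
  rw [← word_nil, stuffle, extend₂_word]
  simp [toIndex, toIndexAux, stuffleIndex, zProd_nil, word_nil]

theorem stuffle_one_mul (k : ℕ) (v : H K) :
    stuffle K 1 (z K (k + 1) * v) = z K (k + 1) * stuffle K 1 v := by
  induction v using induction_word with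
  | mem w =>
    rw [← word_nil, z_mul_word, stuffle, extend₂_word, extend₂_word, toIndex_replicate]
    simp only [toIndex, toIndexAux, stuffleIndex]
    rw [zProd_cons]
  | zero => simp
  | add a b ha hb => simp only [mul_add, map_add, ha, hb]
  | smul c a ha => simp only [mul_smul_comm, map_smul, ha]

theorem stuffle_mul_one (k : ℕ) (v : H K) :
    stuffle K (z K (k + 1) * v) 1 = z K (k + 1) * stuffle K v 1 := by
  induction v using induction_word with
  | mem w =>
    rw [← word_nil, z_mul_word, stuffle, extend₂_word, extend₂_word, toIndex_replicate]
    rw [show toIndex [] = [] from rfl, stuffleIndex_nil, stuffleIndex_nil, zProd_cons]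
  | zero => simp
  | add a b ha hb => simp only [mul_add, map_add, LinearMap.add_apply, ha, hb]
  | smul c a ha => simp only [mul_smul_comm, map_smul, LinearMap.smul_apply, ha]

/-- The letters are written `z K (k + 1)` because `z K 0` and `z K 1` coincide, while `toIndex`
returns positive indices only. -/
theorem stuffle_mul_mul (k l : ℕ) (u v : H K) :
    stuffle K (z K (k + 1) * u) (z K (l + 1) * v) =
      z K (k + 1) * stuffle K u (z K (l + 1) * v) +
        z K (l + 1) * stuffle K (z K (k + 1) * u) v +
        z K (k + l + 1 + 1) * stuffle K u v := by
  induction u using induction_word with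
  | mem u =>
    induction v using induction_word with
    | mem v =>
      rw [z_mul_word, z_mul_word, stuffle, extend₂_word, extend₂_word, extend₂_word,
        extend₂_word, toIndex_replicate, toIndex_replicate, stuffleIndex]
      rw [show k + 1 + (l + 1) = k + l + 1 + 1 by omega]
    | zero => simp
    | add p q hp hq => simp only [mul_add, map_add, hp, hq]; abel
    | smul c p hp => simp only [mul_smul_comm, map_smul, hp, smul_add]
  | zero => simp
  | add p q hp hq => simp only [mul_add, map_add, LinearMap.add_apply, hp, hq]; abel
  | smul c p hp =>
    simp only [mul_smul_comm, map_smul, LinearMap.smul_apply, hp, smul_add]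

theorem sigma_X : sigma K (X K) = X K := by simp [sigma, X]

theorem sigma_Y : sigma K (Y K) = X K + Y K := by simp [sigma, Y]

theorem S_one : S K 1 = 1 := by
  rw [← word_nil, S, extend_word]; rfl

theorem S_mul_Y (u : H K) : S K (u * Y K) = sigma K u * Y K := by
  induction u using induction_word with
  | mem w =>
    have h : word K w * Y K = word K (w ++ [Letter.y]) := by simp [word, Y]
    rw [h, S, extend_word, SWord, List.getLast?_concat, List.dropLast_concat]
    rfl
  | zero => simp
  | add a b ha hb => simp only [add_mul, map_add, ha, hb]
  | smul c a ha => simp only [smul_mul_assoc, map_smul, ha]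

/-- S spares only the last letter, so a left factor comes out under σ once the right factor has a
last letter of its own. -/
theorem S_mul_of_mem (u : H K) {v : H K} (hv : v ∈ hY K) : S K (u * v) = sigma K u * S K v := by
  obtain ⟨v, rfl⟩ := hv
  rw [LinearMap.mulRight_apply, ← mul_assoc, S_mul_Y, S_mul_Y, map_mul, mul_assoc]

theorem S_z (k : ℕ) : S K (z K (k + 1)) = z K (k + 1) := by
  rw [z_succ, S_mul_Y, map_pow, sigma_X]

/-- As σ(y) = x + y, the y that ends z_{k+1} is kept or becomes an x; in the second case z_{k+1}
merges into the next letter. -/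
theorem S_z_mul (k : ℕ) {v : H K} (hv : v ∈ hY K) :
    S K (z K (k + 1) * v) = z K (k + 1) * S K v + X K ^ (k + 1) * S K v := by
  rw [S_mul_of_mem _ hv, z_succ, map_mul, map_pow, sigma_X, sigma_Y, mul_add, add_mul,
    pow_succ, add_comm]

end

end MZV

/-! ### Formal series in the letters `z_k`

A series is a function `List ℕ → K`; the entry `k` of a list stands for the letter `z_{k+1}`. -/

namespace MZV

noncomputable section

open Finset hiding antidiagonal mem_antidiagonal
open Finset.HasAntidiagonal

variable {K : Type*} [Field K]

/-- The left derivative of a series by the letter `z_{k+1}`. -/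
def der (k : ℕ) (f : List ℕ → K) : List ℕ → K := fun w => f (k :: w)

/-- The stuffle product of series. -/
def st : (List ℕ → K) → (List ℕ → K) → List ℕ → K
  | f, g, [] => f [] * g []
  | f, g, 0 :: w => st (der 0 f) g w + st f (der 0 g) w
  | f, g, (k + 1) :: w => st (der (k + 1) f) g w + st f (der (k + 1) g) w +
      ∑ q ∈ antidiagonal k, st (der q.1 f) (der q.2 g) w

/-- The weight-`N` component of a series. -/
def elt (f : List ℕ → K) : ℕ → H K
  | 0 => f [] • 1
  | N + 1 => ∑ k : Fin (N + 1), z K (k + 1) * elt (der k f) (N - k)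
  termination_by N => N

theorem elt_zero (f : List ℕ → K) : elt f 0 = f [] • 1 := by rw [elt]

theorem elt_succ (f : List ℕ → K) (N : ℕ) : elt f (N + 1) =
    ∑ q ∈ antidiagonal N, z K (q.1 + 1) * elt (der q.1 f) q.2 := by
  rw [elt, Finset.Nat.sum_antidiagonal_eq_sum_range_succ_mk,
    ← Fin.sum_univ_eq_sum_range (fun k => z K (k + 1) * elt (der k f) (N - k))]

theorem elt_add (f g : List ℕ → K) (N : ℕ) : elt (f + g) N = elt f N + elt g N := by
  induction N using Nat.strong_induction_on generalizing f g with
  | _ N ih =>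
    cases N with
    | zero => simp [elt_zero, add_smul]
    | succ N =>
      simp only [elt_succ, ← sum_add_distrib, ← mul_add]
      refine sum_congr rfl fun q hq => ?_
      rw [← ih q.2 (by have := mem_antidiagonal.1 hq; omega)]
      rfl

theorem elt_smul (c : K) (f : List ℕ → K) (N : ℕ) : elt (c • f) N = c • elt f N := by
  induction N using Nat.strong_induction_on generalizing f with
  | _ N ih =>
    cases N with
    | zero => simp [elt_zero, mul_smul]
    | succ N =>
      simp only [elt_succ, smul_sum, ← mul_smul_comm]
      refine sum_congr rfl fun q hq => ?_
      rw [← ih q.2 (by have := mem_antidiagonal.1 hq; omega)]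
      rfl

theorem elt_zero_series (N : ℕ) : elt (0 : List ℕ → K) N = 0 := by
  simpa using elt_smul (0 : K) 0 N

theorem elt_sum {ι : Type*} (s : Finset ι) (f : ι → List ℕ → K) (N : ℕ) :
    elt (∑ i ∈ s, f i) N = ∑ i ∈ s, elt (f i) N := by
  classical
  induction s using Finset.induction_on with
  | empty => simp [elt_zero_series]
  | insert a s ha ih => rw [sum_insert ha, sum_insert ha, elt_add, ih]

theorem der_st_zero (f g : List ℕ → K) :
    der 0 (st f g) = st (der 0 f) g + st f (der 0 g) := by
  funext w; simp [der, st]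

theorem der_st_succ (f g : List ℕ → K) (k : ℕ) :
    der (k + 1) (st f g) = st (der (k + 1) f) g + st f (der (k + 1) g) +
      ∑ q ∈ antidiagonal k, st (der q.1 f) (der q.2 g) := by
  funext w; simp [der, st]

theorem st_nil (f g : List ℕ → K) : st f g [] = f [] * g [] := by simp [st]

theorem st_smul_left (c : K) (f g : List ℕ → K) : st (c • f) g = c • st f g := by
  funext w
  induction w generalizing f g with
  | nil => simp [st, mul_assoc]
  | cons k w ih =>
    have h : ∀ k, der k (c • f) = c • der k f := fun _ => rfl
    cases k <;> simp [st, h, ih, mul_add, mul_sum]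

theorem st_smul_right (c : K) (f g : List ℕ → K) : st f (c • g) = c • st f g := by
  funext w
  induction w generalizing f g with
  | nil => simp [st, mul_left_comm]
  | cons k w ih =>
    have h : ∀ k, der k (c • g) = c • der k g := fun _ => rfl
    cases k <;> simp [st, h, ih, mul_add, mul_sum]

theorem st_zero_left (g : List ℕ → K) : st 0 g = 0 := by
  simpa using st_smul_left (0 : K) 0 g

theorem st_zero_right (g : List ℕ → K) : st g 0 = 0 := by
  simpa using st_smul_right (0 : K) g 0

/-- The unit series. -/
def one : List ℕ → K
  | [] => 1
  | _ :: _ => 0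

theorem der_one (k : ℕ) : der k (one : List ℕ → K) = 0 := rfl

theorem st_one_right (f : List ℕ → K) : st f one = f := by
  funext w
  induction w generalizing f with
  | nil => simp [st, one]
  | cons k w ih => cases k <;> simp [st, der_one, st_zero_right, ih] <;> rfl

theorem elt_one_succ (N : ℕ) : elt (one : List ℕ → K) (N + 1) = 0 := by
  simp [elt_succ, der_one, elt_zero_series]

/-- The four-fold exchange of antidiagonal sums. -/
theorem sum_antidiagonal_exchange {M : Type*} [AddCommMonoid M] (N : ℕ)
    (F : ℕ → ℕ → ℕ → ℕ → M) :
    ∑ p ∈ antidiagonal N, ∑ a ∈ antidiagonal p.1, ∑ b ∈ antidiagonal p.2,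
        F a.1 a.2 b.1 b.2 =
      ∑ p ∈ antidiagonal N, ∑ a ∈ antidiagonal p.1, ∑ b ∈ antidiagonal p.2,
        F a.1 b.1 a.2 b.2 := by
  simp only [← sum_product', sum_sigma']
  refine sum_nbij' (fun x => ⟨(x.2.1.1 + x.2.2.1, x.2.1.2 + x.2.2.2),
      ((x.2.1.1, x.2.2.1), (x.2.1.2, x.2.2.2))⟩)
    (fun x => ⟨(x.2.1.1 + x.2.2.1, x.2.1.2 + x.2.2.2),
      ((x.2.1.1, x.2.2.1), (x.2.1.2, x.2.2.2))⟩) ?_ ?_ ?_ ?_ ?_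
  · rintro ⟨⟨p, q⟩, ⟨⟨a, b⟩, ⟨c, d⟩⟩⟩ h
    simp only [mem_sigma, mem_product, mem_antidiagonal] at h ⊢
    grind
  · rintro ⟨⟨p, q⟩, ⟨⟨a, b⟩, ⟨c, d⟩⟩⟩ h
    simp only [mem_sigma, mem_product, mem_antidiagonal] at h ⊢
    grind
  · rintro ⟨⟨p, q⟩, ⟨⟨a, b⟩, ⟨c, d⟩⟩⟩ h
    simp only [mem_sigma, mem_product, mem_antidiagonal] at h
    obtain ⟨-, rfl, rfl⟩ := h
    rfl
  · rintro ⟨⟨p, q⟩, ⟨⟨a, b⟩, ⟨c, d⟩⟩⟩ h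
    simp only [mem_sigma, mem_product, mem_antidiagonal] at h
    obtain ⟨-, rfl, rfl⟩ := h
    rfl
  · intros; rfl

theorem sum_antidiagonal_assoc {M : Type*} [AddCommMonoid M] (N : ℕ) (F : ℕ → ℕ → ℕ → M) :
    ∑ p ∈ antidiagonal N, ∑ a ∈ antidiagonal p.1, F a.1 a.2 p.2 =
      ∑ p ∈ antidiagonal N, ∑ b ∈ antidiagonal p.2, F p.1 b.1 b.2 := by
  simp only [sum_sigma']
  refine sum_nbij' (fun x => ⟨(x.2.1, x.2.2 + x.1.2), (x.2.2, x.1.2)⟩)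
    (fun x => ⟨(x.1.1 + x.2.1, x.2.2), (x.1.1, x.2.1)⟩) ?_ ?_ ?_ ?_ ?_
  · rintro ⟨⟨p, q⟩, ⟨a, b⟩⟩ h
    simp only [mem_sigma, mem_antidiagonal] at h ⊢
    grind
  · rintro ⟨⟨p, q⟩, ⟨a, b⟩⟩ h
    simp only [mem_sigma, mem_antidiagonal] at h ⊢
    grind
  · rintro ⟨⟨p, q⟩, ⟨a, b⟩⟩ h
    simp only [mem_sigma, mem_antidiagonal] at h
    obtain ⟨-, rfl⟩ := h
    rfl
  · rintro ⟨⟨p, q⟩, ⟨a, b⟩⟩ h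
    simp only [mem_sigma, mem_antidiagonal] at h
    obtain ⟨-, rfl⟩ := h
    rfl
  · intros; rfl

theorem sum_antidiagonal_left_comm {M : Type*} [AddCommMonoid M] (N : ℕ) (F : ℕ → ℕ → ℕ → M) :
    ∑ p ∈ antidiagonal N, ∑ a ∈ antidiagonal p.2, F p.1 a.1 a.2 =
      ∑ p ∈ antidiagonal N, ∑ b ∈ antidiagonal p.2, F b.1 p.1 b.2 := by
  rw [← sum_antidiagonal_assoc, ← sum_antidiagonal_assoc N fun a b c => F b a c]
  refine sum_congr rfl fun p _ => ?_
  exact Finset.Nat.sum_antidiagonal_swap (f := fun q => F q.1 q.2 p.2) |>.symm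

theorem stuffle_elt_succ_zero (f g : List ℕ → K) (i : ℕ) :
    stuffle K (elt f (i + 1)) (elt g 0) = ∑ a ∈ antidiagonal i,
      z K (a.1 + 1) * stuffle K (elt (der a.1 f) a.2) (elt g 0) := by
  rw [elt_succ, elt_zero g, map_sum, LinearMap.sum_apply]
  refine sum_congr rfl fun a _ => ?_
  rw [map_smul, map_smul, stuffle_mul_one, mul_smul_comm]

theorem stuffle_elt_zero_succ (f g : List ℕ → K) (j : ℕ) :
    stuffle K (elt f 0) (elt g (j + 1)) = ∑ b ∈ antidiagonal j,
      z K (b.1 + 1) * stuffle K (elt f 0) (elt (der b.1 g) b.2) := by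
  rw [elt_succ, elt_zero f, map_sum]
  refine sum_congr rfl fun b _ => ?_
  rw [map_smul, LinearMap.smul_apply, LinearMap.smul_apply, stuffle_one_mul, mul_smul_comm]

theorem stuffle_elt_succ_succ (f g : List ℕ → K) (i j : ℕ) :
    stuffle K (elt f (i + 1)) (elt g (j + 1)) =
      ∑ a ∈ antidiagonal i, z K (a.1 + 1) * stuffle K (elt (der a.1 f) a.2) (elt g (j + 1)) +
      ∑ b ∈ antidiagonal j, z K (b.1 + 1) * stuffle K (elt f (i + 1)) (elt (der b.1 g) b.2) +
      ∑ a ∈ antidiagonal i, ∑ b ∈ antidiagonal j,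
        z K (a.1 + b.1 + 1 + 1) * stuffle K (elt (der a.1 f) a.2) (elt (der b.1 g) b.2) := by
  conv_lhs => rw [elt_succ f, elt_succ g]
  simp only [map_sum, LinearMap.sum_apply, stuffle_mul_mul, sum_add_distrib]
  congr 1
  congr 1
  · rw [sum_comm]
    refine sum_congr rfl fun a _ => ?_
    rw [elt_succ g, map_sum, mul_sum]
  · refine sum_congr rfl fun b _ => ?_
    rw [elt_succ f, map_sum, LinearMap.sum_apply, mul_sum]
  · rw [sum_comm]

/-- The recursion of `st` on the first letter is the transpose of the stuffle recursion. An identity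
of series checked with `der` therefore becomes an identity in 𝔥 in every weight. -/
theorem sum_stuffle_elt (f g : List ℕ → K) (N : ℕ) :
    ∑ q ∈ antidiagonal N, stuffle K (elt f q.1) (elt g q.2) = elt (st f g) N := by
  induction N using Nat.strong_induction_on generalizing f g with
  | _ N ih =>
    cases N with
    | zero => simp [elt_zero, st_nil, stuffle_one_one, smul_smul, mul_comm]
    | succ N =>
      -- The three groups of terms: the first letter comes from f, from g, or from a merge. Each is
      -- set to 0 where a factor to be peeled has weight 0, so that `hP` includes the boundary.
      let P₁ : ℕ → ℕ → H K := fun i j => match i with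
        | 0 => 0
        | i + 1 => ∑ a ∈ antidiagonal i,
            z K (a.1 + 1) * stuffle K (elt (der a.1 f) a.2) (elt g j)
      let P₂ : ℕ → ℕ → H K := fun i j => match j with
        | 0 => 0
        | j + 1 => ∑ b ∈ antidiagonal j,
            z K (b.1 + 1) * stuffle K (elt f i) (elt (der b.1 g) b.2)
      let P₃ : ℕ → ℕ → H K := fun i j => match i, j with
        | i + 1, j + 1 => ∑ a ∈ antidiagonal i, ∑ b ∈ antidiagonal j,
            z K (a.1 + b.1 + 1 + 1) * stuffle K (elt (der a.1 f) a.2) (elt (der b.1 g) b.2)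
        | _, _ => 0
      have hP : ∀ q ∈ antidiagonal (N + 1), stuffle K (elt f q.1) (elt g q.2) =
          P₁ q.1 q.2 + P₂ q.1 q.2 + P₃ q.1 q.2 := by
        rintro ⟨i, j⟩ hq
        rcases i with _ | i <;> rcases j with _ | j
        · simp at hq
        · simp only [P₁, P₂, P₃, zero_add, add_zero, stuffle_elt_zero_succ]
        · simp only [P₁, P₂, P₃, add_zero, stuffle_elt_succ_zero]
        · simp only [P₁, P₂, P₃, stuffle_elt_succ_succ]
      have h₁ : ∑ q ∈ antidiagonal (N + 1), P₁ q.1 q.2 =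
          ∑ q ∈ antidiagonal N, z K (q.1 + 1) * elt (st (der q.1 f) g) q.2 := by
        rw [Finset.Nat.sum_antidiagonal_succ]
        simp only [P₁, zero_add]
        rw [sum_antidiagonal_assoc N fun a b c =>
          z K (a + 1) * stuffle K (elt (der a f) b) (elt g c)]
        refine sum_congr rfl fun q hq => ?_
        rw [← mul_sum, ih q.2 (by have := mem_antidiagonal.1 hq; omega)]
      have h₂ : ∑ q ∈ antidiagonal (N + 1), P₂ q.1 q.2 =
          ∑ q ∈ antidiagonal N, z K (q.1 + 1) * elt (st f (der q.1 g)) q.2 := by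
        rw [Finset.Nat.sum_antidiagonal_succ']
        simp only [P₂, zero_add]
        rw [sum_antidiagonal_left_comm N fun a b c =>
          z K (b + 1) * stuffle K (elt f a) (elt (der b g) c)]
        refine sum_congr rfl fun q hq => ?_
        rw [← mul_sum, ih q.2 (by have := mem_antidiagonal.1 hq; omega)]
      rw [sum_congr rfl hP, sum_add_distrib, sum_add_distrib, h₁, h₂, elt_succ]
      cases N with
      -- In weight one no letter can arise from a merge.
      | zero => simp [P₃, der_st_zero, elt_add, mul_add, Finset.Nat.antidiagonal_succ]
      | succ N =>
        have h₃ : ∑ q ∈ antidiagonal (N + 1 + 1), P₃ q.1 q.2 =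
            ∑ q ∈ antidiagonal N, z K (q.1 + 1 + 1) *
              elt (∑ s ∈ antidiagonal q.1, st (der s.1 f) (der s.2 g)) q.2 := by
          rw [Finset.Nat.sum_antidiagonal_succ, Finset.Nat.sum_antidiagonal_succ']
          simp only [P₃, zero_add]
          rw [sum_antidiagonal_exchange N fun a b c d =>
            z K (a + c + 1 + 1) * stuffle K (elt (der a f) b) (elt (der c g) d)]
          refine sum_congr rfl fun q hq => ?_
          rw [elt_sum, mul_sum]
          refine sum_congr rfl fun s hs => ?_
          rw [← mul_sum, ih q.2 (by have := mem_antidiagonal.1 hq; omega),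
            mem_antidiagonal.1 hs]
        rw [h₃, ← sum_add_distrib, Finset.Nat.sum_antidiagonal_succ,
          Finset.Nat.sum_antidiagonal_succ]
        simp only [der_st_zero, der_st_succ, elt_add, mul_add, sum_add_distrib]
        abel

end

end MZV

/-! ### The series used below -/

namespace MZV

noncomputable section

open Finset hiding antidiagonal mem_antidiagonal
open Finset.HasAntidiagonal

variable {K : Type*} [Field K]

/-- The product of the letter `z_{k+1}` with a series. -/
def cons (k : ℕ) (f : List ℕ → K) : List ℕ → K
  | [] => 0
  | j :: w => if j = k then f w else 0

/-- Increases the first letter of every nonempty word by `κ`, and drops the constant term. -/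
def shift (κ : ℕ) (f : List ℕ → K) : List ℕ → K
  | [] => 0
  | j :: w => if κ ≤ j then f ((j - κ) :: w) else 0

theorem der_cons (j k : ℕ) (f : List ℕ → K) : der j (cons k f) = if j = k then f else 0 := by
  funext w; simp only [der, cons]; split_ifs <;> rfl

theorem der_shift (j κ : ℕ) (f : List ℕ → K) :
    der j (shift κ f) = if κ ≤ j then der (j - κ) f else 0 := by
  funext w; simp only [der, shift]; split_ifs <;> rfl

theorem elt_cons_of_le {k N : ℕ} (h : N ≤ k) (f : List ℕ → K) : elt (cons k f) N = 0 := by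
  cases N with
  | zero => simp [elt_zero, cons]
  | succ N =>
    rw [elt_succ]
    refine sum_eq_zero fun q hq => ?_
    have := mem_antidiagonal.1 hq
    rw [der_cons, if_neg (by omega), elt_zero_series, mul_zero]

theorem elt_cons (k N : ℕ) (f : List ℕ → K) :
    elt (cons k f) (N + k + 1) = z K (k + 1) * elt f N := by
  rw [elt_succ, sum_eq_single (k, N)]
  · rw [der_cons, if_pos rfl]
  · intro q hq hne
    have := mem_antidiagonal.1 hq
    rw [der_cons, if_neg (fun h => hne (Prod.ext h (by simp only; omega))), elt_zero_series,
      mul_zero]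
  · intro h; exact absurd (mem_antidiagonal.2 (by simp only; omega)) h

theorem elt_shift_of_le {κ N : ℕ} (h : N ≤ κ) (f : List ℕ → K) : elt (shift κ f) N = 0 := by
  cases N with
  | zero => simp [elt_zero, shift]
  | succ N =>
    rw [elt_succ]
    refine sum_eq_zero fun q hq => ?_
    have := mem_antidiagonal.1 hq
    rw [der_shift, if_neg (by omega), elt_zero_series, mul_zero]

theorem elt_shift (κ N : ℕ) (f : List ℕ → K) :
    elt (shift κ f) (N + 1 + κ) = X K ^ κ * elt f (N + 1) := by
  rw [show N + 1 + κ = N + κ + 1 by omega, elt_succ, elt_succ, mul_sum]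
  rw [← sum_filter_add_sum_filter_not _ (fun q : ℕ × ℕ => κ ≤ q.1)]
  rw [sum_eq_zero (s := filter (fun q : ℕ × ℕ => ¬ κ ≤ q.1) _), add_zero]
  · refine sum_nbij' (fun q => (q.1 - κ, q.2)) (fun q => (q.1 + κ, q.2)) ?_ ?_ ?_ ?_ ?_
    · intro q hq; simp only [mem_filter, mem_antidiagonal] at hq ⊢; omega
    · intro q hq; simp only [mem_filter, mem_antidiagonal] at hq ⊢; omega
    · intro q hq
      simp only [mem_filter, mem_antidiagonal] at hq
      exact Prod.ext (by simp only; omega) rfl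
    · intro q hq; exact Prod.ext (by simp only; omega) rfl
    · intro q hq
      simp only [mem_filter, mem_antidiagonal] at hq
      rw [der_shift, if_pos hq.2, ← mul_assoc, X_pow_mul_z_succ]
      congr 2
      simp only; omega
  · intro q hq
    rw [der_shift, if_neg (mem_filter.1 hq).2, elt_zero_series, mul_zero]

theorem elt_succ_mem_hY (f : List ℕ → K) (N : ℕ) : elt f (N + 1) ∈ hY K := by
  induction N using Nat.strong_induction_on generalizing f with
  | _ N ih =>
    rw [elt_succ]
    refine Submodule.sum_mem _ fun q hq => ?_
    have := mem_antidiagonal.1 hq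
    obtain ⟨a, b⟩ := q
    cases b with
    | zero =>
      rw [elt_zero, mul_smul_comm, mul_one]
      exact Submodule.smul_mem _ _ (mul_Y_mem K _)
    | succ b => exact mul_mem_hY K _ (ih b (by simp only at this; omega) _)

/-- The condition `der 0 f = 0` says that no word of the series begins with z_1. -/
theorem elt_mem_h0 {f : List ℕ → K} (hf : der 0 f = 0) (N : ℕ) : elt f N ∈ h0 K := by
  cases N with
  | zero => rw [elt_zero]; exact Submodule.smul_mem _ _ (one_mem_h0 K)
  | succ N =>
    rw [elt_succ]
    refine Submodule.sum_mem _ fun q _ => ?_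
    obtain ⟨a, b⟩ := q
    cases a with
    | zero => simp only [hf, elt_zero_series, mul_zero]; exact Submodule.zero_mem _
    | succ a =>
      refine z_mul_mem_h0 K (by omega) ?_
      cases b with
      | zero =>
        rw [elt_zero]
        exact Submodule.smul_mem _ _ (Submodule.mem_sup_left (Submodule.mem_span_singleton_self 1))
      | succ b => exact Submodule.mem_sup_right (elt_succ_mem_hY _ b)

/-- The series form of `S_z_mul`. A final letter has nothing to merge into, which is why `shift`
drops the constant term. Only weights below N are assumed, so the lemma serves inside an induction
on the weight. -/
theorem S_elt_cons {f g : List ℕ → K} {N : ℕ} (k : ℕ) (h : ∀ M < N, S K (elt f M) = elt g M) :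
    S K (elt (cons k f) N) = elt (cons k g) N + elt (shift (k + 1) g) N := by
  rcases Nat.lt_or_ge k N with hN | hN
  · obtain ⟨M, rfl⟩ := Nat.exists_eq_add_of_lt hN
    have hM := h M (by omega)
    rw [show k + M + 1 = M + k + 1 by omega, elt_cons, elt_cons]
    cases M with
    | zero =>
      rw [elt_shift_of_le (by omega), ← hM, elt_zero, mul_smul_comm, mul_one, map_smul, map_smul,
        S_z, S_one, mul_smul_comm, mul_one, add_zero]
    | succ M =>
      rw [show M + 1 + k + 1 = M + 1 + (k + 1) by omega, elt_shift,
        S_z_mul _ (elt_succ_mem_hY f M), hM]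
  · rw [elt_cons_of_le hN, elt_cons_of_le hN, elt_shift_of_le (by omega), map_zero, add_zero]

/-- The series `∑ aⁿ z_{c+1}ⁿ`. -/
def eSer (c : ℕ) (a : K) : List ℕ → K
  | [] => 1
  | k :: w => if k = c then a * eSer c a w else 0

/-- The series `∑ S(z_{c+1}ⁿ)`. -/
def hSer (c : ℕ) : List ℕ → K
  | [] => 1
  | k :: w => if c + 1 ∣ k + 1 then hSer c w else 0

/-- The series `∑ (-1)ⁿ⁻¹ z_{n(c+1)}`. -/
def pSer (c : ℕ) : List ℕ → K
  | [] => 0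
  | k :: w => if c + 1 ∣ k + 1 then (-1) ^ ((k + 1) / (c + 1) + 1) * one w else 0

/-- Multiplies the coefficient of every word by its number of letters. -/
def euler (f : List ℕ → K) : List ℕ → K := fun w => w.length * f w

theorem der_eSer (c k : ℕ) (a : K) : der k (eSer c a) = if k = c then a • eSer c a else 0 := by
  funext w; simp only [der, eSer]; split_ifs <;> rfl

theorem der_hSer (c k : ℕ) :
    der k (hSer c : List ℕ → K) = if c + 1 ∣ k + 1 then hSer c else 0 := by
  funext w; simp only [der, hSer]; split_ifs <;> rfl

theorem der_pSer (c k : ℕ) : der k (pSer c : List ℕ → K) =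
    if c + 1 ∣ k + 1 then (-1 : K) ^ ((k + 1) / (c + 1) + 1) • one else 0 := by
  funext w; simp only [der, pSer]; split_ifs <;> rfl

/-- In a product with ∑ aⁿ z_{c+1}ⁿ the first letter comes from g, is z_{c+1}, or is z_{c+1} merged
with the first letter of g. This lemma and the next two treat the first letters below, at and above
z_{c+1}. -/
theorem der_st_eSer_of_lt {c k : ℕ} (h : k < c) (a : K) (g : List ℕ → K) :
    der k (st (eSer c a) g) = st (eSer c a) (der k g) := by
  cases k with
  | zero => rw [der_st_zero, der_eSer, if_neg (by omega), st_zero_left, zero_add]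
  | succ k =>
    rw [der_st_succ, der_eSer, if_neg (by omega), st_zero_left, zero_add, sum_eq_zero, add_zero]
    intro q hq
    have := mem_antidiagonal.1 hq
    rw [der_eSer, if_neg (by omega), st_zero_left]

theorem der_st_eSer_self (c : ℕ) (a : K) (g : List ℕ → K) :
    der c (st (eSer c a) g) = a • st (eSer c a) g + st (eSer c a) (der c g) := by
  cases c with
  | zero => rw [der_st_zero, der_eSer, if_pos rfl, st_smul_left]
  | succ k =>
    rw [der_st_succ, der_eSer, if_pos rfl, st_smul_left, sum_eq_zero, add_zero]
    intro q hq
    have := mem_antidiagonal.1 hq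
    rw [der_eSer, if_neg (by omega), st_zero_left]

theorem der_st_eSer_add (c j : ℕ) (a : K) (g : List ℕ → K) :
    der (c + j + 1) (st (eSer c a) g) =
      st (eSer c a) (der (c + j + 1) g) + a • st (eSer c a) (der j g) := by
  rw [der_st_succ, der_eSer, if_neg (by omega), st_zero_left, zero_add, sum_eq_single (c, j)]
  · rw [der_eSer, if_pos rfl, st_smul_left]
  · intro q hq hne
    have := mem_antidiagonal.1 hq
    rw [der_eSer, if_neg (fun h => hne (Prod.ext h (by simp only; omega))), st_zero_left]
  · intro h; exact (h (mem_antidiagonal.2 rfl)).elim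

/-- The letters of `hSer` are the multiples of c + 1. At a first letter above z_{c+1} the term from
`hSer` and the merged term cancel; at z_{c+1} itself the two unmerged terms cancel. -/
theorem st_eSer_hSer (c : ℕ) : st (eSer c (-1 : K)) (hSer c) = one := by
  funext w
  cases w with
  | nil => simp [st_nil, eSer, hSer, one]
  | cons k w =>
    change der k (st (eSer c (-1 : K)) (hSer c)) w = 0
    suffices h : der k (st (eSer c (-1 : K)) (hSer c)) = 0 by rw [h]; rfl
    rcases lt_trichotomy k c with h | rfl | h
    · rw [der_st_eSer_of_lt h, der_hSer, if_neg (fun hd => by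
        have := Nat.le_of_dvd (by omega) hd; omega), st_zero_right]
    · rw [der_st_eSer_self, der_hSer, if_pos dvd_rfl]; simp
    · obtain ⟨j, rfl⟩ := Nat.exists_eq_add_of_lt h
      rw [der_st_eSer_add, der_hSer, der_hSer]
      have : c + 1 ∣ c + j + 1 + 1 ↔ c + 1 ∣ j + 1 := by
        rw [show c + j + 1 + 1 = (c + 1) + (j + 1) by omega]
        exact Nat.dvd_add_right (dvd_refl (c + 1))
      simp only [this]
      split_ifs <;> simp [st_zero_right]

/-- Newton's identity. First letters above z_{c+1} cancel by the alternating signs of `pSer`; at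
z_{c+1} one more copy of `eSer` is added, which counts the new letter. -/
theorem st_eSer_pSer (c : ℕ) : st (eSer c (1 : K)) (pSer c) = euler (eSer c 1) := by
  funext w
  induction w with
  | nil => simp [st_nil, pSer, euler]
  | cons k w ih =>
    change der k (st (eSer c (1 : K)) (pSer c)) w = _
    rcases lt_trichotomy k c with h | rfl | h
    · rw [der_st_eSer_of_lt h, der_pSer, if_neg (fun hd => by
        have := Nat.le_of_dvd (by omega) hd; omega), st_zero_right]
      simp [euler, eSer, h.ne]
    · rw [der_st_eSer_self, der_pSer, if_pos dvd_rfl, Nat.div_self (by omega)]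
      simp only [st_smul_right, st_one_right, Pi.add_apply, Pi.smul_apply, ih]
      simp [euler, eSer]; ring
    · obtain ⟨j, rfl⟩ := Nat.exists_eq_add_of_lt h
      rw [der_st_eSer_add, der_pSer, der_pSer]
      have h1 : c + j + 1 + 1 = (c + 1) + (j + 1) := by omega
      simp only [h1, Nat.dvd_add_right (dvd_refl (c + 1)), Nat.add_div_left (j + 1) (Nat.succ_pos c)]
      have h2 : c + j + 1 ≠ c := by omega
      split_ifs
      · rw [st_smul_right, st_smul_right, one_smul, ← add_smul]
        simp [euler, eSer, h2, pow_succ]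
      · simp [st_zero_right, euler, eSer, h2]

theorem eSer_eq (c : ℕ) (a : K) : eSer c a = one + a • cons c (eSer c a) := by
  funext w; cases w <;> simp [eSer, one, cons]

theorem hSer_eq (c : ℕ) :
    (hSer c : List ℕ → K) = one + cons c (hSer c) + shift (c + 1) (hSer c) := by
  funext w
  cases w with
  | nil => simp [hSer, one, cons, shift]
  | cons k w =>
    simp only [hSer, one, cons, shift, Pi.add_apply, zero_add]
    rcases lt_trichotomy k c with h | rfl | h
    · rw [if_neg (fun hd => by have := Nat.le_of_dvd (by omega) hd; omega), if_neg h.ne,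
        if_neg (by omega), add_zero]
    · rw [if_pos dvd_rfl, if_pos rfl, if_neg (by omega), add_zero]
    · obtain ⟨j, rfl⟩ := Nat.exists_eq_add_of_lt h
      rw [if_neg (show c + j + 1 ≠ c by omega), if_pos (show c + 1 ≤ c + j + 1 by omega), zero_add,
        show c + j + 1 - (c + 1) = j by omega, show c + j + 1 + 1 = (c + 1) + (j + 1) by omega]
      simp only [Nat.dvd_add_right (dvd_refl (c + 1))]

theorem S_elt_one (N : ℕ) : S K (elt one N) = elt one N := by
  cases N with
  | zero => simp [elt_zero, one, S_one]
  | succ N => rw [elt_one_succ, map_zero]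

/-- By `S_elt_cons`, S carries the fixed-point equation `eSer_eq` to `hSer_eq`. -/
theorem S_elt_eSer (c N : ℕ) : S K (elt (eSer c 1) N) = elt (hSer c) N := by
  induction N using Nat.strong_induction_on with
  | _ N ih =>
    rw [eSer_eq, hSer_eq, elt_add, elt_add, elt_add, elt_smul, one_smul, map_add, S_elt_one,
      S_elt_cons c ih, add_assoc]

theorem elt_eSer_mul (c n : ℕ) (a : K) :
    elt (eSer c a) ((c + 1) * n) = a ^ n • z K (c + 1) ^ n := by
  induction n with
  | zero => simp [elt_zero, eSer]
  | succ n ih =>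
    rw [show (c + 1) * (n + 1) = (c + 1) * n + c + 1 by ring, eSer_eq, elt_add, elt_one_succ,
      elt_smul, elt_cons, ih, zero_add, mul_smul_comm, smul_smul, pow_succ' a, pow_succ']

theorem elt_eSer_of_not_dvd {c N : ℕ} (a : K) (h : ¬ c + 1 ∣ N) : elt (eSer c a) N = 0 := by
  induction N using Nat.strong_induction_on with
  | _ N ih =>
    have h0 : N ≠ 0 := fun h0 => h (h0 ▸ dvd_zero _)
    obtain ⟨N, rfl⟩ := Nat.exists_eq_succ_of_ne_zero h0
    rw [eSer_eq, elt_add, elt_one_succ, elt_smul, zero_add]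
    rcases Nat.lt_or_ge c (N + 1) with hN | hN
    · obtain ⟨M, hM⟩ := Nat.exists_eq_add_of_lt hN
      rw [show N.succ = M + c + 1 by omega, elt_cons, ih M (by omega), mul_zero, smul_zero]
      intro hd
      refine h ?_
      rw [show N.succ = (c + 1) + M by omega]
      exact (Nat.dvd_add_right (dvd_refl _)).2 hd
    · rw [elt_cons_of_le hN, smul_zero]

theorem elt_pSer_mul (c n : ℕ) : elt (pSer c : List ℕ → K) ((c + 1) * (n + 1)) =
    (-1 : K) ^ n • z K ((c + 1) * (n + 1)) := by
  rw [show (c + 1) * (n + 1) = (c + 1) * n + c + 1 by ring, elt_succ,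
    sum_eq_single ((c + 1) * n + c, 0)]
  · rw [der_pSer, show (c + 1) * n + c + 1 = (c + 1) * (n + 1) by ring, if_pos (dvd_mul_right _ _),
      Nat.mul_div_cancel_left _ (Nat.succ_pos c), elt_smul, elt_zero]
    simp [one, pow_succ]
  · rintro ⟨a, b⟩ hq hne
    have := mem_antidiagonal.1 hq
    simp only at this
    cases b with
    | zero => exact (hne (by rw [← this]; rfl)).elim
    | succ b =>
      rw [der_pSer]
      split_ifs
      · rw [elt_smul, elt_one_succ, smul_zero, mul_zero]
      · rw [elt_zero_series, mul_zero]
  · intro h; exact (h (mem_antidiagonal.2 rfl)).elim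

theorem elt_euler_eSer_mul (c n : ℕ) :
    elt (euler (eSer c (1 : K))) ((c + 1) * n) = (n : K) • z K (c + 1) ^ n := by
  have h : euler (eSer c (1 : K)) = cons c (eSer c 1 + euler (eSer c 1)) := by
    funext w
    cases w with
    | nil => simp [euler, cons]
    | cons k w =>
      simp only [euler, eSer, cons, List.length_cons, Pi.add_apply]
      split_ifs <;> push_cast <;> ring
  induction n with
  | zero => simp [elt_zero, euler]
  | succ n ih =>
    rw [h, show (c + 1) * (n + 1) = (c + 1) * n + c + 1 by ring, elt_cons, elt_add, ih,
      elt_eSer_mul, one_pow, ← add_smul, mul_smul_comm, pow_succ', Nat.cast_succ, add_comm (1 : K)]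

end

end MZV

/-! ### The series of the indices `{2}^{c_0}, 3, {2}^{c_1}, 1, …` -/

namespace MZV

noncomputable section

open Finset hiding antidiagonal mem_antidiagonal
open Finset.HasAntidiagonal

variable {K : Type*} [Field K]

/-- The words in `z_2`, `z_3`, `z_1` in which `z_3` and `z_1` alternate, the last one of these
letters being `z_1`; the first one is `z_3` for `false` and `z_1` for `true`. Every `z_2` has weight
`a`, every `z_3` and `z_1` has weight `b`. -/
def altSer (a b : K) : Bool → List ℕ → K
  | false, [] => 1
  | true, [] => 0
  | false, k :: w =>
      if k = 1 then a * altSer a b false w else if k = 2 then b * altSer a b true w else 0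
  | true, k :: w =>
      if k = 1 then a * altSer a b true w else if k = 0 then b * altSer a b false w else 0

/-- The pair `(α, β)` with `(c + d J) ^ n = α + β J` and `J ^ 2 = 1`. -/
def splitPow (c d : K) : ℕ → K × K
  | 0 => (1, 0)
  | n + 1 => (c * (splitPow c d n).1 + d * (splitPow c d n).2,
      c * (splitPow c d n).2 + d * (splitPow c d n).1)

/-- The image of `altSer c d` under `S`. -/
def altStarSer (c d : K) : Bool → List ℕ → K
  | false, [] => 1
  | true, [] => 0
  | false, k :: w => if Even k then (splitPow c d (k / 2)).2 * altStarSer c d true w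
      else (splitPow c d (k / 2 + 1)).1 * altStarSer c d false w
  | true, k :: w => if Even k then (splitPow c d (k / 2 + 1)).2 * altStarSer c d false w
      else (splitPow c d (k / 2 + 1)).1 * altStarSer c d true w

theorem splitPow_add (c d : K) (n : ℕ) :
    (splitPow c d n).1 + (splitPow c d n).2 = (c + d) ^ n := by
  induction n with
  | zero => simp [splitPow]
  | succ n ih => rw [pow_succ, ← ih, splitPow]; ring

/-- Here (c + dJ) - (c - d) = d(1 + J), and 1 + J is an eigenvector of c + dJ with eigenvalue c + d.
So both components of the difference are d(c + d)ⁿ. -/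
theorem splitPow_fst_sub (c d : K) (n : ℕ) :
    (splitPow c d (n + 1)).1 - (c - d) * (splitPow c d n).1 = d * (c + d) ^ n := by
  rw [← splitPow_add, splitPow]; ring

theorem splitPow_snd_sub (c d : K) (n : ℕ) :
    (splitPow c d (n + 1)).2 - (c - d) * (splitPow c d n).2 = d * (c + d) ^ n := by
  rw [← splitPow_add, splitPow]; ring

theorem altSer_false_eq (a b : K) : altSer a b false =
    one + a • cons 1 (altSer a b false) + b • cons 2 (altSer a b true) := by
  funext w
  cases w with
  | nil => simp [altSer, one, cons]
  | cons k w =>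
    rcases k with _ | _ | _ | k <;> simp [altSer, one, cons]

theorem altSer_true_eq (a b : K) : altSer a b true =
    b • cons 0 (altSer a b false) + a • cons 1 (altSer a b true) := by
  funext w
  cases w with
  | nil => simp [altSer, cons]
  | cons k w =>
    rcases k with _ | _ | k <;> simp [altSer, cons]

/-- S merges blocks of letters. A block leading from `false` to `true` has one z_3 more than z_1, so
r letters give z_{2r+1}; a block leading back has one z_1 more, and r + 1 letters are needed for
z_{2r+1}. A block that keeps the state has twice its length as weight. -/
theorem der_altStarSer_false_even (c d : K) (r : ℕ) : der (2 * r) (altStarSer c d false) =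
    (splitPow c d r).2 • altStarSer c d true := by
  funext w; simp [der, altStarSer]

theorem der_altStarSer_false_odd (c d : K) (r : ℕ) : der (2 * r + 1) (altStarSer c d false) =
    (splitPow c d (r + 1)).1 • altStarSer c d false := by
  funext w; simp [der, altStarSer, show (2 * r + 1) / 2 = r by omega]

theorem der_altStarSer_true_even (c d : K) (r : ℕ) : der (2 * r) (altStarSer c d true) =
    (splitPow c d (r + 1)).2 • altStarSer c d false := by
  funext w; simp [der, altStarSer]

theorem der_altStarSer_true_odd (c d : K) (r : ℕ) : der (2 * r + 1) (altStarSer c d true) =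
    (splitPow c d (r + 1)).1 • altStarSer c d true := by
  funext w; simp [der, altStarSer, show (2 * r + 1) / 2 = r by omega]

theorem ext_der {A : Type*} {f g : List ℕ → A} (h0 : f [] = g []) (h : ∀ k, der k f = der k g) : f = g := by
  funext w
  cases w with
  | nil => exact h0
  | cons k w => exact congrFun (h k) w

/-- The recursion of `splitPow` splits off the first letter of a merged block: z_2 with weight c, or
the state-changing letter with weight d. A block of length one gives `cons`, a longer one `shift`.
-/
theorem altStarSer_false_eq (c d : K) : altStarSer c d false = one +
    c • (cons 1 (altStarSer c d false) + shift 2 (altStarSer c d false)) +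
    d • (cons 2 (altStarSer c d true) + shift 3 (altStarSer c d true)) := by
  refine ext_der (by simp [altStarSer, one, cons, shift]) fun k => ?_
  change _ = der k one + c • (der k (cons 1 (altStarSer c d false)) +
    der k (shift 2 (altStarSer c d false))) + d • (der k (cons 2 (altStarSer c d true)) +
    der k (shift 3 (altStarSer c d true)))
  rw [der_one, der_cons, der_cons, der_shift, der_shift]
  obtain ⟨r, rfl | rfl⟩ := Nat.even_or_odd' k
  · rw [der_altStarSer_false_even]
    rcases r with _ | _ | r
    · simp [splitPow]
    · have := der_altStarSer_false_even c d 0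
      simp [splitPow] at this ⊢
      simp [this]
    · have h1 := der_altStarSer_false_even c d (r + 1)
      have h2 := der_altStarSer_true_odd c d r
      rw [if_neg (by omega), if_pos (by omega), if_neg (by omega), if_pos (by omega),
        show 2 * (r + 1 + 1) - 2 = 2 * (r + 1) by omega,
        show 2 * (r + 1 + 1) - 3 = 2 * r + 1 by omega, h1, h2, splitPow]
      module
  · rw [der_altStarSer_false_odd]
    rcases r with _ | r
    · simp [splitPow]
    · have h1 := der_altStarSer_false_odd c d r
      have h2 := der_altStarSer_true_even c d r
      rw [if_neg (by omega), if_pos (by omega), if_neg (by omega), if_pos (by omega),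
        show 2 * (r + 1) + 1 - 2 = 2 * r + 1 by omega,
        show 2 * (r + 1) + 1 - 3 = 2 * r by omega, h1, h2, splitPow]
      module

theorem altStarSer_true_eq (c d : K) : altStarSer c d true =
    d • (cons 0 (altStarSer c d false) + shift 1 (altStarSer c d false)) +
    c • (cons 1 (altStarSer c d true) + shift 2 (altStarSer c d true)) := by
  refine ext_der (by simp [altStarSer, cons, shift]) fun k => ?_
  change _ = d • (der k (cons 0 (altStarSer c d false)) +
    der k (shift 1 (altStarSer c d false))) + c • (der k (cons 1 (altStarSer c d true)) +
    der k (shift 2 (altStarSer c d true)))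
  rw [der_cons, der_cons, der_shift, der_shift]
  obtain ⟨r, rfl | rfl⟩ := Nat.even_or_odd' k
  · rw [der_altStarSer_true_even]
    rcases r with _ | r
    · simp [splitPow]
    · have h1 := der_altStarSer_true_even c d r
      have h2 := der_altStarSer_false_odd c d r
      rw [if_neg (by omega), if_pos (by omega), if_neg (by omega), if_pos (by omega),
        show 2 * (r + 1) - 2 = 2 * r by omega,
        show 2 * (r + 1) - 1 = 2 * r + 1 by omega, h1, h2, splitPow]
      module
  · rw [der_altStarSer_true_odd]
    rcases r with _ | r
    · have := der_altStarSer_false_even c d 0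
      simp [splitPow] at this ⊢
      simp [this]
    · have h1 := der_altStarSer_true_odd c d r
      have h2 := der_altStarSer_false_even c d (r + 1)
      rw [if_neg (by omega), if_pos (by omega), if_neg (by omega), if_pos (by omega),
        show 2 * (r + 1) + 1 - 2 = 2 * r + 1 by omega,
        show 2 * (r + 1) + 1 - 1 = 2 * (r + 1) by omega, h1, h2, splitPow]
      module

/-- S carries the fixed-point equations of `altSer` to those of `altStarSer`; the two states need a
common induction on the weight. -/
theorem S_elt_altSer (c d : K) (s : Bool) (N : ℕ) :
    S K (elt (altSer c d s) N) = elt (altStarSer c d s) N := by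
  induction N using Nat.strong_induction_on generalizing s with
  | _ N ih =>
    cases s
    · rw [altSer_false_eq, altStarSer_false_eq]
      simp only [elt_add, elt_smul, map_add, map_smul, S_elt_one]
      rw [S_elt_cons 1 fun M hM => ih M hM false, S_elt_cons 2 fun M hM => ih M hM true]
    · rw [altSer_true_eq, altStarSer_true_eq]
      simp only [elt_add, elt_smul, map_add, map_smul]
      rw [S_elt_cons 0 fun M hM => ih M hM false, S_elt_cons 1 fun M hM => ih M hM true]

/-- The first of two stuffle factors that turn `altStarSer c d` into `altSer (-c) d`. -/
def altMidSer (c d : K) (s : Bool) : List ℕ → K :=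
  st (eSer 1 (-(c - d))) (altStarSer c d s)

theorem der_altMidSer_false_zero (c d : K) : der 0 (altMidSer c d false) = 0 := by
  have h := der_altStarSer_false_even c d 0
  rw [mul_zero] at h
  rw [altMidSer, der_st_eSer_of_lt one_pos, h]
  simp [splitPow, st_zero_right]

/-- The first factor removes the eigenvalue c - d. Here and in the next three lemmas a geometric
sequence of ratio c + d is left. -/
theorem der_altMidSer_false_even (c d : K) (r : ℕ) :
    der (2 * r + 2) (altMidSer c d false) = (d * (c + d) ^ r) • altMidSer c d true := by
  have h := der_st_eSer_add 1 (2 * r) (-(c - d)) (altStarSer c d false)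
  rw [show 1 + 2 * r + 1 = 2 * (r + 1) by ring, der_altStarSer_false_even,
    der_altStarSer_false_even, st_smul_right, st_smul_right] at h
  rw [altMidSer, altMidSer, show 2 * r + 2 = 2 * (r + 1) by ring, h, ← splitPow_snd_sub]
  module

theorem der_altMidSer_false_odd (c d : K) (r : ℕ) :
    der (2 * r + 1) (altMidSer c d false) = (d * (c + d) ^ r) • altMidSer c d false := by
  cases r with
  | zero =>
    have h := der_st_eSer_self 1 (-(c - d)) (altStarSer c d false)
    have h' := der_altStarSer_false_odd c d 0
    simp only [mul_zero, zero_add] at h' ⊢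
    rw [altMidSer, h, h', st_smul_right, splitPow, splitPow]
    module
  | succ r =>
    have h := der_st_eSer_add 1 (2 * r + 1) (-(c - d)) (altStarSer c d false)
    rw [show 1 + (2 * r + 1) + 1 = 2 * (r + 1) + 1 by ring, der_altStarSer_false_odd,
      der_altStarSer_false_odd, st_smul_right, st_smul_right] at h
    rw [altMidSer, h, ← splitPow_fst_sub]
    module

theorem der_altMidSer_true_even (c d : K) (r : ℕ) :
    der (2 * r) (altMidSer c d true) = (d * (c + d) ^ r) • altMidSer c d false := by
  cases r with
  | zero =>
    have h := der_altStarSer_true_even c d 0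
    simp only [mul_zero, zero_add] at h ⊢
    rw [altMidSer, der_st_eSer_of_lt one_pos, h, st_smul_right, splitPow, splitPow, altMidSer]
    module
  | succ r =>
    have h := der_st_eSer_add 1 (2 * r) (-(c - d)) (altStarSer c d true)
    rw [show 1 + 2 * r + 1 = 2 * (r + 1) by ring, der_altStarSer_true_even,
      der_altStarSer_true_even, st_smul_right, st_smul_right] at h
    rw [altMidSer, altMidSer, h, ← splitPow_snd_sub]
    module

theorem der_altMidSer_true_odd (c d : K) (r : ℕ) :
    der (2 * r + 1) (altMidSer c d true) = (d * (c + d) ^ r) • altMidSer c d true := by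
  cases r with
  | zero =>
    have h := der_st_eSer_self 1 (-(c - d)) (altStarSer c d true)
    have h' := der_altStarSer_true_odd c d 0
    simp only [mul_zero, zero_add] at h' ⊢
    rw [altMidSer, h, h', st_smul_right, splitPow, splitPow]
    module
  | succ r =>
    have h := der_st_eSer_add 1 (2 * r + 1) (-(c - d)) (altStarSer c d true)
    rw [show 1 + (2 * r + 1) + 1 = 2 * (r + 1) + 1 by ring, der_altStarSer_true_odd,
      der_altStarSer_true_odd, st_smul_right, st_smul_right] at h
    rw [altMidSer, h, ← splitPow_fst_sub]
    module

/-- The second factor cancels consecutive terms of the geometric sequence, so only the letters z_1,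
z_2, z_3 survive. The letters z_1 and z_3 keep the weight d, and z_2 gets d - (c + d) = -c. -/
theorem st_altMidSer (c d : K) (s : Bool) :
    st (eSer 1 (-(c + d))) (altMidSer c d s) = altSer (-c) d s := by
  funext w
  induction w generalizing s with
  | nil => cases s <;> simp [st_nil, altMidSer, altSer, eSer, altStarSer]
  | cons k w ih =>
    change der k (st (eSer 1 (-(c + d))) (altMidSer c d s)) w = _
    rcases k with _ | _ | k
    · rw [der_st_eSer_of_lt one_pos]
      cases s
      · rw [der_altMidSer_false_zero, st_zero_right]
        simp [altSer]
      · have h := der_altMidSer_true_even c d 0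
        simp only [mul_zero] at h
        rw [h, st_smul_right, Pi.smul_apply, ih]
        simp [altSer]
    · rw [zero_add, der_st_eSer_self]
      cases s
      · have h := der_altMidSer_false_odd c d 0
        simp only [mul_zero, zero_add] at h
        rw [h, st_smul_right, Pi.add_apply, Pi.smul_apply, Pi.smul_apply, ih]
        simp [altSer]
        ring
      · have h := der_altMidSer_true_odd c d 0
        simp only [mul_zero, zero_add] at h
        rw [h, st_smul_right, Pi.add_apply, Pi.smul_apply, Pi.smul_apply, ih]
        simp [altSer]
        ring
    · rw [show k + 1 + 1 = 1 + k + 1 by ring, der_st_eSer_add]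
      obtain ⟨r, rfl | rfl⟩ := Nat.even_or_odd' k
      · rw [show 1 + 2 * r + 1 = 2 * r + 2 by ring]
        cases s
        · rw [der_altMidSer_false_even]
          cases r with
          | zero =>
            rw [mul_zero, der_altMidSer_false_zero, st_smul_right, st_zero_right, smul_zero,
              add_zero, Pi.smul_apply, ih]
            simp [altSer]
          | succ r =>
            rw [show 2 * (r + 1) = 2 * r + 2 by ring, der_altMidSer_false_even, st_smul_right,
              st_smul_right, smul_smul, ← add_smul, Pi.smul_apply]
            simp [altSer, pow_succ]
            left; ring
        · rw [show 2 * r + 2 = 2 * (r + 1) by ring, der_altMidSer_true_even,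
            der_altMidSer_true_even, st_smul_right, st_smul_right, smul_smul, ← add_smul,
            Pi.smul_apply]
          simp [altSer, pow_succ]
          left; ring
      · rw [show 1 + (2 * r + 1) + 1 = 2 * (r + 1) + 1 by ring]
        cases s
        · rw [der_altMidSer_false_odd, der_altMidSer_false_odd, st_smul_right,
            st_smul_right, smul_smul, ← add_smul, Pi.smul_apply]
          simp [altSer, pow_succ]
          left; ring
        · rw [der_altMidSer_true_odd, der_altMidSer_true_odd, st_smul_right,
            st_smul_right, smul_smul, ← add_smul, Pi.smul_apply]
          simp [altSer, pow_succ]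
          left; ring

end

end MZV

/-! ### The sums over the indices `{2}^{c_0}, 3, {2}^{c_1}, 1, …` -/

namespace MZV

noncomputable section

open Finset hiding antidiagonal mem_antidiagonal
open Finset.HasAntidiagonal

variable {K : Type*} [Field K]

theorem sum_antidiagonalTuple_succ {M : Type*} [AddCommMonoid M] (k N : ℕ)
    (F : (Fin (k + 1) → ℕ) → M) :
    ∑ c ∈ Finset.Nat.antidiagonalTuple (k + 1) N, F c =
      ∑ q ∈ antidiagonal N, ∑ c ∈ Finset.Nat.antidiagonalTuple k q.2, F (Fin.cons q.1 c) := by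
  rw [sum_sigma']
  refine sum_nbij' (fun c => ⟨(c 0, ∑ i, Fin.tail c i), Fin.tail c⟩)
    (fun x => Fin.cons x.1.1 x.2) ?_ ?_ ?_ ?_ ?_
  · intro c hc
    rw [Finset.Nat.mem_antidiagonalTuple, Fin.sum_univ_succ] at hc
    simp only [mem_sigma, mem_antidiagonal, Finset.Nat.mem_antidiagonalTuple, and_true]
    exact hc
  · rintro ⟨⟨a, b⟩, c⟩ h
    simp only [mem_sigma, mem_antidiagonal, Finset.Nat.mem_antidiagonalTuple] at h ⊢
    rw [Fin.sum_univ_succ]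
    simpa [h.2] using h.1
  · intro c _; simp
  · rintro ⟨⟨a, b⟩, c⟩ h
    simp only [mem_sigma, mem_antidiagonal, Finset.Nat.mem_antidiagonalTuple] at h
    simp [h.2]
  · intro c _; simp

theorem insertTwos_cons_cons (n a b : ℕ) (c : Fin (2 * n + 1) → ℕ) :
    insertTwos (n + 1) (Fin.cons a (Fin.cons b c : Fin (2 * n + 1 + 1) → ℕ)) =
      List.replicate a 2 ++ 3 :: (List.replicate b 2 ++ 1 :: insertTwos n c) := by
  rw [insertTwos, List.finRange_succ, List.flatMap_cons, List.flatMap_map, insertTwos]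
  simp only [List.append_assoc, List.cons_append]
  rfl

/-- The sum of the words of all indices `insertTwos n c` with `M` inserted entries `2`. -/
def altSum (K : Type*) [Field K] (n M : ℕ) : H K :=
  ∑ c ∈ Finset.Nat.antidiagonalTuple (2 * n + 1) M, zProd K (insertTwos n c)

/-- The sum of all words `{2}^{c_0}, 1, …` with `M` inserted entries `2`. -/
def altSum' (K : Type*) [Field K] (n M : ℕ) : H K :=
  ∑ q ∈ antidiagonal M, z K 2 ^ q.1 * (z K 1 * altSum K n q.2)

theorem altSum_zero (M : ℕ) : altSum K 0 M = z K 2 ^ M := by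
  refine (sum_congr (Finset.Nat.antidiagonalTuple_one M) fun _ _ => rfl).trans ?_
  rw [sum_singleton, insertTwos, List.finRange_zero, List.flatMap_nil, List.append_nil,
    zProd_replicate]
  rfl

theorem altSum_succ (n M : ℕ) : altSum K (n + 1) M =
    ∑ q ∈ antidiagonal M, z K 2 ^ q.1 * (z K 3 * altSum' K n q.2) := by
  refine (sum_antidiagonalTuple_succ (2 * n + 1 + 1) M
    fun c => zProd K (insertTwos (n + 1) c)).trans ?_
  refine sum_congr rfl fun q _ => ?_
  rw [sum_antidiagonalTuple_succ, altSum', mul_sum, mul_sum]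
  refine sum_congr rfl fun r _ => ?_
  rw [altSum]
  simp only [mul_sum]
  refine sum_congr rfl fun c _ => ?_
  rw [insertTwos_cons_cons, zProd_append, zProd_cons, zProd_append, zProd_cons, zProd_replicate,
    zProd_replicate]

theorem sum_antidiagonal_pow_succ {A : Type*} [Semiring A] (a : A) (f : ℕ → A) (M : ℕ) :
    ∑ q ∈ antidiagonal (M + 1), a ^ q.1 * f q.2 =
      a * ∑ q ∈ antidiagonal M, a ^ q.1 * f q.2 + f (M + 1) := by
  rw [Finset.Nat.sum_antidiagonal_succ, mul_sum, add_comm]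
  simp only [pow_succ', mul_assoc, pow_zero, one_mul]

/-- The component of weight `2m` of `altSum`. -/
def altW (K : Type*) [Field K] (m n : ℕ) : H K := if 2 * n ≤ m then altSum K n (m - 2 * n) else 0

/-- The component of weight `2m + 1` of `altSum'`. -/
def altW' (K : Type*) [Field K] (m n : ℕ) : H K :=
  if 2 * n ≤ m then altSum' K n (m - 2 * n) else 0

theorem altW_of_lt {m n : ℕ} (h : m < 2 * n) : altW K m n = 0 := if_neg (by omega)

theorem altW'_of_lt {m n : ℕ} (h : m < 2 * n) : altW' K m n = 0 := if_neg (by omega)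

theorem altW_zero (m : ℕ) : altW K m 0 = z K 2 ^ m := by
  rw [altW, if_pos (by omega), altSum_zero]; rfl

/-- The first letter is z_2 or the first z_3. Setting the sums to 0 for m < 2n makes this recursion
hold without side conditions. -/
theorem altW_succ_succ (m n : ℕ) :
    altW K (m + 2) (n + 1) = z K 2 * altW K (m + 1) (n + 1) + z K 3 * altW' K m n := by
  rcases Nat.lt_or_ge m (2 * n) with h | h
  · rw [altW_of_lt (by omega), altW_of_lt (by omega), altW'_of_lt h]; simp
  obtain ⟨M, rfl⟩ := Nat.exists_eq_add_of_le h
  rw [altW, if_pos (by omega), altW', if_pos h, show 2 * n + M + 2 - 2 * (n + 1) = M by omega,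
    Nat.add_sub_cancel_left, altSum_succ]
  cases M with
  | zero => rw [altW_of_lt (by omega)]; simp
  | succ M =>
    rw [altW, if_pos (by omega), show 2 * n + (M + 1) + 1 - 2 * (n + 1) = M by omega, altSum_succ,
      sum_antidiagonal_pow_succ _ fun j => z K 3 * altSum' K n j]

theorem altW'_zero (n : ℕ) : altW' K 0 n = z K 1 * altW K 0 n := by
  cases n with
  | zero => simp [altW', altW, altSum']
  | succ n => rw [altW_of_lt (by omega), altW'_of_lt (by omega), mul_zero]

theorem altW'_succ (m n : ℕ) :
    altW' K (m + 1) n = z K 2 * altW' K m n + z K 1 * altW K (m + 1) n := by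
  rcases Nat.lt_or_ge (m + 1) (2 * n) with h | h
  · rw [altW_of_lt (by omega), altW'_of_lt (by omega), altW'_of_lt (by omega)]; simp
  obtain ⟨M, hM⟩ := Nat.exists_eq_add_of_le h
  rw [altW', if_pos h, altW, if_pos h, hM, Nat.add_sub_cancel_left, altSum']
  cases M with
  | zero => rw [altW'_of_lt (by omega)]; simp
  | succ M =>
    rw [altW', if_pos (by omega), show m - 2 * n = M by omega, altSum',
      sum_antidiagonal_pow_succ _ fun j => z K 1 * altSum K n j]

/-! ### The shuffle product of powers of `xy` -/

/-- The number `binom(p + q - 2n, p - n)`, to be read as `0` unless `n ≤ p` and `n ≤ q`. -/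
def midChoose (p q n : ℕ) : ℕ := if n ≤ p ∧ n ≤ q then (p + q - 2 * n).choose (p - n) else 0

theorem midChoose_succ_succ_succ (p q n : ℕ) :
    midChoose (p + 1) (q + 1) (n + 1) = midChoose p q n := by
  simp only [midChoose, Nat.add_le_add_iff_right, show p + 1 + (q + 1) - 2 * (n + 1) =
    p + q - 2 * n by omega, Nat.add_sub_add_right]

theorem midChoose_zero_right (p n : ℕ) : midChoose p 0 n = if n = 0 then 1 else 0 := by
  rcases n with _ | n <;> simp [midChoose]

theorem midChoose_zero_left (q n : ℕ) : midChoose 0 q n = if n = 0 then 1 else 0 := by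
  rcases n with _ | n <;> simp [midChoose]

/-- Pascal's rule. It fails only at n = p + 1 = q + 1, where the left side is 1 and both terms on
the right are 0; the hypothesis excludes this corner. -/
theorem midChoose_succ_succ {p q n : ℕ} (h : 2 * n ≤ p + q + 1) :
    midChoose (p + 1) (q + 1) n = midChoose p (q + 1) n + midChoose (p + 1) q n := by
  unfold midChoose
  rcases Nat.lt_or_ge (p + 1) n with h1 | h1
  · rw [if_neg (by omega), if_neg (by omega), if_neg (by omega)]
  rcases Nat.lt_or_ge (q + 1) n with h2 | h2
  · rw [if_neg (by omega), if_neg (by omega), if_neg (by omega)]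
  rw [if_pos ⟨h1, h2⟩]
  rcases Nat.lt_or_ge p n with h3 | h3
  · rw [if_neg (by omega), if_pos (by omega), zero_add, show p + 1 - n = 0 by omega,
      Nat.choose_zero_right, Nat.choose_zero_right]
  rcases Nat.lt_or_ge q n with h4 | h4
  · rw [if_pos (by omega), if_neg (by omega), add_zero,
      show p + 1 + (q + 1) - 2 * n = p + 1 - n by omega,
      show p + (q + 1) - 2 * n = p - n by omega, Nat.choose_self, Nat.choose_self]
  rw [if_pos ⟨h3, h2⟩, if_pos ⟨h1, h4⟩]
  rw [show p + 1 + (q + 1) - 2 * n = p + q + 1 - 2 * n + 1 by omega,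
    show p + 1 - n = p - n + 1 by omega, Nat.choose_succ_succ,
    show p + (q + 1) - 2 * n = p + q + 1 - 2 * n by omega,
    show p + 1 + q - 2 * n = p + q + 1 - 2 * n by omega]

theorem z_one : z K 1 = Y K := by simp [z]

theorem z_two : z K 2 = X K * Y K := by simp [z]

theorem z_three : z K 3 = X K * (X K * Y K) := by simp [z, pow_two, mul_assoc]

theorem z_two_pow_succ (p : ℕ) : z K 2 ^ (p + 1) = X K * (Y K * z K 2 ^ p) := by
  rw [pow_succ', z_two, mul_assoc]

/-- The first two letters of a shuffle are either xy from a single factor, or one x from each, in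
two possible orders. -/
theorem shuffle_pow_succ_succ (p q : ℕ) :
    shuffle K (z K 2 ^ (p + 1)) (z K 2 ^ (q + 1)) =
      z K 2 * (shuffle K (z K 2 ^ p) (z K 2 ^ (q + 1)) + shuffle K (z K 2 ^ (p + 1)) (z K 2 ^ q)) +
      (2 : K) • (X K * (X K * shuffle K (Y K * z K 2 ^ p) (Y K * z K 2 ^ q))) := by
  conv_lhs => rw [z_two_pow_succ, z_two_pow_succ, shuffle_X_X, shuffle_Y_X, shuffle_X_Y,
    ← z_two_pow_succ, ← z_two_pow_succ]
  rw [z_two, two_smul]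
  noncomm_ring

theorem shuffle_Y_pow_succ_succ (p q : ℕ) :
    shuffle K (Y K * z K 2 ^ (p + 1)) (Y K * z K 2 ^ (q + 1)) =
      (2 : K) • (Y K * (Y K * shuffle K (z K 2 ^ (p + 1)) (z K 2 ^ (q + 1)))) +
      Y K * (X K * (shuffle K (Y K * z K 2 ^ p) (Y K * z K 2 ^ (q + 1)) +
        shuffle K (Y K * z K 2 ^ (p + 1)) (Y K * z K 2 ^ q))) := by
  rw [shuffle_Y_Y]
  conv_lhs => rw [z_two_pow_succ p, shuffle_X_Y, ← z_two_pow_succ p, z_two_pow_succ q,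
    shuffle_Y_X, ← z_two_pow_succ q]
  rw [two_smul]
  noncomm_ring

theorem shuffle_Y_mul_Y (u : H K) :
    shuffle K (Y K * u) (Y K) = Y K * shuffle K u (Y K) + Y K * (Y K * u) := by
  have h := shuffle_Y_Y u 1
  rwa [mul_one, shuffle_one_right] at h

theorem shuffle_X_mul_Y (u : H K) :
    shuffle K (X K * u) (Y K) = X K * shuffle K u (Y K) + Y K * (X K * u) := by
  have h := shuffle_X_Y u 1
  rwa [mul_one, shuffle_one_right] at h

theorem shuffle_Y_Y_mul (u : H K) :
    shuffle K (Y K) (Y K * u) = Y K * (Y K * u) + Y K * shuffle K (Y K) u := by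
  have h := shuffle_Y_Y 1 u
  rwa [mul_one, shuffle_one_left] at h

theorem shuffle_Y_X_mul (u : H K) :
    shuffle K (Y K) (X K * u) = Y K * (X K * u) + X K * shuffle K (Y K) u := by
  have h := shuffle_Y_X 1 u
  rwa [mul_one, shuffle_one_left] at h

theorem shuffle_Y_Y_self : shuffle K (Y K) (Y K) = (2 : K) • (Y K * Y K) := by
  have h := shuffle_Y_mul_Y (1 : H K)
  rwa [mul_one, shuffle_one_left, ← two_smul K] at h

theorem shuffle_Y_pow_succ_zero (p : ℕ) :
    shuffle K (Y K * z K 2 ^ (p + 1)) (Y K) =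
      (2 : K) • (Y K * (Y K * z K 2 ^ (p + 1))) +
      Y K * (X K * shuffle K (Y K * z K 2 ^ p) (Y K)) := by
  rw [shuffle_Y_mul_Y]
  conv_lhs => rw [z_two_pow_succ p, shuffle_X_mul_Y, ← z_two_pow_succ p]
  rw [two_smul]
  noncomm_ring

theorem shuffle_Y_pow_zero_succ (q : ℕ) :
    shuffle K (Y K) (Y K * z K 2 ^ (q + 1)) =
      (2 : K) • (Y K * (Y K * z K 2 ^ (q + 1))) +
      Y K * (X K * shuffle K (Y K) (Y K * z K 2 ^ q)) := by
  rw [shuffle_Y_Y_mul]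
  conv_lhs => rw [z_two_pow_succ q, shuffle_Y_X_mul, ← z_two_pow_succ q]
  rw [two_smul]
  noncomm_ring

theorem mul_altW'_succ (m n : ℕ) : Y K * altW' K (m + 1) n =
    Y K * (X K * (Y K * altW' K m n)) + Y K * (Y K * altW K (m + 1) n) := by
  rw [altW'_succ, z_one, z_two, mul_add, mul_assoc]

/-- The sum of the words of weight `2 (p + q)` in the shuffle product of two powers of `xy`. -/
def midSum (K : Type*) [Field K] (p q : ℕ) (f : ℕ → H K) : H K :=
  ∑ n ∈ range (p + q + 1), ((4 : K) ^ n * (midChoose p q n : K)) • f n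

theorem midSum_eq {p q N : ℕ} (h : p + q < N) (f : ℕ → H K) :
    midSum K p q f = ∑ n ∈ range N, ((4 : K) ^ n * (midChoose p q n : K)) • f n := by
  refine sum_subset (range_subset_range.2 h) fun n _ hn => ?_
  rw [mem_range, not_lt] at hn
  rw [midChoose, if_neg (by omega), Nat.cast_zero, mul_zero, zero_smul]

theorem midSum_zero_right (p : ℕ) (f : ℕ → H K) : midSum K p 0 f = f 0 := by
  rw [midSum, sum_eq_single 0]
  · simp [midChoose]
  · intro n _ hn; simp [midChoose_zero_right, hn]
  · intro h; exact absurd (mem_range.2 (Nat.succ_pos _)) h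

theorem midSum_zero_left (q : ℕ) (f : ℕ → H K) : midSum K 0 q f = f 0 := by
  rw [midSum, sum_eq_single 0]
  · simp [midChoose]
  · intro n _ hn; simp [midChoose_zero_left, hn]
  · intro h; exact absurd (mem_range.2 (Nat.succ_pos _)) h

/-- The vanishing of f covers exactly the range where Pascal's rule is not available. -/
theorem midSum_succ_succ (p q : ℕ) {f : ℕ → H K} (hf : ∀ n, p + q + 1 < 2 * n → f n = 0) :
    midSum K (p + 1) (q + 1) f = midSum K p (q + 1) f + midSum K (p + 1) q f := by
  rw [midSum_eq (N := p + q + 3) (by omega), midSum_eq (N := p + q + 3) (by omega),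
    midSum_eq (N := p + q + 3) (by omega), ← sum_add_distrib]
  refine sum_congr rfl fun n _ => ?_
  rcases Nat.lt_or_ge (p + q + 1) (2 * n) with h | h
  · rw [hf n h]; simp
  · rw [midChoose_succ_succ h, Nat.cast_add, mul_add, add_smul]

/-- `midChoose` depends only on p - n and q - n, so lowering p, q and n together costs just the
factor 4. -/
theorem midSum_succ_succ_shift (p q : ℕ) {f g : ℕ → H K} (h0 : f 0 = 0)
    (h : ∀ n, f (n + 1) = g n) :
    midSum K (p + 1) (q + 1) f = (4 : K) • midSum K p q g := by
  rw [midSum, sum_range_succ', h0, smul_zero, add_zero, midSum_eq (N := p + 1 + (q + 1)) (by omega),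
    smul_sum]
  refine sum_congr rfl fun n _ => ?_
  rw [midChoose_succ_succ_succ, h, smul_smul]
  congr 1; ring

theorem midSum_add (p q : ℕ) (f g : ℕ → H K) :
    midSum K p q (fun n => f n + g n) = midSum K p q f + midSum K p q g := by
  simp only [midSum, smul_add, sum_add_distrib]

theorem midSum_mul (p q : ℕ) (u : H K) (f : ℕ → H K) :
    midSum K p q (fun n => u * f n) = u * midSum K p q f := by
  simp only [midSum, mul_sum, mul_smul_comm]

/-- The counterpart of `shuffle_pow_succ_succ`. The 4 is a product of two factors 2, one from the
two orders of xx and one from the two orders of yy. -/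
theorem midSum_altW_succ_succ (p q : ℕ) :
    midSum K (p + 1) (q + 1) (altW K (p + q + 2)) =
      z K 2 * (midSum K p (q + 1) (altW K (p + q + 1)) +
        midSum K (p + 1) q (altW K (p + q + 1))) +
      (4 : K) • (X K * (X K * midSum K p q (fun n => Y K * altW' K (p + q) n))) := by
  let g : ℕ → H K := fun n => match n with
    | 0 => 0
    | n + 1 => z K 3 * altW' K (p + q) n
  have h : altW K (p + q + 2) = fun n => z K 2 * altW K (p + q + 1) n + g n := by
    funext n
    cases n with
    | zero => simp [altW_zero, g, pow_succ']
    | succ n => exact altW_succ_succ _ _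
  rw [h, midSum_add, midSum_mul, midSum_succ_succ p q fun n hn => altW_of_lt hn,
    midSum_succ_succ_shift p q (f := g) (g := fun n => z K 3 * altW' K (p + q) n) rfl
      fun _ => rfl, midSum_mul, midSum_mul, z_three]
  simp only [mul_assoc]

theorem midSum_altW'_succ_succ (p q : ℕ) :
    midSum K (p + 1) (q + 1) (fun n => Y K * altW' K (p + q + 2) n) =
      Y K * (Y K * midSum K (p + 1) (q + 1) (altW K (p + q + 2))) +
      Y K * (X K * (midSum K p (q + 1) (fun n => Y K * altW' K (p + q + 1) n) +
        midSum K (p + 1) q (fun n => Y K * altW' K (p + q + 1) n))) := by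
  simp only [mul_altW'_succ (p + q + 1)]
  rw [midSum_add, midSum_mul _ _ _ fun n => X K * (Y K * altW' K (p + q + 1) n),
    midSum_mul _ _ _ fun n => Y K * altW' K (p + q + 1) n,
    midSum_mul _ _ _ fun n => Y K * altW K (p + q + 1 + 1) n,
    midSum_mul _ _ _ fun n => altW K (p + q + 1 + 1) n,
    midSum_succ_succ p q (f := fun n => Y K * altW' K (p + q + 1) n) fun n hn => by
      rw [altW'_of_lt hn, mul_zero], add_comm]

/-- The halves depend on each other: removing xx from two powers of xy leaves two words beginning
with y, and removing yy from those leaves powers of xy again. -/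
theorem shuffle_pow_pow_aux (p q : ℕ) :
    shuffle K (z K 2 ^ p) (z K 2 ^ q) = midSum K p q (altW K (p + q)) ∧
    shuffle K (Y K * z K 2 ^ p) (Y K * z K 2 ^ q) =
      (2 : K) • midSum K p q (fun n => Y K * altW' K (p + q) n) := by
  induction hN : p + q using Nat.strong_induction_on generalizing p q with
  | _ N ih =>
    subst hN
    rcases p with _ | p <;> rcases q with _ | q
    · simp only [pow_zero, mul_one, shuffle_one_left, shuffle_Y_Y_self, midSum_zero_left,
        altW_zero, altW'_zero, z_one, add_zero, and_self]
    · have h := (ih (0 + q) (by omega) 0 q rfl).2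
      rw [pow_zero, mul_one] at h
      rw [pow_zero, mul_one, shuffle_one_left, shuffle_Y_pow_zero_succ, h, midSum_zero_left,
        midSum_zero_left, midSum_zero_left, zero_add, zero_add, altW_zero, mul_altW'_succ,
        altW_zero]
      refine ⟨rfl, ?_⟩
      simp only [mul_smul_comm, ← smul_add]
      rw [add_comm]
    · have h := (ih (p + 0) (by omega) p 0 rfl).2
      rw [pow_zero, mul_one] at h
      rw [pow_zero, mul_one, shuffle_one_right, shuffle_Y_pow_succ_zero, h, midSum_zero_right,
        midSum_zero_right, midSum_zero_right, add_zero, add_zero, altW_zero, mul_altW'_succ,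
        altW_zero]
      refine ⟨rfl, ?_⟩
      simp only [mul_smul_comm, ← smul_add]
      rw [add_comm]
    · obtain ⟨h1, h1'⟩ := ih (p + q + 1) (by omega) p (q + 1) rfl
      obtain ⟨h2, h2'⟩ := ih (p + q + 1) (by omega) (p + 1) q (by ring)
      obtain ⟨h3, h3'⟩ := ih (p + q) (by omega) p q rfl
      -- Proved first because the second half uses it for this same pair of exponents, not a smaller
      -- one.
      have hA : shuffle K (z K 2 ^ (p + 1)) (z K 2 ^ (q + 1)) =
          midSum K (p + 1) (q + 1) (altW K (p + q + 2)) := by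
        rw [shuffle_pow_succ_succ, h1, h2, h3', midSum_altW_succ_succ]
        simp only [mul_smul_comm, smul_smul]
        norm_num
      rw [show p + 1 + (q + 1) = p + q + 2 by ring]
      refine ⟨hA, ?_⟩
      rw [shuffle_Y_pow_succ_succ, hA, h1', h2', midSum_altW'_succ_succ]
      simp only [mul_smul_comm, ← smul_add]

/-- The product of two powers of `xy` in terms of the sums of the words `{2}^{c_0}, 3, …`. -/
theorem shuffle_pow_pow (p q : ℕ) :
    shuffle K (z K 2 ^ p) (z K 2 ^ q) = ∑ n ∈ range (p + q + 1),
      ((4 : K) ^ n * (midChoose p q n : K)) • altW K (p + q) n :=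
  (shuffle_pow_pow_aux p q).1

end

end MZV

/-! ### Weight components of the alternating series, and admissibility of the series -/

namespace MZV

noncomputable section

open Finset hiding antidiagonal mem_antidiagonal
open Finset.HasAntidiagonal

variable {K : Type*} [Field K]

/-- The truncated exponent m - 2n does no harm, as `altW K m n` vanishes where the truncation
occurs. -/
theorem smul_altW_succ (a b : K) (m n : ℕ) :
    a • ((a ^ (m - 2 * n) * b) • altW K m n) = (a ^ (m + 1 - 2 * n) * b) • altW K m n := by
  rcases Nat.lt_or_ge m (2 * n) with h | h
  · simp [altW_of_lt h]
  · rw [smul_smul, ← mul_assoc, ← pow_succ', show m - 2 * n + 1 = m + 1 - 2 * n by omega]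

theorem smul_altW'_succ (a b : K) (m n : ℕ) :
    a • ((a ^ (m - 2 * n) * b) • altW' K m n) = (a ^ (m + 1 - 2 * n) * b) • altW' K m n := by
  rcases Nat.lt_or_ge m (2 * n) with h | h
  · simp [altW'_of_lt h]
  · rw [smul_smul, ← mul_assoc, ← pow_succ', show m - 2 * n + 1 = m + 1 - 2 * n by omega]

/-- The bound N is left free so that the sums over n have matching ranges after the index shift
caused by a letter z_3. -/
theorem elt_altSer_aux (a b : K) (m N : ℕ) (hN : m < N) :
    elt (altSer a b false) (2 * m) =
      ∑ n ∈ range N, (a ^ (m - 2 * n) * b ^ (2 * n)) • altW K m n ∧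
    elt (altSer a b true) (2 * m + 1) =
      ∑ n ∈ range N, (a ^ (m - 2 * n) * b ^ (2 * n + 1)) • altW' K m n := by
  induction m using Nat.strong_induction_on generalizing N with
  | _ m ih =>
    obtain ⟨N, rfl⟩ : ∃ N', N = N' + 1 := ⟨N - 1, by omega⟩
    have hfalse : elt (altSer a b false) (2 * m) =
        ∑ n ∈ range (N + 1), (a ^ (m - 2 * n) * b ^ (2 * n)) • altW K m n := by
      rcases m with _ | _ | m
      · rw [sum_eq_single 0]
        · simp [elt_zero, altSer, altW_zero]
        · intro n _ hn; rw [altW_of_lt (by omega), smul_zero]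
        · intro h; exact absurd (mem_range.2 (Nat.succ_pos _)) h
      · have h0 := (ih 0 (by omega) 1 (by omega)).1
        simp only [mul_zero, range_one, sum_singleton, altW_zero, pow_zero,
          mul_one] at h0
        rw [altSer_false_eq, elt_add, elt_add, elt_smul, elt_smul,
          show 2 * (0 + 1) = 0 + 1 + 1 by rfl, elt_cons 1 0, elt_cons_of_le (k := 2) (by omega), h0,
          elt_one_succ, sum_eq_single 0]
        · simp [altW_zero]
        · intro n _ hn; rw [altW_of_lt (by omega), smul_zero]
        · intro h; exact absurd (mem_range.2 (Nat.succ_pos _)) h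
      · rw [altSer_false_eq, elt_add, elt_add, elt_smul, elt_smul,
          show 2 * (m + 1 + 1) = 2 * (m + 1) + 1 + 1 by ring, elt_cons, elt_one_succ,
          show 2 * (m + 1) + 1 + 1 = 2 * m + 1 + 2 + 1 by ring, elt_cons,
          (ih (m + 1) (by omega) (N + 1) (by omega)).1, (ih m (by omega) N (by omega)).2,
          sum_range_succ', sum_range_succ', mul_add, smul_add, zero_add, mul_sum, mul_sum,
          smul_sum, smul_sum, add_right_comm, ← sum_add_distrib]
        congr 1
        · refine sum_congr rfl fun n _ => ?_
          rw [altW_succ_succ, smul_add, ← mul_smul_comm a, smul_altW_succ, mul_smul_comm,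
            mul_smul_comm, smul_smul]
          congr 2
          rw [show m + 1 + 1 - 2 * (n + 1) = m - 2 * n by omega]
          ring
        · rw [← mul_smul_comm, smul_altW_succ, altW_zero, altW_zero, mul_smul_comm,
            pow_succ' (z K 2) (m + 1)]
    refine ⟨hfalse, ?_⟩
    rw [altSer_true_eq, elt_add, elt_smul, elt_smul]
    have h0 := elt_cons 0 (2 * m) (altSer a b false)
    rw [add_zero] at h0
    rw [h0, hfalse]
    rcases m with _ | m
    · rw [elt_cons_of_le (by omega), smul_zero, add_zero, mul_sum, smul_sum]
      refine sum_congr rfl fun n _ => ?_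
      rw [altW'_zero, mul_smul_comm, smul_smul]
      congr 1; ring
    · rw [show 2 * (m + 1) + 1 = 2 * m + 1 + 1 + 1 by ring, elt_cons,
        (ih m (by omega) (N + 1) (by omega)).2, mul_sum, smul_sum, mul_sum, smul_sum,
        ← sum_add_distrib]
      refine sum_congr rfl fun n _ => ?_
      rw [altW'_succ, ← mul_smul_comm a, smul_altW'_succ, mul_smul_comm, mul_smul_comm, smul_smul,
        smul_add, add_comm]
      congr 2; ring

theorem elt_altSer (a b : K) (m : ℕ) : elt (altSer a b false) (2 * m) =
    ∑ n ∈ range (m + 1), (a ^ (m - 2 * n) * b ^ (2 * n)) • altW K m n :=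
  (elt_altSer_aux a b m (m + 1) (by omega)).1

theorem der_zero_altStarSer (c d : K) : der 0 (altStarSer c d false) = 0 := by
  have h := der_altStarSer_false_even c d 0
  rw [mul_zero] at h
  rw [h]
  simp [splitPow]

theorem der_zero_eSer {c : ℕ} (hc : c ≠ 0) (a : K) : der 0 (eSer c a) = 0 := by
  rw [der_eSer, if_neg hc.symm]

theorem der_zero_hSer {c : ℕ} (hc : c ≠ 0) : der 0 (hSer c : List ℕ → K) = 0 := by
  rw [der_hSer, if_neg (fun h => hc (by simpa using h))]

theorem der_zero_pSer {c : ℕ} (hc : c ≠ 0) : der 0 (pSer c : List ℕ → K) = 0 := by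
  rw [der_pSer, if_neg (fun h => hc (by simpa using h))]

end

end MZV

/-! ### Evaluation of series -/

namespace MZV

noncomputable section

open Finset hiding antidiagonal mem_antidiagonal
open Finset.HasAntidiagonal

variable {K : Type*} [Field K] {R : Type*} [CommRing R] [Algebra K R]

/-- A linear extension of `Z` to all of `𝔥`. -/
def ext (Z : h0 K →ₗ[K] R) : H K →ₗ[K] R := Classical.choose (LinearMap.exists_extend Z)

theorem ext_of_mem (Z : h0 K →ₗ[K] R) {u : H K} (hu : u ∈ h0 K) : ext Z u = Z ⟨u, hu⟩ :=
  LinearMap.congr_fun (Classical.choose_spec (LinearMap.exists_extend Z)) ⟨u, hu⟩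

theorem zeta_eq_ext (Z : h0 K →ₗ[K] R) {ks : List ℕ} (h : Admissible ks) :
    zeta Z ks = ext Z (zProd K ks) := by
  rw [zeta, dif_pos h, ext_of_mem]

theorem zetaStar_eq_ext (Z : h0 K →ₗ[K] R) {ks : List ℕ} (h : Admissible ks) :
    zetaStar Z ks = ext Z (S K (zProd K ks)) := by
  rw [zetaStar, zeta, dif_pos h, ext_of_mem Z (S_mem_h0 K (zProd_mem_h0 K h))]
  rfl

theorem admissible_replicate (n : ℕ) {k : ℕ} (hk : 2 ≤ k) : Admissible (List.replicate n k) := by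
  refine ⟨fun j hj => ?_, fun j hj => ?_⟩
  · rw [List.eq_of_mem_replicate hj]; omega
  · rw [List.eq_of_mem_replicate (List.mem_of_mem_head? hj)]; exact hk

theorem admissible_singleton {k : ℕ} (hk : 2 ≤ k) : Admissible [k] := admissible_replicate 1 hk

theorem zeta_replicate (Z : h0 K →ₗ[K] R) (n : ℕ) {k : ℕ} (hk : 2 ≤ k) :
    zeta Z (List.replicate n k) = ext Z (z K k ^ n) := by
  rw [zeta_eq_ext Z (admissible_replicate n hk), zProd_replicate]

theorem zetaStar_replicate (Z : h0 K →ₗ[K] R) (n : ℕ) {k : ℕ} (hk : 2 ≤ k) :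
    zetaStar Z (List.replicate n k) = ext Z (S K (z K k ^ n)) := by
  rw [zetaStar_eq_ext Z (admissible_replicate n hk), zProd_replicate]

theorem zeta_singleton (Z : h0 K →ₗ[K] R) {k : ℕ} (hk : 2 ≤ k) : zeta Z [k] = ext Z (z K k) := by
  rw [zeta_eq_ext Z (admissible_singleton hk), zProd_cons, zProd_nil, mul_one]

variable {Z : h0 K →ₗ[K] R}

theorem DoubleShuffle.ext_one (hZ : DoubleShuffle Z) : ext Z 1 = 1 := by
  rw [ext_of_mem Z (one_mem_h0 K), hZ.map_one]

theorem DoubleShuffle.ext_stuffle (hZ : DoubleShuffle Z) {u v : H K} (hu : u ∈ h0 K)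
    (hv : v ∈ h0 K) : ext Z (stuffle K u v) = ext Z u * ext Z v := by
  rw [ext_of_mem Z (stuffle_mem_h0 K hu hv), ext_of_mem Z hu, ext_of_mem Z hv]
  exact hZ.map_stuffle ⟨u, hu⟩ ⟨v, hv⟩

theorem DoubleShuffle.ext_shuffle (hZ : DoubleShuffle Z) {u v : H K} (hu : u ∈ h0 K)
    (hv : v ∈ h0 K) : ext Z (shuffle K u v) = ext Z u * ext Z v := by
  rw [ext_of_mem Z (shuffle_mem_h0 K hu hv), ext_of_mem Z hu, ext_of_mem Z hv]
  exact hZ.map_shuffle ⟨u, hu⟩ ⟨v, hv⟩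

/-- Evaluation turns `st` into the Cauchy product of the sequences of values. -/
theorem DoubleShuffle.sum_ext_elt (hZ : DoubleShuffle Z) {f g : List ℕ → K} (hf : der 0 f = 0)
    (hg : der 0 g = 0) (N : ℕ) :
    ∑ q ∈ antidiagonal N, ext Z (elt f q.1) * ext Z (elt g q.2) = ext Z (elt (st f g) N) := by
  rw [← sum_stuffle_elt, map_sum]
  exact sum_congr rfl fun q _ => (hZ.ext_stuffle (elt_mem_h0 hf _) (elt_mem_h0 hg _)).symm

/-- A convolution whose first factor is supported on the multiples of `κ`. -/
theorem sum_antidiagonal_mul {A : Type*} [Semiring A] {κ : ℕ} (hκ : 0 < κ) {f : ℕ → A} (g : ℕ → A)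
    (hf : ∀ i, ¬ κ ∣ i → f i = 0) (n : ℕ) :
    ∑ q ∈ antidiagonal (κ * n), f q.1 * g q.2 =
      ∑ q ∈ antidiagonal n, f (κ * q.1) * g (κ * q.2) := by
  rw [← sum_filter_of_ne (p := fun q : ℕ × ℕ => κ ∣ q.1)
    (fun q _ hne => by_contra fun h => hne (by rw [hf _ h, zero_mul]))]
  symm
  refine sum_bij (fun q _ => (κ * q.1, κ * q.2)) ?_ ?_ ?_ ?_
  · intro q hq
    rw [mem_antidiagonal] at hq
    rw [mem_filter, mem_antidiagonal, ← hq]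
    exact ⟨by ring, dvd_mul_right _ _⟩
  · rintro ⟨a, b⟩ _ ⟨c, d⟩ _ h
    simp only [Prod.mk.injEq, mul_eq_mul_left_iff, hκ.ne', or_false] at h ⊢
    exact h
  · rintro ⟨a, b⟩ hq
    rw [mem_filter, mem_antidiagonal] at hq
    obtain ⟨h, a, rfl⟩ := hq
    have hb : κ ∣ b := (Nat.dvd_add_right (dvd_mul_right κ a)).1 (h ▸ dvd_mul_right κ n)
    obtain ⟨b, rfl⟩ := hb
    refine ⟨(a, b), mem_antidiagonal.2 (Nat.eq_of_mul_eq_mul_left hκ ?_), rfl⟩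
    simpa [mul_add] using h
  · intro q _; rfl

/-- The generating function of `ζ({κ}ⁿ)`. -/
def genE (Z : h0 K →ₗ[K] R) (κ : ℕ) : PowerSeries R :=
  PowerSeries.mk fun n => zeta Z (List.replicate n κ)

/-- The generating function of `ζ⋆({κ}ⁿ)`. -/
def genH (Z : h0 K →ₗ[K] R) (κ : ℕ) : PowerSeries R :=
  PowerSeries.mk fun n => zetaStar Z (List.replicate n κ)

/-- The generating function of `(-1)ⁿ⁻¹ ζ(κ n)`. -/
def genP (Z : h0 K →ₗ[K] R) (κ : ℕ) : PowerSeries R :=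
  PowerSeries.mk fun n => if n = 0 then 0 else (-1) ^ (n + 1) * zeta Z [κ * n]

theorem ext_elt_eSer (Z : h0 K →ₗ[K] R) {c : ℕ} (hc : c ≠ 0) (a : K) (n : ℕ) :
    ext Z (elt (eSer c a) ((c + 1) * n)) =
      algebraMap K R (a ^ n) * zeta Z (List.replicate n (c + 1)) := by
  rw [elt_eSer_mul, map_smul, zeta_replicate Z n (by omega), Algebra.smul_def]

theorem ext_elt_eSer_of_not_dvd (Z : h0 K →ₗ[K] R) (c : ℕ) (a : K) (i : ℕ) (h : ¬ c + 1 ∣ i) :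
    ext Z (elt (eSer c a) i) = 0 := by
  rw [elt_eSer_of_not_dvd a h, map_zero]

theorem ext_elt_hSer (Z : h0 K →ₗ[K] R) {c : ℕ} (hc : c ≠ 0) (n : ℕ) :
    ext Z (elt (hSer c) ((c + 1) * n)) = zetaStar Z (List.replicate n (c + 1)) := by
  rw [← S_elt_eSer, elt_eSer_mul, one_pow, one_smul, zetaStar_replicate Z n (by omega)]

/-- The value of `st_eSer_pSer` in weight (c + 1)n; `eSer` lives in weights divisible by c + 1, so
the convolution reduces to those. -/
theorem DoubleShuffle.genE_newton (hZ : DoubleShuffle Z) {c : ℕ} (hc : c ≠ 0) :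
    PowerSeries.X * PowerSeries.derivative R (genE Z (c + 1)) =
      genE Z (c + 1) * genP Z (c + 1) := by
  ext n
  have h := hZ.sum_ext_elt (der_zero_eSer hc 1) (der_zero_pSer hc) ((c + 1) * n)
  rw [sum_antidiagonal_mul (κ := c + 1) (by omega) (fun j => ext Z (elt (pSer c) j))
    (ext_elt_eSer_of_not_dvd Z c 1), st_eSer_pSer,
    elt_euler_eSer_mul, map_smul, ← zeta_replicate Z n (by omega), Algebra.smul_def,
    map_natCast] at h
  have hL : PowerSeries.coeff n (PowerSeries.X * PowerSeries.derivative R (genE Z (c + 1))) =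
      (n : R) * zeta Z (List.replicate n (c + 1)) := by
    cases n with
    | zero => simp
    | succ n =>
      rw [PowerSeries.coeff_succ_X_mul, PowerSeries.coeff_derivative, genE, PowerSeries.coeff_mk]
      push_cast; ring
  rw [hL, ← h, PowerSeries.coeff_mul]
  refine sum_congr rfl fun q _ => ?_
  rw [ext_elt_eSer Z hc, one_pow, _root_.map_one, one_mul, genE, genP, PowerSeries.coeff_mk,
    PowerSeries.coeff_mk]
  congr 1
  obtain ⟨i, j⟩ := q
  cases j with
  | zero => simp [elt_zero, pSer]
  | succ j =>
    rw [elt_pSer_mul, map_smul, if_neg (Nat.succ_ne_zero j), zeta_singleton Z (by nlinarith [Nat.pos_of_ne_zero hc]),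
      Algebra.smul_def]
    simp [pow_succ]

theorem DoubleShuffle.genE_mul_genH (hZ : DoubleShuffle Z) {c : ℕ} (hc : c ≠ 0) :
    PowerSeries.rescale (-1) (genE Z (c + 1)) * genH Z (c + 1) = 1 := by
  ext n
  have h := hZ.sum_ext_elt (der_zero_eSer hc (-1)) (der_zero_hSer hc) ((c + 1) * n)
  rw [sum_antidiagonal_mul (κ := c + 1) (by omega) (fun j => ext Z (elt (hSer c) j))
    (ext_elt_eSer_of_not_dvd Z c (-1)),
    st_eSer_hSer] at h
  rw [PowerSeries.coeff_mul, PowerSeries.coeff_one]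
  refine Eq.trans (sum_congr rfl fun q _ => ?_) (h.trans ?_)
  · rw [ext_elt_eSer Z hc, ext_elt_hSer Z hc, PowerSeries.coeff_rescale, genE, genH,
      PowerSeries.coeff_mk, PowerSeries.coeff_mk]
    simp
  · cases n with
    | zero => simp [elt_zero, one, hZ.ext_one]
    | succ n =>
      rw [show (c + 1) * (n + 1) = (c + 1) * n + c + 1 by ring, elt_one_succ, map_zero,
        if_neg (Nat.succ_ne_zero n)]

/-- Differentiate E(-t)H(t) = 1 and insert tE' = EP at -t. -/
theorem DoubleShuffle.genH_newton (hZ : DoubleShuffle Z) {c : ℕ} (hc : c ≠ 0) :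
    PowerSeries.X * PowerSeries.derivative R (genH Z (c + 1)) =
      genH Z (c + 1) * -PowerSeries.rescale (-1) (genP Z (c + 1)) := by
  have h1 := hZ.genE_mul_genH hc
  have h2 := congrArg (PowerSeries.rescale (-1 : R)) (hZ.genE_newton hc)
  have h3 := congrArg (PowerSeries.derivative R) h1
  have h4 : PowerSeries.rescale (-1 : R)
      (PowerSeries.X * PowerSeries.derivative R (genE Z (c + 1))) =
      PowerSeries.X * PowerSeries.derivative R (PowerSeries.rescale (-1) (genE Z (c + 1))) := by
    ext n
    cases n with
    | zero => simp
    | succ n =>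
      rw [PowerSeries.coeff_rescale, PowerSeries.coeff_succ_X_mul, PowerSeries.coeff_succ_X_mul,
        PowerSeries.coeff_derivative, PowerSeries.coeff_derivative, PowerSeries.coeff_rescale]
      ring
  rw [h4, map_mul] at h2
  rw [Derivation.leibniz, smul_eq_mul, smul_eq_mul, Derivation.map_one_eq_zero] at h3
  linear_combination (-(PowerSeries.X * PowerSeries.derivative R (genH Z (c + 1))) -
    genH Z (c + 1) * PowerSeries.rescale (-1) (genP Z (c + 1))) * h1 +
    PowerSeries.X * genH Z (c + 1) * h3 - genH Z (c + 1) ^ 2 * h2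

end

end MZV

/-! ### Even zeta values -/

namespace MZV

noncomputable section

open Finset hiding antidiagonal mem_antidiagonal
open Finset.HasAntidiagonal

variable {K : Type*} [Field K] {R : Type*} [CommRing R] [Algebra K R]

/-- Inserting y before the final y of x^N y cuts the word into two letters z; inserting it at the
end gives the last term. -/
theorem shuffle_Y_z (N : ℕ) : shuffle K (Y K) (z K (N + 1)) =
    ∑ q ∈ antidiagonal N, z K (q.1 + 1) * z K (q.2 + 1) + z K (N + 1) * Y K := by
  induction N with
  | zero => simp [z_one, shuffle_Y_Y_self, two_smul]
  | succ N ih =>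
    have h : z K (N + 1 + 1) = X K * z K (N + 1) := by rw [z_succ, z_succ, pow_succ', mul_assoc]
    rw [h, shuffle_Y_X_mul, ih, Finset.Nat.sum_antidiagonal_succ, mul_add, mul_sum, ← h]
    have h' : ∀ q : ℕ × ℕ, X K * (z K (q.1 + 1) * z K (q.2 + 1)) =
        z K (q.1 + 1 + 1) * z K (q.2 + 1) := fun q => by
      rw [← mul_assoc, z_succ q.1, ← mul_assoc, ← pow_succ', ← z_succ]
    simp only [h', zero_add, z_one]
    rw [h, mul_assoc, ← add_assoc, add_assoc]

theorem stuffle_z_z (k l : ℕ) : stuffle K (z K (k + 1)) (z K (l + 1)) =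
    z K (k + 1) * z K (l + 1) + z K (l + 1) * z K (k + 1) + z K (k + l + 1 + 1) := by
  have h := stuffle_mul_mul k l (1 : H K) 1
  have h1 := stuffle_one_mul l (1 : H K)
  have h2 := stuffle_mul_one k (1 : H K)
  rw [stuffle_one_one] at h h1 h2
  simp only [mul_one] at h h1 h2
  rw [h, h1, h2]

theorem isShuffleReg_self (v : h0 K) : IsShuffleReg (v : H K) v :=
  ⟨0, fun _ => v, rfl, by simp [shufflePowY, shuffle_one_right]⟩

theorem z_mem_h0 {k : ℕ} (hk : 2 ≤ k) : z K k ∈ h0 K := by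
  simpa [zProd] using zProd_mem_h0_of_two_le K hk []

theorem Y_mem_h1 : Y K ∈ h1 K :=
  Submodule.mem_sup_right (by simpa using mul_Y_mem K (1 : H K))

theorem z_mul_z_mem_h0 {k : ℕ} (hk : 2 ≤ k) (l : ℕ) : z K k * z K l ∈ h0 K := by
  simpa [zProd] using zProd_mem_h0_of_two_le K hk [l]

variable {Z : h0 K →ₗ[K] R}

/-- The sum formula in depth two. -/
theorem RegularizedDoubleShuffle.sum_depth_two (hZ : RegularizedDoubleShuffle Z) (N : ℕ) :
    ∑ q ∈ antidiagonal N, ext Z (z K (q.1 + 2) * z K (q.2 + 1)) = ext Z (z K (N + 3)) := by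
  -- The inadmissible word y z_{N+2} occurs in both products and cancels. The difference lies in 𝔥⁰
  -- and is its own regularization.
  have h : shuffle K (Y K) (z K (N + 2)) - stuffle K (Y K) (z K (N + 2)) =
      ∑ q ∈ antidiagonal N, z K (q.1 + 2) * z K (q.2 + 1) - z K (N + 3) := by
    have h' := stuffle_z_z (K := K) 0 (N + 1)
    rw [zero_add, z_one, zero_add] at h'
    rw [shuffle_Y_z, h', Finset.Nat.sum_antidiagonal_succ]
    simp only [zero_add, z_one]
    abel
  have hmem : ∑ q ∈ antidiagonal N, z K (q.1 + 2) * z K (q.2 + 1) - z K (N + 3) ∈ h0 K :=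
    sub_mem (Submodule.sum_mem _ fun q _ => z_mul_z_mem_h0 (by omega) _) (z_mem_h0 (by omega))
  have h0 := hZ.map_reg (Y K) Y_mem_h1 (z K (N + 2)) (z_mem_h0 (by omega)) ⟨_, hmem⟩
    (by rw [h]; exact isShuffleReg_self ⟨_, hmem⟩)
  rw [← ext_of_mem Z hmem, map_sub, map_sum] at h0
  exact sub_eq_zero.1 h0

/-- Removing the leading x from either factor writes each product as x times a sum of two
neighbouring shuffle products. The alternating sum telescopes to the two end terms, where z_1 = y.
-/
theorem sum_neg_one_pow_shuffle (L : ℕ) :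
    ∑ q ∈ antidiagonal L, (-1 : H K) ^ q.1 * shuffle K (z K (q.1 + 2)) (z K (q.2 + 2)) =
      X K * (shuffle K (Y K) (z K (L + 2)) + (-1) ^ L * shuffle K (z K (L + 2)) (Y K)) := by
  have hz : ∀ k, z K (k + 2) = X K * z K (k + 1) := fun k => by
    rw [z_succ, z_succ, pow_succ', mul_assoc]
  let P : ℕ → ℕ → H K := fun a b => shuffle K (z K (a + 1)) (z K (b + 1))
  have h1 : ∀ q : ℕ × ℕ, (-1 : H K) ^ q.1 * shuffle K (z K (q.1 + 2)) (z K (q.2 + 2)) =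
      X K * ((-1 : H K) ^ q.1 * P q.1 (q.2 + 1) - (-1 : H K) ^ (q.1 + 1) * P (q.1 + 1) q.2) := by
    intro q
    have hc : (-1 : H K) ^ q.1 * X K = X K * (-1 : H K) ^ q.1 :=
      ((Commute.neg_one_left (X K)).pow_left q.1).eq
    rw [hz q.1, hz q.2, shuffle_X_X, ← hz q.1, ← hz q.2, ← mul_add, ← mul_assoc, hc, mul_assoc,
      mul_add, pow_succ]
    congr 1
    simp only [P]
    noncomm_ring
  have h2 := Finset.Nat.sum_antidiagonal_succ (n := L)
    (f := fun q => (-1 : H K) ^ q.1 * P q.1 q.2)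
  rw [Finset.Nat.sum_antidiagonal_succ'] at h2
  simp only [h1, ← mul_sum, sum_sub_distrib]
  congr 1
  simp only [P, zero_add, z_one, pow_zero, one_mul] at h2 ⊢
  have h3 := eq_sub_of_add_eq h2.symm
  rw [sub_eq_iff_eq_add, h3, pow_succ]
  simp only [mul_neg, mul_one, neg_mul]
  abel

/-- Add the plain and the alternating sum of ζ(a)ζ(b) over a + b = 2l + 4 with a, b ≥ 2: twice the
even terms remain. Stuffle evaluates the plain sum, shuffle the alternating one, and the depth two
parts are eliminated by the sum formula. -/
theorem RegularizedDoubleShuffle.even_depth_two (hZ : RegularizedDoubleShuffle Z) (l : ℕ) :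
    2 * ∑ q ∈ antidiagonal l, ext Z (z K (2 * q.1 + 2)) * ext Z (z K (2 * q.2 + 2)) =
      (2 * l + 5) * ext Z (z K (2 * l + 4)) := by
  have hds := hZ.toDoubleShuffle
  have hstuffle : ∀ q ∈ antidiagonal (2 * l), ext Z (z K (q.1 + 2)) * ext Z (z K (q.2 + 2)) =
      ext Z (z K (q.1 + 2) * z K (q.2 + 2)) + ext Z (z K (q.2 + 2) * z K (q.1 + 2)) +
        ext Z (z K (2 * l + 4)) := by
    intro q hq
    rw [← hds.ext_stuffle (z_mem_h0 (by omega)) (z_mem_h0 (by omega)), stuffle_z_z, map_add,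
      map_add, show q.1 + 1 + (q.2 + 1) + 1 + 1 = 2 * l + 4 by
        have := mem_antidiagonal.1 hq; omega]
  have hpar : ∀ q ∈ antidiagonal (2 * l), (-1 : R) ^ q.2 = (-1 : R) ^ q.1 := by
    intro q hq
    have := mem_antidiagonal.1 hq
    exact neg_one_pow_congr (by simp only [Nat.even_iff]; omega)
  have hone : ∑ q ∈ antidiagonal (2 * l), (-1 : R) ^ q.1 = 1 := by
    rw [Finset.Nat.sum_antidiagonal_eq_sum_range_succ (fun a _ => (-1 : R) ^ a), neg_one_geom_sum,
      if_neg (by simp)]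
  set ζ := ext Z (z K (2 * l + 4))
  set T := ∑ q ∈ antidiagonal (2 * l), ext Z (z K (q.1 + 2) * z K (q.2 + 2)) with hT
  set A := ∑ q ∈ antidiagonal (2 * l), (-1 : R) ^ q.1 * ext Z (z K (q.1 + 2) * z K (q.2 + 2))
    with hA
  have hT' : ∑ q ∈ antidiagonal (2 * l), ext Z (z K (q.2 + 2) * z K (q.1 + 2)) = T :=
    Finset.Nat.sum_antidiagonal_swap (f := fun q => ext Z (z K (q.1 + 2) * z K (q.2 + 2)))
  have hA' : ∑ q ∈ antidiagonal (2 * l), (-1 : R) ^ q.1 * ext Z (z K (q.2 + 2) * z K (q.1 + 2)) =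
      A := by
    rw [hA, ← Finset.Nat.sum_antidiagonal_swap]
    exact sum_congr rfl fun q hq => by rw [← hpar q hq]; rfl
  have h1 : ∑ q ∈ antidiagonal (2 * l), ext Z (z K (q.1 + 2)) * ext Z (z K (q.2 + 2)) =
      2 * T + (2 * l + 1) * ζ := by
    rw [sum_congr rfl hstuffle, sum_add_distrib, sum_add_distrib, hT', sum_const,
      Finset.Nat.card_antidiagonal, nsmul_eq_mul]
    push_cast; ring
  have h2 : ∑ q ∈ antidiagonal (2 * l),
      (-1 : R) ^ q.1 * (ext Z (z K (q.1 + 2)) * ext Z (z K (q.2 + 2))) = 2 * A + ζ := by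
    rw [sum_congr rfl fun q hq => by rw [hstuffle q hq]]
    simp only [mul_add, sum_add_distrib, hA', ← sum_mul, hone]
    ring
  -- The alternating sum once by stuffle and once by shuffle. The shuffle side is twice a full depth
  -- two sum, plus twice the extra word z_{2l+3} y coming from `shuffle_Y_z`.
  have h3 : 2 * A + ζ = 2 * ζ + 2 * ext Z (z K (2 * l + 3) * Y K) := by
    have hX : X K * (shuffle K (Y K) (z K (2 * l + 2)) +
        (-1) ^ (2 * l) * shuffle K (z K (2 * l + 2)) (Y K)) = (2 : K) •
        (∑ q ∈ antidiagonal (2 * l + 1), z K (q.1 + 2) * z K (q.2 + 1) +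
          z K (2 * l + 3) * Y K) := by
      have hz : ∀ k, X K * z K (k + 1) = z K (k + 2) := fun k => by
        rw [z_succ, z_succ, pow_succ', mul_assoc]
      have hcomm : shuffle K (z K (2 * l + 2)) (Y K) = shuffle K (Y K) (z K (2 * l + 2)) := by
        have : ∀ N, shuffle K (z K (N + 1)) (Y K) = shuffle K (Y K) (z K (N + 1)) := by
          intro N
          induction N with
          | zero => rw [zero_add, z_one]
          | succ N ih =>
            rw [← hz, shuffle_X_mul_Y, shuffle_Y_X_mul, ih, add_comm]
        exact this _
      rw [hcomm, pow_mul, neg_one_sq, one_pow, one_mul, ← two_smul K, mul_smul_comm,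
        shuffle_Y_z (2 * l + 1), mul_add, mul_sum]
      simp only [← mul_assoc, hz]
    have hX' := congrArg (ext Z) ((sum_neg_one_pow_shuffle (K := K) (2 * l)).trans hX)
    rw [map_sum, map_smul, map_add, map_sum, hZ.sum_depth_two, Algebra.smul_def, map_ofNat] at hX'
    rw [← h2, ← mul_add, ← hX']
    refine sum_congr rfl fun q _ => ?_
    rw [← hds.ext_shuffle (z_mem_h0 (by omega)) (z_mem_h0 (by omega))]
    -- The sign is a factor in 𝔥 on one side and in R on the other; splitting by parity reduces this
    -- to linearity.
    rcases neg_one_pow_eq_or (H K) q.1 with h | h <;> rcases Nat.even_or_odd q.1 with h' | h' <;>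
      simp [h'.neg_one_pow]
  have h4 : T + ext Z (z K (2 * l + 3) * Y K) = ζ := by
    have h := hZ.sum_depth_two (2 * l + 1)
    rw [Finset.Nat.sum_antidiagonal_succ'] at h
    simp only [zero_add, z_one] at h
    rw [add_comm] at h
    exact h
  have h5 : ∑ q ∈ antidiagonal (2 * l), (1 + (-1 : R) ^ q.1) * ext Z (z K (q.1 + 2)) *
      ext Z (z K (q.2 + 2)) = 2 * ∑ q ∈ antidiagonal l,
        ext Z (z K (2 * q.1 + 2)) * ext Z (z K (2 * q.2 + 2)) := by
    rw [sum_antidiagonal_mul two_pos (f := fun i => (1 + (-1 : R) ^ i) * ext Z (z K (i + 2)))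
      (fun j => ext Z (z K (j + 2))), mul_sum]
    · refine sum_congr rfl fun q _ => ?_
      rw [pow_mul, neg_one_sq, one_pow]; ring
    · intro i hi
      rw [(Nat.odd_iff.2 (by omega) : Odd i).neg_one_pow]; ring
  rw [← h5]
  simp only [add_mul, one_mul, sum_add_distrib, mul_assoc, h1, h2]
  linear_combination h3 + 2 * h4

end

end MZV

/-! ### Identities for Bernoulli numbers -/

namespace MZV

noncomputable section

open Finset hiding antidiagonal mem_antidiagonal
open Finset.HasAntidiagonal
open PowerSeries (derivative rescale coeff)

/-- The value `-B_{2n} / (2 (2n)!)` of `ζ(2n) / λ^{2n}`. -/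
def evenValue (n : ℕ) : ℚ := -(bernoulli (2 * n)) / (2 * (2 * n).factorial)

/-- The value of `(-1)ⁿ ζ({2}ⁿ) / λ^{2n}`. -/
def sinhCoeff (n : ℕ) : ℚ := 1 / (4 ^ n * (2 * n + 1).factorial)

theorem coeff_bernoulliPowerSeries (n : ℕ) :
    coeff n (bernoulliPowerSeries ℚ) = bernoulli n / n.factorial := by
  simp [bernoulliPowerSeries]

theorem derivative_rescale_exp (a : ℚ) :
    derivative ℚ (rescale a (PowerSeries.exp ℚ)) =
      PowerSeries.C a * rescale a (PowerSeries.exp ℚ) := by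
  ext n
  rw [PowerSeries.coeff_derivative, PowerSeries.coeff_rescale, PowerSeries.coeff_C_mul,
    PowerSeries.coeff_rescale, PowerSeries.coeff_exp, PowerSeries.coeff_exp, Nat.factorial_succ]
  simp only [Algebra.algebraMap_self, RingHom.id_apply]
  push_cast
  field_simp
  ring

/-- The power series of `(t / 2) coth (t / 2)`. -/
def cothSeries : PowerSeries ℚ := bernoulliPowerSeries ℚ + PowerSeries.C (1 / 2) * PowerSeries.X

/-- The power series of `sinh (t / 2) / (t / 2)`. -/
def sinhSeries : PowerSeries ℚ :=
  PowerSeries.mk fun n => if Even n then sinhCoeff (n / 2) else 0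

theorem coeff_cothSeries_even (n : ℕ) :
    coeff (2 * n) cothSeries = bernoulli (2 * n) / (2 * n).factorial := by
  rw [cothSeries, map_add, coeff_bernoulliPowerSeries, PowerSeries.coeff_C_mul,
    PowerSeries.coeff_X, if_neg (by omega)]
  ring

theorem coeff_cothSeries_odd {i : ℕ} (h : ¬ 2 ∣ i) : coeff i cothSeries = 0 := by
  rw [cothSeries, map_add, coeff_bernoulliPowerSeries, PowerSeries.coeff_C_mul,
    PowerSeries.coeff_X]
  split_ifs with h1
  · subst h1; norm_num
  · rw [bernoulli_eq_zero_of_odd (Nat.odd_iff.2 (by omega)) (by omega)]; simp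

theorem coeff_sinhSeries_even (n : ℕ) : coeff (2 * n) sinhSeries = sinhCoeff n := by
  simp [sinhSeries]

theorem coeff_sinhSeries_odd {i : ℕ} (h : ¬ 2 ∣ i) : coeff i sinhSeries = 0 := by
  rw [sinhSeries, PowerSeries.coeff_mk, if_neg (by rwa [even_iff_two_dvd])]

/-- Differentiate b(eᵗ - 1) = t and eliminate eᵗ. -/
theorem bernoulliPowerSeries_riccati :
    PowerSeries.X * derivative ℚ (bernoulliPowerSeries ℚ) + bernoulliPowerSeries ℚ ^ 2 +
      PowerSeries.X * bernoulliPowerSeries ℚ = bernoulliPowerSeries ℚ := by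
  have h := bernoulliPowerSeries_mul_exp_sub_one ℚ
  have h' := congrArg (derivative ℚ) h
  have he : derivative ℚ (PowerSeries.exp ℚ) = PowerSeries.exp ℚ := by
    simpa using derivative_rescale_exp 1
  rw [Derivation.leibniz, smul_eq_mul, smul_eq_mul, map_sub, he, Derivation.map_one_eq_zero,
    sub_zero, PowerSeries.derivative_X] at h'
  linear_combination bernoulliPowerSeries ℚ * h' -
    (derivative ℚ (bernoulliPowerSeries ℚ) + bernoulliPowerSeries ℚ) * h

/-- Adding t/2 to t/(eᵗ - 1) makes the series even and removes the term linear in it. -/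
theorem cothSeries_riccati :
    PowerSeries.X * derivative ℚ cothSeries + cothSeries ^ 2 - cothSeries =
      PowerSeries.C (1 / 4) * PowerSeries.X ^ 2 := by
  have h := bernoulliPowerSeries_riccati
  have h2 : (PowerSeries.C (1 / 2 : ℚ)) * 2 = 1 := by
    rw [← map_ofNat (PowerSeries.C (R := ℚ)) 2, ← map_mul]; norm_num
  have h4 : (PowerSeries.C (1 / 4 : ℚ)) = PowerSeries.C (1 / 2) * PowerSeries.C (1 / 2) := by
    rw [← map_mul]; norm_num
  rw [cothSeries, map_add, Derivation.leibniz, PowerSeries.derivative_X, PowerSeries.derivative_C,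
    smul_zero, add_zero, smul_eq_mul, mul_one, h4]
  linear_combination h + PowerSeries.X * bernoulliPowerSeries ℚ * h2

/-- The coefficient of t^{2l+4} in the Riccati equation. The two end terms of the square, with
constant coefficient 1, are moved to the other side and account for the 5. -/
theorem two_mul_sum_evenValue (l : ℕ) :
    2 * ∑ q ∈ antidiagonal l, evenValue (q.1 + 1) * evenValue (q.2 + 1) =
      (2 * l + 5) * evenValue (l + 2) := by
  have h := congrArg (coeff (2 * (l + 2))) cothSeries_riccati
  have hd : coeff (2 * (l + 2)) (PowerSeries.X * derivative ℚ cothSeries) =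
      (2 * l + 4) * coeff (2 * (l + 2)) cothSeries := by
    rw [show 2 * (l + 2) = 2 * l + 3 + 1 by ring, PowerSeries.coeff_succ_X_mul,
      PowerSeries.coeff_derivative]
    push_cast; ring
  have hc : ∀ n, coeff (2 * n) cothSeries = -2 * evenValue n := fun n => by
    rw [coeff_cothSeries_even, evenValue]; field_simp
  rw [map_sub, map_add, hd, pow_two, PowerSeries.coeff_mul,
    sum_antidiagonal_mul two_pos (f := fun i => coeff i cothSeries)
      (fun j => coeff j cothSeries) (fun i hi => coeff_cothSeries_odd hi),
    PowerSeries.coeff_C_mul, PowerSeries.coeff_X_pow, if_neg (by omega),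
    Finset.Nat.sum_antidiagonal_succ, Finset.Nat.sum_antidiagonal_succ'] at h
  have h0 : coeff 0 cothSeries = 1 := by
    have := coeff_cothSeries_even 0
    simpa using this
  simp only [hc, mul_zero, h0] at h
  have hs : ∑ q ∈ antidiagonal l, -2 * evenValue (q.1 + 1) * (-2 * evenValue (q.2 + 1)) =
      4 * ∑ q ∈ antidiagonal l, evenValue (q.1 + 1) * evenValue (q.2 + 1) := by
    rw [mul_sum]; exact sum_congr rfl fun q _ => by ring
  rw [hs] at h
  linear_combination (1 / 2) * h

/-- The power series of `exp (t / 2)`. -/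
def halfExp : PowerSeries ℚ := rescale (1 / 2 : ℚ) (PowerSeries.exp ℚ)

/-- The power series of `exp (-t / 2)`. -/
def halfExpInv : PowerSeries ℚ := rescale (-1 / 2 : ℚ) (PowerSeries.exp ℚ)

theorem halfExp_sq : halfExp * halfExp = PowerSeries.exp ℚ := by
  rw [halfExp, PowerSeries.exp_mul_exp_eq_exp_add]; norm_num

theorem halfExp_mul_inv : halfExp * halfExpInv = 1 := by
  rw [halfExp, halfExpInv, PowerSeries.exp_mul_exp_eq_exp_add]
  norm_num

theorem X_mul_sinhSeries : PowerSeries.X * sinhSeries = halfExp - halfExpInv := by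
  ext n
  rw [map_sub, halfExp, halfExpInv, PowerSeries.coeff_rescale, PowerSeries.coeff_rescale]
  cases n with
  | zero => simp
  | succ n =>
    rw [PowerSeries.coeff_succ_X_mul, PowerSeries.coeff_exp]
    simp only [Algebra.algebraMap_self, RingHom.id_apply]
    obtain ⟨m, rfl | rfl⟩ := Nat.even_or_odd' n
    · rw [coeff_sinhSeries_even, sinhCoeff, (by ring : (-1 / 2 : ℚ) = -(1 / 2)),
        Odd.neg_pow ⟨m, rfl⟩, pow_succ, pow_mul]
      norm_num
      rw [one_div_pow]
      ring
    · rw [coeff_sinhSeries_odd (by omega), (by ring : (-1 / 2 : ℚ) = -(1 / 2)),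
        Even.neg_pow ⟨m + 1, by ring⟩]
      ring

theorem bernoulli_mul_sinhSeries : bernoulliPowerSeries ℚ * sinhSeries = halfExpInv := by
  have h := bernoulliPowerSeries_mul_exp_sub_one ℚ
  have h1 := X_mul_sinhSeries
  have h2 := halfExp_mul_inv
  have h3 := halfExp_sq
  refine mul_left_cancel₀ (PowerSeries.X_ne_zero (R := ℚ)) ?_
  linear_combination bernoulliPowerSeries ℚ * h1 + halfExpInv * h + bernoulliPowerSeries ℚ *
    halfExpInv * h3 - bernoulliPowerSeries ℚ * halfExp * h2

/-- The logarithmic derivative of sinh(t/2)/(t/2), times t, is (t/2) coth(t/2) - 1. -/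
theorem X_mul_derivative_sinhSeries :
    PowerSeries.X * derivative ℚ sinhSeries = sinhSeries * (cothSeries - 1) := by
  have h := congrArg (derivative ℚ) X_mul_sinhSeries
  rw [Derivation.leibniz, smul_eq_mul, smul_eq_mul, PowerSeries.derivative_X, map_sub, halfExp,
    halfExpInv, derivative_rescale_exp, derivative_rescale_exp, ← halfExp, ← halfExpInv,
    show (-1 / 2 : ℚ) = -(1 / 2) by ring, map_neg] at h
  have h2 : (PowerSeries.C (1 / 2 : ℚ)) * 2 = 1 := by
    rw [← map_ofNat (PowerSeries.C (R := ℚ)) 2, ← map_mul]; norm_num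
  rw [cothSeries]
  linear_combination h - bernoulli_mul_sinhSeries - PowerSeries.C (1 / 2) * X_mul_sinhSeries +
    halfExpInv * h2

theorem sinhCoeff_newton (n : ℕ) : (2 * n) * sinhCoeff n =
    ∑ q ∈ antidiagonal n, sinhCoeff q.1 * (if q.2 = 0 then 0 else -2 * evenValue q.2) := by
  have h := congrArg (coeff (2 * n)) X_mul_derivative_sinhSeries
  rw [PowerSeries.coeff_mul (n := 2 * n) (φ := sinhSeries),
    sum_antidiagonal_mul two_pos (f := fun i => coeff i sinhSeries)
      (fun j => coeff j (cothSeries - 1)) (fun i hi => coeff_sinhSeries_odd hi)] at h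
  have hL : coeff (2 * n) (PowerSeries.X * derivative ℚ sinhSeries) = (2 * n) * sinhCoeff n := by
    cases n with
    | zero => simp
    | succ n =>
      rw [← coeff_sinhSeries_even, show 2 * (n + 1) = 2 * n + 1 + 1 by ring,
        PowerSeries.coeff_succ_X_mul, PowerSeries.coeff_derivative]
      push_cast; ring
  rw [← hL, h]
  refine sum_congr rfl fun q _ => ?_
  rw [coeff_sinhSeries_even, map_sub, coeff_cothSeries_even, PowerSeries.coeff_one, evenValue]
  congr 1
  split_ifs with h1 h2 h2
  · simp [h2]
  · omega
  · omega
  · field_simp; ring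

/-- The inverse of sinh(t/2)/(t/2) is 2b(t/2) - b(t) with b(t) = t/(eᵗ - 1), and its coefficient at
t^{2n} is β_n. -/
theorem sum_sinhCoeff_mul_beta (n : ℕ) :
    ∑ q ∈ antidiagonal n, sinhCoeff q.1 * beta q.2 = if n = 0 then 1 else 0 := by
  let G : PowerSeries ℚ :=
    2 * rescale (1 / 2 : ℚ) (bernoulliPowerSeries ℚ) - bernoulliPowerSeries ℚ
  have hB := bernoulliPowerSeries_mul_exp_sub_one ℚ
  have hB2 : rescale (1 / 2 : ℚ) (bernoulliPowerSeries ℚ) * (halfExp - 1) =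
      PowerSeries.C (1 / 2) * PowerSeries.X := by
    have := congrArg (rescale (1 / 2 : ℚ)) hB
    rwa [map_mul, map_sub, map_one, PowerSeries.rescale_X] at this
  have h2 : (PowerSeries.C (1 / 2 : ℚ)) * 2 = 1 := by
    rw [← map_ofNat (PowerSeries.C (R := ℚ)) 2, ← map_mul]; norm_num
  have hu : halfExp ≠ 0 := left_ne_zero_of_mul (halfExp_mul_inv ▸ one_ne_zero)
  have hG : sinhSeries * G = 1 := by
    refine mul_left_cancel₀ (mul_ne_zero (PowerSeries.X_ne_zero (R := ℚ)) hu) ?_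
    simp only [G]
    have hXF := X_mul_sinhSeries
    have hui := halfExp_mul_inv
    have huu := halfExp_sq
    set b := bernoulliPowerSeries ℚ
    set b2 := rescale (1 / 2 : ℚ) b
    linear_combination halfExp * (2 * b2 - b) * hXF - (2 * b2 - b) * hui +
      2 * (halfExp + 1) * hB2 - hB - b * huu + (halfExp + 1) * PowerSeries.X * h2
  have h := congrArg (coeff (2 * n)) hG
  rw [PowerSeries.coeff_mul, sum_antidiagonal_mul two_pos (f := fun i => coeff i sinhSeries)
      (fun j => coeff j G) (fun i hi => coeff_sinhSeries_odd hi), PowerSeries.coeff_one] at h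
  simp only [mul_eq_zero, OfNat.ofNat_ne_zero, false_or] at h
  rw [← h]
  refine sum_congr rfl fun q _ => ?_
  rw [coeff_sinhSeries_even]
  congr 1
  simp only [G]
  rw [map_sub, ← map_ofNat (PowerSeries.C (R := ℚ)) 2, PowerSeries.coeff_C_mul,
    PowerSeries.coeff_rescale, coeff_bernoulliPowerSeries, beta, zpow_sub₀ two_ne_zero, zpow_one,
    show (2 * (q.2 : ℤ)) = ((2 * q.2 : ℕ) : ℤ) by push_cast; ring, zpow_natCast, one_div_pow]
  ring

end

end MZV

/-! ### The values of the zeta functions in `R` -/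

namespace MZV

noncomputable section

open Finset hiding antidiagonal mem_antidiagonal
open Finset.HasAntidiagonal
open PowerSeries (derivative rescale coeff)

/-- The solution `c` of `c 0 = 1`, `n c n = ∑ c (n - m) p m`. -/
def newtonSeq (p : ℕ → ℚ) : ℕ → ℚ
  | 0 => 1
  | n + 1 => (∑ k : Fin (n + 1), newtonSeq p k * p (n + 1 - k)) / (n + 1)

theorem newtonSeq_zero (p : ℕ → ℚ) : newtonSeq p 0 = 1 := by rw [newtonSeq]

theorem newtonSeq_spec {p : ℕ → ℚ} (hp : p 0 = 0) (n : ℕ) :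
    n * newtonSeq p n = ∑ q ∈ antidiagonal n, newtonSeq p q.1 * p q.2 := by
  cases n with
  | zero => simp [hp]
  | succ n =>
    rw [newtonSeq, Finset.Nat.sum_antidiagonal_eq_sum_range_succ (fun a b => newtonSeq p a * p b),
      sum_range_succ, Nat.sub_self, hp, mul_zero, add_zero,
      ← Fin.sum_univ_eq_sum_range (fun k => newtonSeq p k * p (n + 1 - k))]
    push_cast
    field_simp

/-- The recursion of `newtonSeq` for the values of the even zeta values. -/
theorem newtonSeq_evenValue (s : ℕ → ℚ) {k n : ℕ} (hn : 1 ≤ n) {p : ℕ → ℚ}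
    (hp : ∀ m, p m = if m = 0 then 0 else -s m * evenValue (k * m)) :
    newtonSeq p n * (2 * n * k).factorial = 1 / (2 * (n : ℚ)) * ∑ m ∈ Icc 1 n,
      s m * ((2 * n * k).choose (2 * m * k) : ℚ) * bernoulli (2 * m * k) *
        (newtonSeq p (n - m) * (2 * (n - m) * k).factorial) := by
  have hn0 : (n : ℚ) ≠ 0 := by positivity
  have h := newtonSeq_spec (p := p) (by simp [hp]) n
  rw [← Finset.Nat.sum_antidiagonal_swap,
    Finset.Nat.sum_antidiagonal_eq_sum_range_succ_mk] at h
  have hsub : Icc 1 n ⊆ range n.succ := fun m hm => by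
    rw [mem_Icc] at hm; rw [mem_range]; omega
  rw [← sum_subset hsub (fun m hm hm' => by
    have : m = 0 := by rw [mem_Icc] at hm'; rw [mem_range] at hm; omega
    simp [hp, this])] at h
  have h' : newtonSeq p n = 1 / n * ∑ m ∈ Icc 1 n, newtonSeq p (n - m) * p m := by
    rw [eq_comm, one_div, inv_mul_eq_iff_eq_mul₀ hn0, h]; rfl
  rw [h', mul_sum, mul_sum, sum_mul]
  refine sum_congr rfl fun m hm => ?_
  rw [mem_Icc] at hm
  have hle : 2 * m * k ≤ 2 * n * k := by gcongr; exact hm.2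
  have hfac := Nat.choose_mul_factorial_mul_factorial hle
  rw [show 2 * n * k - 2 * m * k = 2 * (n - m) * k by
    rw [← Nat.sub_mul, ← Nat.mul_sub]] at hfac
  have hfac' : ((2 * n * k).factorial : ℚ) = ((2 * n * k).choose (2 * m * k) : ℚ) *
      (2 * m * k).factorial * (2 * (n - m) * k).factorial := by exact_mod_cast hfac.symm
  have h0 : ((2 * m * k).factorial : ℚ) ≠ 0 := by positivity
  rw [hp, if_neg (by omega), evenValue, hfac', show 2 * (k * m) = 2 * m * k by ring]
  field_simp

/-- The value of the sum over the indices `insertTwos n c` divided by `λ^{2m}`. -/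
def altValue (m n : ℕ) : ℚ :=
  (-1) ^ m * (2 / (4 ^ m * (2 * m + 2).factorial)) * (m + 1).choose (2 * n + 1)

theorem sum_range_two_mul {A : Type*} [AddCommMonoid A] (M : ℕ) (f : ℕ → A) :
    ∑ k ∈ range (2 * M), f k = ∑ j ∈ range M, (f (2 * j) + f (2 * j + 1)) := by
  induction M with
  | zero => simp
  | succ M ih =>
    rw [show 2 * (M + 1) = 2 * M + 1 + 1 by ring, sum_range_succ, sum_range_succ, ih,
      sum_range_succ, add_assoc]

/-- Compare the coefficients of X^{2p+1} in (1 + X)^{2N} = (2X + (1 + X²))^N for N = p + q + 1. Only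
odd powers of 2X contribute. -/
theorem choose_eq_sum_midChoose (p q : ℕ) : (2 * (p + q) + 2).choose (2 * p + 1) =
    2 * ∑ n ∈ range (p + q + 1), 4 ^ n * midChoose p q n * (p + q + 1).choose (2 * n + 1) := by
  have h : ((1 : Polynomial ℕ) + Polynomial.X) ^ (2 * (p + q) + 2) =
      (2 * Polynomial.X + (1 + Polynomial.X ^ 2)) ^ (p + q + 1) := by
    rw [show 2 * (p + q) + 2 = 2 * (p + q + 1) by ring, pow_mul]
    congr 1; ring
  have h' := congrArg (fun P => Polynomial.coeff P (2 * p + 1)) h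
  simp only [Polynomial.coeff_one_add_X_pow, Nat.cast_id] at h'
  rw [h', add_pow, Polynomial.finsetSum_coeff]
  have hterm : ∀ k, Polynomial.coeff ((2 * Polynomial.X) ^ k *
      (1 + Polynomial.X ^ 2) ^ (p + q + 1 - k) * ((p + q + 1).choose k : Polynomial ℕ))
      (2 * p + 1) = if k ≤ 2 * p + 1 ∧ 2 ∣ 2 * p + 1 - k then
        2 ^ k * (p + q + 1 - k).choose ((2 * p + 1 - k) / 2) * (p + q + 1).choose k else 0 := by
    intro k
    have hexp : (1 + Polynomial.X ^ 2 : Polynomial ℕ) ^ (p + q + 1 - k) =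
        Polynomial.expand ℕ 2 ((1 + Polynomial.X) ^ (p + q + 1 - k)) := by simp
    rw [hexp, mul_pow, mul_assoc, mul_assoc, ← Polynomial.C_ofNat, ← Polynomial.C_pow,
      Polynomial.coeff_C_mul, Polynomial.coeff_X_pow_mul', ← Polynomial.C_eq_natCast]
    rw [Polynomial.coeff_mul_C, Polynomial.coeff_expand two_pos,
      Polynomial.coeff_one_add_X_pow]
    split_ifs <;> simp_all [mul_assoc]
  simp only [hterm]
  -- The range is lengthened by vanishing terms so that it splits into pairs of an even and an odd
  -- index.
  rw [sum_subset (range_subset_range.2 (show p + q + 1 + 1 ≤ 2 * (p + q + 1) by omega))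
    (fun k _ hk => by
      rw [mem_range, not_lt] at hk
      rw [Nat.choose_eq_zero_of_lt (show p + q + 1 < k by omega)]; simp),
    sum_range_two_mul, mul_sum]
  refine sum_congr rfl fun j _ => ?_
  rw [if_neg (by omega), zero_add]
  rcases Nat.lt_or_ge (p + q) (2 * j) with h1 | h1
  · rw [Nat.choose_eq_zero_of_lt (show p + q + 1 < 2 * j + 1 by omega)]; simp
  unfold midChoose
  rcases Nat.lt_or_ge p j with h2 | h2
  · rw [if_neg (by omega), if_neg (by omega)]; simp
  rw [if_pos ⟨by omega, by omega⟩, show (2 * p + 1 - (2 * j + 1)) / 2 = p - j by omega,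
    show p + q + 1 - (2 * j + 1) = p + q - 2 * j by omega]
  rcases Nat.lt_or_ge q j with h3 | h3
  · rw [if_neg (by omega), Nat.choose_eq_zero_of_lt (show p + q - 2 * j < p - j by omega)]; simp
  · rw [if_pos ⟨h2, h3⟩, pow_succ, pow_mul]; ring

/-- The left side is the value of ζ({2}^p)ζ({2}^q) without its power of λ. Thus the numbers
`altValue` solve the system that `shuffle_pow_pow` imposes. -/
theorem sinhCoeff_mul_sinhCoeff (p q : ℕ) :
    (-1) ^ p * sinhCoeff p * ((-1) ^ q * sinhCoeff q) =
      ∑ n ∈ range (p + q + 1), 4 ^ n * (midChoose p q n : ℚ) * altValue (p + q) n := by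
  have h : ((2 * (p + q) + 2).choose (2 * p + 1) : ℚ) = 2 * ∑ n ∈ range (p + q + 1),
      4 ^ n * (midChoose p q n : ℚ) * (p + q + 1).choose (2 * n + 1) := by
    exact_mod_cast choose_eq_sum_midChoose p q
  have hfac : ((2 * (p + q) + 2).factorial : ℚ) = ((2 * (p + q) + 2).choose (2 * p + 1) : ℚ) *
      (2 * p + 1).factorial * (2 * q + 1).factorial := by
    have := Nat.choose_mul_factorial_mul_factorial
      (show 2 * p + 1 ≤ 2 * (p + q) + 2 by omega)
    rw [show 2 * (p + q) + 2 - (2 * p + 1) = 2 * q + 1 by omega] at this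
    exact_mod_cast this.symm
  have hsum : ∑ n ∈ range (p + q + 1), 4 ^ n * (midChoose p q n : ℚ) * altValue (p + q) n =
      (-1) ^ (p + q) * (1 / (4 ^ (p + q) * (2 * (p + q) + 2).factorial)) *
        ((2 * (p + q) + 2).choose (2 * p + 1) : ℚ) := by
    rw [h, mul_sum, mul_sum]
    refine sum_congr rfl fun n _ => ?_
    rw [altValue]; ring
  have h0 : ((2 * (p + q) + 2).choose (2 * p + 1) : ℚ) ≠ 0 := by
    have := Nat.choose_pos (show 2 * p + 1 ≤ 2 * (p + q) + 2 by omega)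
    positivity
  rw [hsum, hfac, sinhCoeff, sinhCoeff]
  field_simp
  ring

variable {K : Type*} [Field K] [CharZero K] {R : Type*} [CommRing R] [Algebra K R]

/-- The image of a rational number in a `K`-algebra. -/
def rat (K R : Type*) [Field K] [CharZero K] [CommRing R] [Algebra K R] : ℚ →+* R :=
  (algebraMap K R).comp (algebraMap ℚ K)

theorem rat_mul_cancel {c : ℚ} (hc : c ≠ 0) {a b : R} (h : rat K R c * a = rat K R c * b) :
    a = b := by
  have := congrArg (fun x => rat K R c⁻¹ * x) h
  simpa only [← mul_assoc, ← map_mul, inv_mul_cancel₀ hc, map_one, one_mul] using this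

/-- The equation tA' = AP with constant term 1 determines A, as positive integers are invertible in
K; the rational solution c then passes to R, with powers of ν recording the degree. -/
theorem coeff_eq_of_newton {A P : PowerSeries R} {ν : R} {c p : ℕ → ℚ}
    (hA0 : coeff 0 A = 1) (hA : PowerSeries.X * derivative R A = A * P)
    (hP : ∀ n, coeff n P = rat K R (p n) * ν ^ n) (hp : p 0 = 0) (hc0 : c 0 = 1)
    (hc : ∀ n : ℕ, n * c n = ∑ q ∈ antidiagonal n, c q.1 * p q.2) (n : ℕ) :
    coeff n A = rat K R (c n) * ν ^ n := by
  induction n using Nat.strong_induction_on with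
  | _ n ih =>
    cases n with
    | zero => simp [hA0, hc0]
    | succ n =>
      have h := congrArg (coeff (n + 1)) hA
      rw [PowerSeries.coeff_succ_X_mul, PowerSeries.coeff_derivative, PowerSeries.coeff_mul,
        Finset.Nat.sum_antidiagonal_succ', hP 0, hp, map_zero, zero_mul, mul_zero, zero_add] at h
      have h' := hc (n + 1)
      rw [Finset.Nat.sum_antidiagonal_succ', hp, mul_zero, zero_add] at h'
      refine rat_mul_cancel (K := K) (c := (n + 1 : ℕ)) (by positivity) ?_
      rw [← mul_assoc, ← map_mul, h', map_natCast, mul_comm, Nat.cast_succ, h, map_sum, sum_mul]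
      refine sum_congr rfl fun q hq => ?_
      have hq' := mem_antidiagonal.1 hq
      rw [ih q.1 (by omega), hP, map_mul, ← hq', add_assoc, pow_add]
      ring

variable {Z : h0 K →ₗ[K] R}

/-- The element `λ ^ 2` of `R`. -/
def period (Z : h0 K →ₗ[K] R) : R := -24 * zeta Z [2]

/-- `even_depth_two` and `two_mul_sum_evenValue` are one recursion, with the invertible factor 2l +
5. The start is the definition of `period`, since `evenValue 1` is -1/24. -/
theorem RegularizedDoubleShuffle.zeta_even (hZ : RegularizedDoubleShuffle Z) (n : ℕ) :
    zeta Z [2 * (n + 1)] = rat K R (evenValue (n + 1)) * period Z ^ (n + 1) := by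
  induction n using Nat.strong_induction_on with
  | _ n ih =>
    rcases n with _ | l
    · refine rat_mul_cancel (K := K) (c := 24) (by norm_num) ?_
      rw [← mul_assoc, ← map_mul, evenValue, period]
      norm_num [bernoulli_two, Nat.factorial]
      rw [map_ofNat]
    · refine rat_mul_cancel (K := K) (c := 2 * l + 5) (by positivity) ?_
      have h := hZ.even_depth_two l
      have hz : ∀ n, ext Z (z K (2 * n + 2)) = zeta Z [2 * (n + 1)] := fun n => by
        rw [zeta_singleton Z (by omega)]; rfl
      have h' : ∑ q ∈ antidiagonal l, ext Z (z K (2 * q.1 + 2)) * ext Z (z K (2 * q.2 + 2)) =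
          rat K R (∑ q ∈ antidiagonal l, evenValue (q.1 + 1) * evenValue (q.2 + 1)) *
            period Z ^ (l + 2) := by
        rw [map_sum, sum_mul]
        refine sum_congr rfl fun q hq => ?_
        have hq' := mem_antidiagonal.1 hq
        rw [hz, hz, ih q.1 (by omega), ih q.2 (by omega), map_mul,
          show l + 2 = q.1 + 1 + (q.2 + 1) by omega, pow_add]
        ring
      have h2 := congrArg (rat K R) (two_mul_sum_evenValue l)
      rw [map_mul, map_mul, map_ofNat] at h2
      have hcast : rat K R (2 * l + 5) = 2 * l + 5 := by
        rw [map_add, map_mul, map_ofNat, map_ofNat, map_natCast]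
      rw [hcast] at h2 ⊢
      rw [← hz (l + 1), show 2 * (l + 1) + 2 = 2 * l + 4 by ring, ← h, h', ← mul_assoc, h2]
      ring

theorem rat_neg_one_pow (n : ℕ) : rat K R ((-1) ^ n) = (-1) ^ n := by simp

theorem admissible_nil : Admissible [] := ⟨by simp, by simp⟩

omit [CharZero K] in
theorem DoubleShuffle.zeta_nil (hZ : DoubleShuffle Z) : zeta Z [] = 1 := by
  rw [zeta_eq_ext Z admissible_nil, zProd_nil, hZ.ext_one]

omit [CharZero K] in
theorem DoubleShuffle.zetaStar_nil (hZ : DoubleShuffle Z) : zetaStar Z [] = 1 := by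
  rw [zetaStar_eq_ext Z admissible_nil, zProd_nil, S_one, hZ.ext_one]

theorem RegularizedDoubleShuffle.coeff_genP (hZ : RegularizedDoubleShuffle Z) {k : ℕ} (hk : 1 ≤ k)
    (n : ℕ) : coeff n (genP Z (2 * k)) =
      rat K R (if n = 0 then 0 else -(-1) ^ n * evenValue (k * n)) * (period Z ^ k) ^ n := by
  rw [genP, PowerSeries.coeff_mk]
  cases n with
  | zero => simp
  | succ n =>
    rw [if_neg (by omega), if_neg (by omega), map_mul, map_neg, rat_neg_one_pow,
      show 2 * k * (n + 1) = 2 * (k * (n + 1)) by ring]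
    obtain ⟨j, hj⟩ := Nat.exists_eq_add_of_le (show 1 ≤ k * (n + 1) from Nat.mul_pos hk (by omega))
    rw [← pow_mul, hj, add_comm 1 j, hZ.zeta_even j]
    ring

/-- The values of `ζ({2k}ⁿ)`. -/
theorem RegularizedDoubleShuffle.zeta_replicate_even (hZ : RegularizedDoubleShuffle Z) {k : ℕ}
    (hk : 1 ≤ k) (n : ℕ) : zeta Z (List.replicate n (2 * k)) =
      rat K R (newtonSeq (fun n => if n = 0 then 0 else -(-1) ^ n * evenValue (k * n)) n) *
        period Z ^ (k * n) := by
  have h := hZ.toDoubleShuffle.genE_newton (c := 2 * k - 1) (by omega)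
  rw [show 2 * k - 1 + 1 = 2 * k by omega] at h
  have := coeff_eq_of_newton (by simp [genE, hZ.zeta_nil]) h (hZ.coeff_genP hk)
    (if_pos rfl) (newtonSeq_zero _)
    (newtonSeq_spec (p := fun n => if n = 0 then 0 else -(-1) ^ n * evenValue (k * n)) (if_pos rfl)) n
  rwa [genE, PowerSeries.coeff_mk, ← pow_mul] at this

/-- The values of `ζ⋆({2k}ⁿ)`. -/
theorem RegularizedDoubleShuffle.zetaStar_replicate_even (hZ : RegularizedDoubleShuffle Z) {k : ℕ}
    (hk : 1 ≤ k) (n : ℕ) : zetaStar Z (List.replicate n (2 * k)) =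
      rat K R (newtonSeq (fun n => if n = 0 then 0 else - -1 * evenValue (k * n)) n) *
        period Z ^ (k * n) := by
  have h := hZ.toDoubleShuffle.genH_newton (c := 2 * k - 1) (by omega)
  rw [show 2 * k - 1 + 1 = 2 * k by omega] at h
  have hP : ∀ n, coeff n (-rescale (-1) (genP Z (2 * k))) =
      rat K R (if n = 0 then 0 else - -1 * evenValue (k * n)) * (period Z ^ k) ^ n := by
    intro n
    rw [map_neg, PowerSeries.coeff_rescale, hZ.coeff_genP hk, ← rat_neg_one_pow (K := K),
      ← mul_assoc, ← map_mul, ← neg_mul, ← map_neg]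
    congr 2
    split_ifs
    · ring
    · have : ((-1 : ℚ) ^ n) * (-1) ^ n = 1 := by rw [← mul_pow]; simp
      linear_combination evenValue (k * n) * this
  have := coeff_eq_of_newton (by simp [genH, hZ.zetaStar_nil]) h hP
    (if_pos rfl) (newtonSeq_zero _)
    (newtonSeq_spec (p := fun n => if n = 0 then 0 else - -1 * evenValue (k * n)) (if_pos rfl)) n
  rwa [genH, PowerSeries.coeff_mk, ← pow_mul] at this

theorem RegularizedDoubleShuffle.zeta_two (hZ : RegularizedDoubleShuffle Z) (n : ℕ) :
    zeta Z (List.replicate n 2) = rat K R ((-1) ^ n * sinhCoeff n) * period Z ^ n := by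
  have h := hZ.toDoubleShuffle.genE_newton (c := 1) one_ne_zero
  have := coeff_eq_of_newton (c := fun n => (-1) ^ n * sinhCoeff n) (by simp [genE, hZ.zeta_nil]) h
    (hZ.coeff_genP le_rfl) (by simp) (by simp [sinhCoeff]) (fun n => by
      have h := sinhCoeff_newton n
      rw [show (n : ℚ) * ((-1) ^ n * sinhCoeff n) =
        (-1) ^ n * (1 / 2) * (2 * n * sinhCoeff n) by ring, h, mul_sum]
      refine sum_congr rfl fun q hq => ?_
      rw [← mem_antidiagonal.1 hq, pow_add]
      split_ifs
      · ring
      · rw [one_mul]; ring) n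
  rwa [genE, PowerSeries.coeff_mk, pow_one] at this

/-- Both series are inverse to E(-t), hence equal. -/
theorem RegularizedDoubleShuffle.zetaStar_two (hZ : RegularizedDoubleShuffle Z) (n : ℕ) :
    zetaStar Z (List.replicate n 2) = rat K R (beta n) * period Z ^ n := by
  have h := hZ.toDoubleShuffle.genE_mul_genH (c := 1) one_ne_zero
  have h' : rescale (-1) (genE Z 2) *
      PowerSeries.mk (fun n => rat K R (beta n) * period Z ^ n) = 1 := by
    ext n
    have hb := congrArg (fun x => rat K R x * period Z ^ n) (sum_sinhCoeff_mul_beta n)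
    simp only [map_sum, sum_mul] at hb
    rw [PowerSeries.coeff_mul, PowerSeries.coeff_one]
    refine Eq.trans (sum_congr rfl fun q hq => ?_) (hb.trans ?_)
    · rw [PowerSeries.coeff_rescale, genE, PowerSeries.coeff_mk, PowerSeries.coeff_mk, hZ.zeta_two,
        ← mem_antidiagonal.1 hq, pow_add, map_mul, map_mul, rat_neg_one_pow]
      have : ((-1 : R) ^ q.1) * (-1) ^ q.1 = 1 := by rw [← mul_pow]; simp
      linear_combination rat K R (sinhCoeff q.1) * rat K R (beta q.2) * period Z ^ q.1 *
        period Z ^ q.2 * this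
    · split_ifs with h0
      · simp [h0]
      · simp
  have h3 : genH Z 2 = PowerSeries.mk (fun n => rat K R (beta n) * period Z ^ n) := by
    rw [mul_comm] at h
    exact left_inv_eq_right_inv h h'
  have := congrArg (coeff n) h3
  rwa [genH, PowerSeries.coeff_mk, PowerSeries.coeff_mk] at this

/-- Apply `shuffle_pow_pow` to the exponents n and m - n. Terms with index above n have coefficient
0, those below n are known by induction, and the n-th has the invertible coefficient 4ⁿ. -/
theorem RegularizedDoubleShuffle.ext_altW (hZ : RegularizedDoubleShuffle Z) (m n : ℕ) :
    ext Z (altW K m n) = rat K R (altValue m n) * period Z ^ m := by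
  rcases Nat.lt_or_ge m (2 * n) with hmn | hmn
  · rw [altW_of_lt hmn, altValue, Nat.choose_eq_zero_of_lt (show m + 1 < 2 * n + 1 by omega)]
    simp
  induction n using Nat.strong_induction_on with
  | _ n ih =>
    obtain ⟨q, rfl⟩ := Nat.exists_eq_add_of_le (show n ≤ m by omega)
    have hmem : ∀ p, z K 2 ^ p ∈ h0 K := fun p => by
      rw [← zProd_replicate]; exact zProd_mem_h0 K (admissible_replicate p le_rfl)
    have h1 := congrArg (ext Z) (shuffle_pow_pow (K := K) n q)
    rw [hZ.toDoubleShuffle.ext_shuffle (hmem n) (hmem q), ← zeta_replicate Z n le_rfl,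
      ← zeta_replicate Z q le_rfl, hZ.zeta_two, hZ.zeta_two, map_sum] at h1
    have h2 := congrArg (fun x => rat K R x * period Z ^ (n + q)) (sinhCoeff_mul_sinhCoeff n q)
    have hcoe : ∀ j, algebraMap K R ((4 : K) ^ j * (midChoose n q j : K)) =
        rat K R (4 ^ j * (midChoose n q j : ℚ)) := fun j => by
      simp only [map_mul, map_pow, map_natCast, map_ofNat]
    have h3 : ∑ j ∈ range (n + q + 1), rat K R (4 ^ j * (midChoose n q j : ℚ)) *
        (ext Z (altW K (n + q) j) - rat K R (altValue (n + q) j) * period Z ^ (n + q)) = 0 := by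
      simp only [map_smul] at h1
      simp only [Algebra.smul_def, hcoe] at h1
      simp only [mul_sub, sum_sub_distrib, ← h1]
      rw [sub_eq_zero]
      rw [map_mul, pow_add] at h2
      simp only [map_sum, sum_mul] at h2
      refine Eq.trans (by ring) (h2.trans (sum_congr rfl fun j _ => ?_))
      rw [map_mul, pow_add]; ring
    rw [sum_eq_single n] at h3
    · have hm : midChoose n q n = 1 := by
        rw [midChoose, if_pos ⟨le_rfl, by omega⟩, Nat.sub_self, Nat.choose_zero_right]
      rw [hm, Nat.cast_one, mul_one] at h3
      refine rat_mul_cancel (K := K) (c := 4 ^ n) (by positivity) ?_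
      rw [mul_sub] at h3
      exact sub_eq_zero.1 h3
    · intro j _ hj
      rcases Nat.lt_or_ge j n with h | h
      · rw [ih j h (by omega), sub_self, mul_zero]
      · rw [midChoose, if_neg (by omega)]; simp
    · intro h; exact absurd (mem_range.2 (by omega)) h

end

end MZV

/-! ### The star version of the sums over the indices `insertTwos n c` -/

namespace MZV

noncomputable section

open Finset hiding antidiagonal mem_antidiagonal
open Finset.HasAntidiagonal
open PowerSeries (derivative rescale coeff)

variable {K : Type*} [Field K] {R : Type*} [CommRing R] [Algebra K R]

/-- Comparison of coefficients in two polynomials over `R` that agree at all points of `K`. -/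
theorem sum_filter_eq_of_forall [Infinite K] {ι κ : Type*} (s : Finset ι) (t : Finset κ)
    (d : ι → ℕ) (e : κ → ℕ) (r : ι → R) (r' : κ → R)
    (h : ∀ b : K, ∑ i ∈ s, algebraMap K R (b ^ d i) * r i =
      ∑ i ∈ t, algebraMap K R (b ^ e i) * r' i) (N : ℕ) :
    ∑ i ∈ s with d i = N, r i = ∑ i ∈ t with e i = N, r' i := by
  -- Linear functionals R → K separate points, which reduces the claim to polynomials over the
  -- infinite field K.
  rw [← sub_eq_zero, ← Module.forall_dual_apply_eq_zero_iff K]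
  intro φ
  have hpoly : ∑ i ∈ s, Polynomial.monomial (d i) (φ (r i)) =
      ∑ i ∈ t, Polynomial.monomial (e i) (φ (r' i)) := by
    refine Polynomial.funext fun b => ?_
    have hb := congrArg φ (h b)
    simp only [← Algebra.smul_def, map_sum, map_smul, smul_eq_mul] at hb
    simp only [Polynomial.eval_finsetSum, Polynomial.eval_monomial, mul_comm (φ _), hb]
  have hN := congrArg (fun P => Polynomial.coeff P N) hpoly
  simp only [Polynomial.finsetSum_coeff, Polynomial.coeff_monomial, ← sum_filter] at hN
  rw [map_sub, map_sum, map_sum, hN, sub_self]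

/-- The tuples `(i, j, k, l, u, v)` with `i + k + l + u + v = m` and `2 j ≤ i`. -/
def starIndices (m : ℕ) : Finset (ℕ × ℕ × ℕ × ℕ × ℕ × ℕ) :=
  (range (m + 1) ×ˢ range (m + 1) ×ˢ range (m + 1) ×ˢ range (m + 1) ×ˢ range (m + 1) ×ˢ
    range (m + 1)).filter fun x => x.1 + x.2.2.1 + x.2.2.2.1 + x.2.2.2.2.1 + x.2.2.2.2.2 = m ∧
      2 * x.2.1 ≤ x.1

theorem mem_starIndices {m i j k l u v : ℕ} :
    (i, j, k, l, u, v) ∈ starIndices m ↔ i + k + l + u + v = m ∧ 2 * j ≤ i := by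
  simp only [starIndices, mem_filter, mem_product, mem_range, and_iff_right_iff_imp]
  omega

theorem sum_starIndices {M : Type*} [AddCommMonoid M] (m : ℕ)
    (F : ℕ → ℕ → ℕ → ℕ → ℕ → ℕ → M) :
    ∑ x ∈ starIndices m, F x.1 x.2.1 x.2.2.1 x.2.2.2.1 x.2.2.2.2.1 x.2.2.2.2.2 =
      ∑ p ∈ antidiagonal m, ∑ q ∈ antidiagonal p.2, ∑ j ∈ range (p.1 + 1) with 2 * j ≤ p.1,
        ∑ s ∈ antidiagonal q.1, ∑ t ∈ antidiagonal q.2, F p.1 j s.1 s.2 t.1 t.2 := by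
  simp only [← sum_product', sum_sigma']
  refine sum_nbij' (fun x => ⟨(x.1, x.2.2.1 + x.2.2.2.1 + (x.2.2.2.2.1 + x.2.2.2.2.2)),
      (x.2.2.1 + x.2.2.2.1, x.2.2.2.2.1 + x.2.2.2.2.2),
      x.2.1, (x.2.2.1, x.2.2.2.1), (x.2.2.2.2.1, x.2.2.2.2.2)⟩)
    (fun y => (y.1.1, y.2.2.1, y.2.2.2.1.1, y.2.2.2.1.2, y.2.2.2.2.1, y.2.2.2.2.2)) ?_ ?_ ?_ ?_ ?_
  · rintro ⟨i, j, k, l, u, v⟩ h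
    rw [mem_starIndices] at h
    simp only [mem_sigma, mem_product, mem_antidiagonal, mem_filter, mem_range]
    refine ⟨?_, ?_, ?_, ?_, ?_⟩ <;> first | trivial | omega
  · rintro ⟨⟨i, r⟩, ⟨p, q⟩, j, ⟨k, l⟩, ⟨u, v⟩⟩ h
    simp only [mem_sigma, mem_product, mem_antidiagonal, mem_filter, mem_range] at h
    refine mem_starIndices.2 ⟨?_, ?_⟩ <;> dsimp only at h ⊢ <;> omega
  · rintro ⟨i, j, k, l, u, v⟩ h; rfl
  · rintro ⟨⟨i, r⟩, ⟨p, q⟩, j, ⟨k, l⟩, ⟨u, v⟩⟩ h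
    simp only [mem_sigma, mem_product, mem_antidiagonal, mem_filter, mem_range] at h
    obtain ⟨-, rfl, -, rfl, rfl⟩ := h
    rfl
  · intro x _; rfl

/-- The summand in the value of the star sums. -/
def starTerm (i j k l u v : ℕ) : ℚ :=
  (-1) ^ k * ((k + l).choose k : ℚ) * ((u + v).choose u : ℚ) * ((i + 1).choose (2 * j + 1) : ℚ) *
    (beta (k + l) * beta (u + v) / ((2 : ℚ) ^ (2 * (i : ℤ) - 1) * (2 * i + 2).factorial))

/-- The three factors are the contributions of the non-star sum, of H((1-b)t) and of H((1+b)t). The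
sign (-1)^i comes from the weight -1 of z_2, and (-1)^k from -b. -/
theorem starTerm_eq (i j k l u v : ℕ) : starTerm i j k l u v =
    ((-1) ^ i * altValue i j) * ((-1) ^ k * (k + l).choose k * beta (k + l)) *
      ((u + v).choose u * beta (u + v)) := by
  have h : (2 : ℚ) ^ (2 * (i : ℤ) - 1) = 4 ^ i / 2 := by
    rw [zpow_sub₀ two_ne_zero, zpow_one, zpow_mul]
    norm_num
  have hs : ((-1 : ℚ) ^ i) * (-1) ^ i = 1 := by rw [← mul_pow]; simp
  rw [starTerm, h, altValue]
  field_simp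
  linear_combination -(↑((k + l).choose k) * ↑((u + v).choose u) *
    ↑((i + 1).choose (2 * j + 1)) * beta (k + l) * beta (u + v)) * hs

variable {Z : h0 K →ₗ[K] R}

/-- Evaluate the two stuffle factors of `st_altMidSer` for c = 1, d = b, and invert them by
E(-t)H(t) = 1. -/
theorem DoubleShuffle.altStar_gen (hZ : DoubleShuffle Z) (b : K) :
    PowerSeries.mk (fun m => ext Z (elt (altStarSer 1 b false) (2 * m))) =
      PowerSeries.mk (fun m => ext Z (elt (altSer (-1) b false) (2 * m))) *
        (rescale (algebraMap K R (1 - b)) (genH Z 2) *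
          rescale (algebraMap K R (1 + b)) (genH Z 2)) := by
  have hmul : ∀ (a : K) {f : List ℕ → K}, der 0 f = 0 →
      rescale (algebraMap K R (-a)) (genE Z 2) *
        PowerSeries.mk (fun m => ext Z (elt f (2 * m))) =
      PowerSeries.mk (fun m => ext Z (elt (st (eSer 1 (-a)) f) (2 * m))) := by
    intro a f hf
    ext m
    have h := hZ.sum_ext_elt (der_zero_eSer one_ne_zero (-a)) hf (2 * m)
    rw [sum_antidiagonal_mul (κ := 2) (by omega) (fun j => ext Z (elt f j))
      (ext_elt_eSer_of_not_dvd Z 1 (-a))] at h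
    rw [PowerSeries.coeff_mul, PowerSeries.coeff_mk, ← h]
    refine sum_congr rfl fun q _ => ?_
    rw [PowerSeries.coeff_mk, PowerSeries.coeff_rescale, genE, PowerSeries.coeff_mk,
      ext_elt_eSer Z one_ne_zero, map_pow]
  have hinv : ∀ a : K, rescale (algebraMap K R (-a)) (genE Z 2) *
      rescale (algebraMap K R a) (genH Z 2) = 1 := by
    intro a
    have h := congrArg (rescale (algebraMap K R a)) (hZ.genE_mul_genH (c := 1) one_ne_zero)
    rwa [map_mul, PowerSeries.rescale_rescale, _root_.map_one, neg_one_mul, ← map_neg] at h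
  have h1 := hmul (1 - b) (der_zero_altStarSer 1 b)
  have h2 := hmul (1 + b) (der_altMidSer_false_zero 1 b)
  rw [st_altMidSer] at h2
  change _ = PowerSeries.mk (fun m => ext Z (elt (altMidSer 1 b false) (2 * m))) at h1
  rw [← h2, ← h1]
  have h3 := hinv (1 - b)
  have h4 := hinv (1 + b)
  generalize PowerSeries.mk (fun m => ext Z (elt (altStarSer 1 b false) (2 * m))) = G
  generalize rescale (algebraMap K R (-(1 - b))) (genE Z 2) = E₁ at *
  generalize rescale (algebraMap K R (-(1 + b))) (genE Z 2) = E₂ at *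
  generalize rescale (algebraMap K R (1 - b)) (genH Z 2) = H₁ at *
  generalize rescale (algebraMap K R (1 + b)) (genH Z 2) = H₂ at *
  linear_combination (-G) * h3 - G * E₁ * H₁ * h4

variable [CharZero K]

theorem rescale_genH_coeff (hZ : RegularizedDoubleShuffle Z) (a b : K) (p : ℕ) :
    coeff p (rescale (algebraMap K R (a + b)) (genH Z 2)) =
      ∑ s ∈ antidiagonal p, algebraMap K R (b ^ s.1 * a ^ s.2) *
        rat K R ((s.1 + s.2).choose s.1 * beta (s.1 + s.2)) * period Z ^ p := by
  rw [PowerSeries.coeff_rescale, genH, PowerSeries.coeff_mk, hZ.zetaStar_two, ← map_pow, add_comm,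
    (Commute.all b a).add_pow', map_sum, sum_mul]
  refine sum_congr rfl fun s hs => ?_
  rw [mem_antidiagonal.1 hs, map_nsmul, map_mul (rat K R), map_natCast, nsmul_eq_mul]
  ring

theorem RegularizedDoubleShuffle.ext_S_altW (hZ : RegularizedDoubleShuffle Z) {m n : ℕ}
    (hmn : 2 * n ≤ m) : ext Z (S K (altW K m n)) =
      rat K R (∑ x ∈ starIndices m with 2 * x.2.1 + x.2.2.1 + x.2.2.2.2.1 = 2 * n,
        starTerm x.1 x.2.1 x.2.2.1 x.2.2.2.1 x.2.2.2.2.1 x.2.2.2.2.2) * period Z ^ m := by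
  -- The coefficient of t^m in `altStar_gen`, with both sides expanded in powers of b.
  have key : ∀ b : K, ∑ n ∈ range (m + 1), algebraMap K R (b ^ (2 * n)) * ext Z (S K (altW K m n)) =
      ∑ x ∈ starIndices m, algebraMap K R (b ^ (2 * x.2.1 + x.2.2.1 + x.2.2.2.2.1)) *
        (rat K R (starTerm x.1 x.2.1 x.2.2.1 x.2.2.2.1 x.2.2.2.2.1 x.2.2.2.2.2) *
          period Z ^ m) := by
    intro b
    have h := congrArg (coeff m) (hZ.toDoubleShuffle.altStar_gen b)
    rw [PowerSeries.coeff_mk, ← S_elt_altSer, elt_altSer, map_sum, map_sum] at h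
    rw [sum_starIndices m (fun i j k l u v => algebraMap K R (b ^ (2 * j + k + u)) *
        (rat K R (starTerm i j k l u v) * period Z ^ m))]
    refine Eq.trans (sum_congr rfl fun n _ => ?_) (h.trans ?_)
    · rw [one_pow, one_mul, map_smul, map_smul, Algebra.smul_def]
    · rw [PowerSeries.coeff_mul]
      refine sum_congr rfl fun p hp => ?_
      rw [PowerSeries.coeff_mul, mul_sum]
      refine sum_congr rfl fun q hq => ?_
      rw [sub_eq_add_neg, rescale_genH_coeff hZ, rescale_genH_coeff hZ, PowerSeries.coeff_mk,
        elt_altSer, map_sum, sum_mul_sum, ← sum_filter_of_ne (p := fun j => 2 * j ≤ p.1)]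
      · rw [sum_mul]
        refine sum_congr rfl fun j hj => ?_
        rw [mul_sum]
        refine sum_congr rfl fun s hs => ?_
        rw [mul_sum]
        refine sum_congr rfl fun t ht => ?_
        obtain ⟨r, hr⟩ := Nat.exists_eq_add_of_le (mem_filter.1 hj).2
        have hpow : ((-1 : K)) ^ (p.1 - 2 * j) = (-1) ^ p.1 := by
          rw [hr, Nat.add_sub_cancel_left, pow_add, pow_mul, neg_one_sq, one_pow, one_mul]
        rw [map_smul, Algebra.smul_def, hZ.ext_altW, starTerm_eq, hpow, neg_pow b]
        rw [← mem_antidiagonal.1 hp, ← mem_antidiagonal.1 hq]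
        simp only [map_mul, map_pow, map_neg, map_one, map_natCast, one_pow, mul_one]
        ring
      · intro j _ hne
        by_contra hlt
        exact hne (by rw [altW_of_lt (by omega), smul_zero, map_zero])
  have h := sum_filter_eq_of_forall (range (m + 1)) (starIndices m) (fun n => 2 * n)
    (fun x => 2 * x.2.1 + x.2.2.1 + x.2.2.2.2.1) (fun n => ext Z (S K (altW K m n)))
    (fun x => rat K R (starTerm x.1 x.2.1 x.2.2.1 x.2.2.2.1 x.2.2.2.2.1 x.2.2.2.2.2) *
      period Z ^ m) key (2 * n)
  rw [map_sum, sum_mul, ← h, sum_eq_single n]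
  · intro j hj hne
    have := (mem_filter.1 hj).2
    omega
  · intro hn
    exact (hn (mem_filter.2 ⟨mem_range.2 (show n < m + 1 by omega), rfl⟩)).elim

end

end MZV

/-! ### The values in the form of the theorem -/

namespace MZV

noncomputable section

open Finset hiding antidiagonal mem_antidiagonal
open Finset.HasAntidiagonal

theorem admissible_insertTwos (n : ℕ) (c : Fin (2 * n + 1) → ℕ) : Admissible (insertTwos n c) := by
  refine ⟨fun k hk => ?_, fun k hk => ?_⟩
  · simp only [insertTwos, List.mem_append, List.mem_replicate, List.mem_flatMap, List.mem_cons]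
      at hk
    grind
  · rw [insertTwos] at hk
    cases hc : c 0 with
    | zero =>
      cases n with
      | zero => simp [hc] at hk
      | succ n =>
        rw [hc, List.finRange_succ, List.flatMap_cons] at hk
        simp at hk
        omega
    | succ a =>
      rw [hc, List.replicate_succ] at hk
      simp at hk
      omega

theorem insertTwos_zero (n : ℕ) : insertTwos n 0 = threeOne n := by
  simp [insertTwos, threeOne, List.flatMap_def]

theorem threeOne_succ (n : ℕ) : threeOne (n + 1) = 3 :: 1 :: threeOne n := by
  simp [threeOne, List.replicate_succ]

theorem sum_insertTwos_zero {M : Type*} [AddCommMonoid M] (n : ℕ) (f : List ℕ → M) :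
    ∑ c ∈ Finset.Nat.antidiagonalTuple (2 * n + 1) 0, f (insertTwos n c) = f (threeOne n) := by
  rw [Finset.Nat.antidiagonalTuple_zero_right, sum_singleton, insertTwos_zero]

/-- The single 2 stands before the leading 3, between it and the following 1, or in the remaining
index, which is the induction step. -/
theorem sum_insertTwos_one {M : Type*} [AddCommMonoid M] (n : ℕ) (f : List ℕ → M) :
    ∑ c ∈ Finset.Nat.antidiagonalTuple (2 * n + 1) 1, f (insertTwos n c) =
      ∑ p ∈ range (2 * n + 1), f ((threeOne n).insertIdx p 2) := by
  induction n generalizing f with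
  | zero =>
    refine (sum_congr (Finset.Nat.antidiagonalTuple_one 1) fun _ _ => rfl).trans ?_
    rw [sum_singleton, sum_range_one]
    rfl
  | succ n ih =>
    refine (sum_antidiagonalTuple_succ (2 * n + 1 + 1) 1 fun c => f (insertTwos (n + 1) c)).trans ?_
    simp only [sum_antidiagonalTuple_succ (2 * n + 1), insertTwos_cons_cons]
    rw [show 2 * (n + 1) + 1 = 2 * n + 1 + 1 + 1 by ring, sum_range_succ', sum_range_succ',
      threeOne_succ, Finset.Nat.sum_antidiagonal_succ]
    simp only [Finset.Nat.antidiagonal_zero, sum_singleton, zero_add,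
      Finset.Nat.sum_antidiagonal_succ, List.replicate_zero, List.replicate_one, List.nil_append,
      List.singleton_append]
    rw [ih fun w => f (3 :: 1 :: w), sum_insertTwos_zero n fun w => f (3 :: 2 :: 1 :: w),
      sum_insertTwos_zero n fun w => f (2 :: 3 :: 1 :: w)]
    rfl

theorem altValue_two_mul (n : ℕ) : altValue (2 * n) n =
    1 / ((2 : ℚ) ^ (4 * (n : ℤ) - 1) * (4 * n + 2).factorial) := by
  have h : (2 : ℚ) ^ (4 * (n : ℤ) - 1) = 4 ^ (2 * n) / 2 := by
    rw [zpow_sub₀ two_ne_zero, zpow_one, zpow_mul, pow_mul]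
    norm_num
  rw [altValue, h, Nat.choose_self, pow_mul, neg_one_sq, one_pow,
    show 2 * (2 * n) + 2 = 4 * n + 2 by ring]
  field_simp
  simp

theorem altValue_two_mul_add_one (n : ℕ) : altValue (2 * n + 1) n =
    -(1 / (4 ^ (2 * n + 1) * (4 * n + 3).factorial)) := by
  rw [altValue, Nat.choose_succ_self_right, pow_succ (-1 : ℚ), pow_mul, neg_one_sq, one_pow,
    show 2 * (2 * n + 1) + 2 = 4 * n + 3 + 1 by ring, Nat.factorial_succ]
  push_cast
  field_simp
  ring

theorem two_mul_evenValue (n : ℕ) :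
    2 * (1 - (2 : ℚ) ^ (1 - 2 * (n : ℤ))) * evenValue n = beta n := by
  rw [evenValue, beta]
  field_simp
  ring

theorem sum_filter_starIndices (m : ℕ) (N : ℕ) :
    ∑ x ∈ starIndices m with 2 * x.2.1 + x.2.2.1 + x.2.2.2.2.1 = N,
        starTerm x.1 x.2.1 x.2.2.1 x.2.2.2.1 x.2.2.2.2.1 x.2.2.2.2.2 =
      ∑ i ∈ range (m + 1), ∑ j ∈ range (m + 1), ∑ k ∈ range (m + 1),
        ∑ l ∈ range (m + 1), ∑ u ∈ range (m + 1), ∑ v ∈ range (m + 1),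
          if 2 * j + k + u = N ∧ i + k + l + u + v = m ∧ 2 * j ≤ i then
            starTerm i j k l u v else 0 := by
  rw [starIndices, filter_filter, sum_filter]
  simp only [sum_product]
  refine sum_congr rfl fun i _ => sum_congr rfl fun j _ => sum_congr rfl fun k _ =>
    sum_congr rfl fun l _ => sum_congr rfl fun u _ => sum_congr rfl fun v _ =>
      if_congr and_comm rfl rfl

/-- Subtracting the constraints gives (i - 2j) + l + v = 0, so all three terms vanish. -/
theorem sum_starIndices_two_mul (n : ℕ) (F : ℕ → ℕ → ℕ → ℕ → ℕ → ℕ → ℚ) :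
    ∑ x ∈ starIndices (2 * n) with 2 * x.2.1 + x.2.2.1 + x.2.2.2.2.1 = 2 * n,
        F x.1 x.2.1 x.2.2.1 x.2.2.2.1 x.2.2.2.2.1 x.2.2.2.2.2 =
      ∑ j ∈ range (n + 1), ∑ q ∈ antidiagonal (2 * (n - j)), F (2 * j) j q.1 0 q.2 0 := by
  rw [sum_sigma']
  refine sum_nbij' (fun x => ⟨x.2.1, (x.2.2.1, x.2.2.2.2.1)⟩)
    (fun y => (2 * y.1, y.1, y.2.1, 0, y.2.2, 0)) ?_ ?_ ?_ ?_ ?_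
  · rintro ⟨i, j, k, l, u, v⟩ h
    simp only [mem_filter, mem_starIndices, mem_sigma, mem_range, mem_antidiagonal] at h ⊢
    omega
  · rintro ⟨j, k, u⟩ h
    simp only [mem_filter, mem_starIndices, mem_sigma, mem_range, mem_antidiagonal] at h ⊢
    omega
  · rintro ⟨i, j, k, l, u, v⟩ h
    simp only [mem_filter, mem_starIndices] at h
    simp only [Prod.mk.injEq, true_and]
    omega
  · intro y _; rfl
  · rintro ⟨i, j, k, l, u, v⟩ h
    simp only [mem_filter, mem_starIndices] at h
    obtain ⟨rfl, rfl, rfl⟩ : i = 2 * j ∧ l = 0 ∧ v = 0 := by omega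
    rfl

/-- Now (i - 2j) + l + v = 1, and the three families say which term is 1. -/
theorem sum_starIndices_two_mul_add_one (n : ℕ) (F : ℕ → ℕ → ℕ → ℕ → ℕ → ℕ → ℚ) :
    ∑ x ∈ starIndices (2 * n + 1) with 2 * x.2.1 + x.2.2.1 + x.2.2.2.2.1 = 2 * n,
        F x.1 x.2.1 x.2.2.1 x.2.2.2.1 x.2.2.2.2.1 x.2.2.2.2.2 =
      ∑ j ∈ range (n + 1), ∑ q ∈ antidiagonal (2 * (n - j)),
        (F (2 * j + 1) j q.1 0 q.2 0 + F (2 * j) j q.1 1 q.2 0 + F (2 * j) j q.1 0 q.2 1) := by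
  have key : ∀ a l v : ℕ, a + l + v = 1 →
      ∑ x ∈ starIndices (2 * n + 1) with 2 * x.2.1 + x.2.2.1 + x.2.2.2.2.1 = 2 * n ∧
          x.2.2.2.1 = l ∧ x.2.2.2.2.2 = v,
        F x.1 x.2.1 x.2.2.1 x.2.2.2.1 x.2.2.2.2.1 x.2.2.2.2.2 =
      ∑ j ∈ range (n + 1), ∑ q ∈ antidiagonal (2 * (n - j)), F (2 * j + a) j q.1 l q.2 v := by
    intro a l v h1
    rw [sum_sigma']
    refine sum_nbij' (fun x => ⟨x.2.1, (x.2.2.1, x.2.2.2.2.1)⟩)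
      (fun y => (2 * y.1 + a, y.1, y.2.1, l, y.2.2, v)) ?_ ?_ ?_ ?_ ?_
    · rintro ⟨i, j, k, l', u, v'⟩ h
      simp only [mem_filter, mem_starIndices, mem_sigma, mem_range, mem_antidiagonal] at h ⊢
      omega
    · rintro ⟨j, k, u⟩ h
      simp only [mem_filter, mem_starIndices, mem_sigma, mem_range, mem_antidiagonal] at h ⊢
      exact ⟨⟨by omega, by omega⟩, by omega, trivial, trivial⟩
    · rintro ⟨i, j, k, l', u, v'⟩ h
      simp only [mem_filter, mem_starIndices] at h
      simp only [Prod.mk.injEq, true_and]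
      omega
    · intro y _; rfl
    · rintro ⟨i, j, k, l', u, v'⟩ h
      simp only [mem_filter, mem_starIndices] at h
      obtain ⟨rfl, rfl, rfl⟩ : i = 2 * j + a ∧ l' = l ∧ v' = v := by omega
      rfl
  have h := key 1 0 0 rfl
  have h' := key 0 1 0 rfl
  have h'' := key 0 0 1 rfl
  simp only [sum_add_distrib]
  simp only [add_zero] at h' h''
  rw [← h, ← h', ← h'', ← sum_union, ← sum_union]
  · refine sum_congr ?_ fun _ _ => rfl
    ext ⟨i, j, k, l, u, v⟩
    simp only [mem_union, mem_filter, mem_starIndices]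
    omega
  all_goals
    rw [disjoint_left]
    rintro ⟨i, j, k, l, u, v⟩ h1 h2
    simp only [mem_union, mem_filter, mem_starIndices] at h1 h2
    omega

theorem sum_starTerm_two_mul (n : ℕ) :
    ∑ x ∈ starIndices (2 * n) with 2 * x.2.1 + x.2.2.1 + x.2.2.2.2.1 = 2 * n,
        starTerm x.1 x.2.1 x.2.2.1 x.2.2.2.1 x.2.2.2.2.1 x.2.2.2.2.2 =
      ∑ j ∈ range (n + 1), ∑ q ∈ antidiagonal (2 * (n - j)),
        (-1) ^ q.1 * (beta q.1 * beta q.2 /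
          ((2 : ℚ) ^ (4 * (j : ℤ) - 1) * (4 * j + 2).factorial)) := by
  rw [sum_starIndices_two_mul n starTerm]
  refine sum_congr rfl fun j _ => sum_congr rfl fun q _ => ?_
  rw [starTerm, show 2 * (2 * j) + 2 = 4 * j + 2 by ring,
    show 2 * ((2 * j : ℕ) : ℤ) - 1 = 4 * (j : ℤ) - 1 by push_cast; ring]
  simp

theorem sum_antidiagonal_succ_filter (M : ℕ) (g : ℕ × ℕ → ℚ) :
    ∑ q ∈ (antidiagonal (M + 1)).filter (fun q => 1 ≤ q.1), g q =
      ∑ q ∈ antidiagonal M, g (q.1 + 1, q.2) := by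
  rw [sum_filter, Finset.Nat.sum_antidiagonal_succ]
  simp

/-- The families l = 1 and v = 1 have equal sums: exchange k and u, whose sum is even, so the signs
agree. -/
theorem sum_starTerm_two_mul_add_one (n : ℕ) :
    ∑ x ∈ starIndices (2 * n + 1) with 2 * x.2.1 + x.2.2.1 + x.2.2.2.2.1 = 2 * n,
        starTerm x.1 x.2.1 x.2.2.1 x.2.2.2.1 x.2.2.2.2.1 x.2.2.2.2.2 =
      ∑ j ∈ range (n + 1),
        (1 / (4 ^ (2 * j + 1) * (4 * j + 3).factorial) *
            ∑ q ∈ antidiagonal (2 * (n - j)), (-1) ^ q.1 * beta q.1 * beta q.2 -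
          1 / ((4 : ℚ) ^ (2 * (j : ℤ) - 1) * (4 * j + 2).factorial) *
            ∑ q ∈ (antidiagonal (2 * (n - j) + 1)).filter (fun q => 1 ≤ q.1),
              (-1) ^ q.1 * (q.1 : ℚ) * beta q.1 * beta q.2) := by
  rw [sum_starIndices_two_mul_add_one n starTerm]
  refine sum_congr rfl fun j _ => ?_
  have h1 : ∑ q ∈ antidiagonal (2 * (n - j)), starTerm (2 * j + 1) j q.1 0 q.2 0 =
      1 / (4 ^ (2 * j + 1) * (4 * j + 3).factorial) *
        ∑ q ∈ antidiagonal (2 * (n - j)), (-1) ^ q.1 * beta q.1 * beta q.2 := by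
    rw [mul_sum]
    refine sum_congr rfl fun q _ => ?_
    have h : ((-1 : ℚ)) ^ (2 * j + 1) * altValue (2 * j + 1) j =
        1 / (4 ^ (2 * j + 1) * (4 * j + 3).factorial) := by
      rw [altValue_two_mul_add_one, pow_succ, pow_mul]; simp
    rw [starTerm_eq, h]
    simp
    ring
  -- The binomial binom(k+1, k) = k + 1 is the factor k of the stated sum after shifting k by one,
  -- which also changes the sign. The 1/2 is absorbed by the two equal families.
  have h2 : ∀ q : ℕ × ℕ, starTerm (2 * j) j q.1 1 q.2 0 = -(1 / 2 * (1 / ((4 : ℚ) ^ (2 * (j : ℤ) - 1)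
      * (4 * j + 2).factorial))) * ((-1) ^ (q.1 + 1) * ((q.1 + 1 : ℕ) : ℚ) * beta (q.1 + 1) *
        beta q.2) := by
    intro q
    have hz : (2 : ℚ) ^ (2 * ((2 * j : ℕ) : ℤ) - 1) = 4 ^ (2 * j) / 2 := by
      rw [zpow_sub₀ two_ne_zero, zpow_one, zpow_mul, zpow_natCast]
      norm_num
    have hz' : (4 : ℚ) ^ (2 * (j : ℤ) - 1) = 4 ^ (2 * j) / 4 := by
      rw [zpow_sub₀ four_ne_zero, zpow_one]
      norm_cast
    rw [starTerm, hz, hz', add_zero, Nat.choose_self, Nat.choose_self, Nat.choose_symm_add,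
      Nat.choose_one_right, show 2 * (2 * j) + 2 = 4 * j + 2 by ring]
    field_simp
    ring
  have h3 : ∑ q ∈ antidiagonal (2 * (n - j)), starTerm (2 * j) j q.1 0 q.2 1 =
      ∑ q ∈ antidiagonal (2 * (n - j)), starTerm (2 * j) j q.1 1 q.2 0 := by
    rw [← Finset.Nat.sum_antidiagonal_swap]
    refine sum_congr rfl fun q hq => ?_
    have hq' := mem_antidiagonal.1 hq
    have hs : (-1 : ℚ) ^ q.2 = (-1) ^ q.1 := by
      have : Even (q.1 + q.2) := hq' ▸ even_two_mul _
      exact neg_one_pow_congr (by grind)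
    simp only [starTerm, Prod.fst_swap, Prod.snd_swap, hs, add_zero, Nat.choose_self]
    ring
  rw [sum_add_distrib, sum_add_distrib, h1, h3, sum_antidiagonal_succ_filter, mul_sum (s := antidiagonal _) (f := fun q : ℕ × ℕ => _ * _ * _ * _)]
  simp only [h2, ← mul_sum]
  ring

variable {K : Type*} [Field K] [CharZero K] {R : Type*} [CommRing R] [Algebra K R]
  {Z : h0 K →ₗ[K] R}

/-- All values are found in R as rational multiples of powers of `period Z`; only here does λ
appear. -/
theorem algebraMap_rat_mul_period {L : Type*} [CommRing L] [Algebra K L] [Algebra R L]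
    [IsScalarTower K R L] {lam : L} (hlam : lam ^ 2 = algebraMap R L (period Z)) (q : ℚ) (n : ℕ) :
    algebraMap R L (rat K R q * period Z ^ n) = (q : K) • lam ^ (2 * n) := by
  rw [map_mul, map_pow, ← hlam, ← pow_mul, Algebra.smul_def, rat, RingHom.comp_apply,
    ← IsScalarTower.algebraMap_apply K R L, eq_ratCast]

omit [CharZero K] in
theorem sum_zeta_insertTwos {m n : ℕ} (hmn : 2 * n ≤ m) :
    ∑ c ∈ Finset.Nat.antidiagonalTuple (2 * n + 1) (m - 2 * n), zeta Z (insertTwos n c) =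
      ext Z (altW K m n) := by
  rw [altW, if_pos hmn, altSum, map_sum]
  exact sum_congr rfl fun c _ => zeta_eq_ext Z (admissible_insertTwos n c)

omit [CharZero K] in
theorem sum_zetaStar_insertTwos {m n : ℕ} (hmn : 2 * n ≤ m) :
    ∑ c ∈ Finset.Nat.antidiagonalTuple (2 * n + 1) (m - 2 * n), zetaStar Z (insertTwos n c) =
      ext Z (S K (altW K m n)) := by
  rw [altW, if_pos hmn, altSum, map_sum, map_sum]
  exact sum_congr rfl fun c _ => zetaStar_eq_ext Z (admissible_insertTwos n c)

theorem RegularizedDoubleShuffle.zetaEven_eq (hZ : RegularizedDoubleShuffle Z) (n : ℕ) :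
    zetaEven Z n = rat K R (evenValue n) * period Z ^ n := by
  cases n with
  | zero => 
    simp [zetaEven, evenValue, rat]
  | succ n => rw [zetaEven, if_neg n.succ_ne_zero, hZ.zeta_even]

end

end MZV

/-! ### The theorem -/

theorem mainTheorem5 {K : Type*} [Field K] [CharZero K] {R : Type*} [CommRing R] [Algebra K R]
    (Z : MZV.h0 K →ₗ[K] R) (hZ : MZV.RegularizedDoubleShuffle Z)
    {L : Type*} [CommRing L] [Algebra K L] [Algebra R L] [IsScalarTower K R L]
    (lam : L) (hlam : lam ^ 2 = algebraMap R L (-24 * MZV.zeta Z [2])) :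
    -- (1)
    (∀ n : ℕ, algebraMap R L (MZV.zetaEven Z n) =
      ((-(bernoulli (2 * n)) / (2 * (2 * n).factorial) : ℚ) : K) • lam ^ (2 * n)) ∧
    -- (2)
    (∀ n : ℕ, 1 ≤ n →
      algebraMap R L (MZV.zetaStar Z (List.replicate n 2)) =
        ((((2 : ℚ) ^ (1 - 2 * (n : ℤ)) - 1) / (2 * n).factorial * bernoulli (2 * n) : ℚ) : K) •
          lam ^ (2 * n) ∧
      MZV.zetaStar Z (List.replicate n 2) =
        ((2 * (1 - (2 : ℚ) ^ (1 - 2 * (n : ℤ))) : ℚ) : K) • MZV.zeta Z [2 * n]) ∧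
    -- (3)
    (∀ k : ℕ, 1 ≤ k → ∃ C : ℕ → ℚ, C 0 = 1 ∧
      (∀ n : ℕ, 1 ≤ n → C n = 1 / (2 * (n : ℚ)) * ∑ m ∈ Finset.Icc 1 n,
        (-1) ^ m * ((2 * n * k).choose (2 * m * k) : ℚ) * bernoulli (2 * m * k) * C (n - m)) ∧
      ∀ n : ℕ, algebraMap R L (MZV.zeta Z (List.replicate n (2 * k))) =
        ((C n / (2 * n * k).factorial : ℚ) : K) • lam ^ (2 * n * k)) ∧
    -- (4)
    (∀ k : ℕ, 1 ≤ k → ∃ C : ℕ → ℚ, C 0 = 1 ∧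
      (∀ n : ℕ, 1 ≤ n → C n = -(1 / (2 * (n : ℚ))) * ∑ m ∈ Finset.Icc 1 n,
        ((2 * n * k).choose (2 * m * k) : ℚ) * bernoulli (2 * m * k) * C (n - m)) ∧
      ∀ n : ℕ, algebraMap R L (MZV.zetaStar Z (List.replicate n (2 * k))) =
        ((C n / (2 * n * k).factorial : ℚ) : K) • lam ^ (2 * n * k)) ∧
    -- (5)
    (∀ m n : ℕ, 2 * n ≤ m →
      algebraMap R L (∑ c ∈ Finset.Nat.antidiagonalTuple (2 * n + 1) (m - 2 * n),
          MZV.zeta Z (MZV.insertTwos n c)) =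
        (((-1) ^ m * (2 / (4 ^ m * (2 * m + 2).factorial)) * (m + 1).choose (2 * n + 1) : ℚ) : K) •
          lam ^ (2 * m)) ∧
    (∀ n : ℕ, algebraMap R L (MZV.zeta Z (MZV.threeOne n)) =
      ((1 / ((2 : ℚ) ^ (4 * (n : ℤ) - 1) * (4 * n + 2).factorial) : ℚ) : K) • lam ^ (4 * n)) ∧
    (∀ n : ℕ, algebraMap R L (∑ p ∈ Finset.range (2 * n + 1),
        MZV.zeta Z ((MZV.threeOne n).insertIdx p 2)) =
      ((-(1 / (4 ^ (2 * n + 1) * (4 * n + 3).factorial)) : ℚ) : K) • lam ^ (4 * n + 2)) ∧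
    -- (6)
    (∀ m n : ℕ, 2 * n ≤ m →
      algebraMap R L (∑ c ∈ Finset.Nat.antidiagonalTuple (2 * n + 1) (m - 2 * n),
          MZV.zetaStar Z (MZV.insertTwos n c)) =
        ((∑ i ∈ Finset.range (m + 1), ∑ j ∈ Finset.range (m + 1), ∑ k ∈ Finset.range (m + 1),
          ∑ l ∈ Finset.range (m + 1), ∑ u ∈ Finset.range (m + 1), ∑ v ∈ Finset.range (m + 1),
          (if 2 * j + k + u = 2 * n ∧ i + k + l + u + v = m ∧ 2 * j ≤ i then
            (-1) ^ k * ((k + l).choose k : ℚ) * ((u + v).choose u : ℚ) *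
              ((i + 1).choose (2 * j + 1) : ℚ) *
              (MZV.beta (k + l) * MZV.beta (u + v) /
                ((2 : ℚ) ^ (2 * (i : ℤ) - 1) * (2 * i + 2).factorial))
          else 0) : ℚ) : K) • lam ^ (2 * m)) ∧
    (∀ n : ℕ, algebraMap R L (MZV.zetaStar Z (MZV.threeOne n)) =
      ((∑ j ∈ Finset.range (n + 1), ∑ q ∈ Finset.HasAntidiagonal.antidiagonal (2 * (n - j)),
        (-1) ^ q.1 * (MZV.beta q.1 * MZV.beta q.2 /
          ((2 : ℚ) ^ (4 * (j : ℤ) - 1) * (4 * j + 2).factorial)) : ℚ) : K) • lam ^ (4 * n)) ∧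
    (∀ n : ℕ, algebraMap R L (∑ p ∈ Finset.range (2 * n + 1),
        MZV.zetaStar Z ((MZV.threeOne n).insertIdx p 2)) =
      ((∑ j ∈ Finset.range (n + 1),
        (1 / (4 ^ (2 * j + 1) * (4 * j + 3).factorial) *
            ∑ q ∈ Finset.HasAntidiagonal.antidiagonal (2 * (n - j)), (-1) ^ q.1 * MZV.beta q.1 * MZV.beta q.2 -
          1 / ((4 : ℚ) ^ (2 * (j : ℤ) - 1) * (4 * j + 2).factorial) *
            ∑ q ∈ (Finset.HasAntidiagonal.antidiagonal (2 * (n - j) + 1)).filter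
              (fun q => 1 ≤ q.1),
              (-1) ^ q.1 * (q.1 : ℚ) * MZV.beta q.1 * MZV.beta q.2) : ℚ) : K) •
        lam ^ (4 * n + 2)) := by
  have hl := MZV.algebraMap_rat_mul_period hlam
  refine ⟨fun n => ?_, fun n hn => ⟨?_, ?_⟩, fun k hk => ?_, fun k hk => ?_, fun m n hmn => ?_,
    fun n => ?_, fun n => ?_, fun m n hmn => ?_, fun n => ?_, fun n => ?_⟩
  · rw [hZ.zetaEven_eq, hl]; rfl
  · rw [hZ.zetaStar_two, hl]; rfl
  · obtain ⟨j, rfl⟩ := Nat.exists_eq_add_of_le' hn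
    rw [hZ.zetaStar_two, hZ.zeta_even, ← MZV.two_mul_evenValue, map_mul, mul_assoc,
      Algebra.smul_def]
    simp only [MZV.rat, RingHom.comp_apply, eq_ratCast]
  -- The witness C is the Newton solution times (2nk)!, which turns the recursion into its binomial
  -- form. The star case differs only in having the constant sign -1.
  · refine ⟨_, ?_, fun n hn => MZV.newtonSeq_evenValue (fun m => (-1) ^ m) (k := k) hn
      fun m => rfl, fun n => ?_⟩
    · simp [MZV.newtonSeq_zero]
    · rw [hZ.zeta_replicate_even hk, hl, mul_div_cancel_right₀ _ (by positivity),
        mul_comm k n, mul_assoc]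
  · refine ⟨_, ?_, fun n hn => (MZV.newtonSeq_evenValue (fun _ => -1) (k := k) hn
      fun m => rfl).trans ?_, fun n => ?_⟩
    · simp [MZV.newtonSeq_zero]
    · simp only [neg_mul, one_mul, Finset.sum_neg_distrib, mul_neg]
    · rw [hZ.zetaStar_replicate_even hk, hl, mul_div_cancel_right₀ _ (by positivity),
        mul_comm k n, mul_assoc]
  · rw [MZV.sum_zeta_insertTwos hmn, hZ.ext_altW, hl]; rfl
  · have := MZV.sum_zeta_insertTwos (Z := Z) (le_refl (2 * n))
    rw [Nat.sub_self, MZV.sum_insertTwos_zero] at this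
    rw [this, hZ.ext_altW, hl, MZV.altValue_two_mul, show 2 * (2 * n) = 4 * n by ring]
  · have := MZV.sum_zeta_insertTwos (Z := Z) (Nat.le_succ (2 * n))
    rw [Nat.succ_eq_add_one, Nat.add_sub_cancel_left, MZV.sum_insertTwos_one] at this
    rw [this, hZ.ext_altW, hl, MZV.altValue_two_mul_add_one,
      show 2 * (2 * n + 1) = 4 * n + 2 by ring]
  · rw [MZV.sum_zetaStar_insertTwos hmn, hZ.ext_S_altW hmn, hl, MZV.sum_filter_starIndices]
    rfl
  · have := MZV.sum_zetaStar_insertTwos (Z := Z) (le_refl (2 * n))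
    rw [Nat.sub_self, MZV.sum_insertTwos_zero] at this
    rw [this, hZ.ext_S_altW le_rfl, hl, MZV.sum_starTerm_two_mul,
      show 2 * (2 * n) = 4 * n by ring]
  · have := MZV.sum_zetaStar_insertTwos (Z := Z) (Nat.le_succ (2 * n))
    rw [Nat.succ_eq_add_one, Nat.add_sub_cancel_left, MZV.sum_insertTwos_one] at this
    rw [this, hZ.ext_S_altW (Nat.le_succ (2 * n)), hl, MZV.sum_starTerm_two_mul_add_one,
      show 2 * (2 * n + 1) = 4 * n + 2 by ring]
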